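/- Let $\Omega$ be an algebraically closed field and $F\subseteq\Omega$ a subfield. For a finite group $X$ and $\theta\in\operatorname{Irr}_\Omega X$, let $F(\theta)$ be the field generated over $F$ by the values of $\theta$, let $e_{(\theta,F)}$ be the central primitive idempotent $e$ of $FX$ with $\theta(FXe)\neq0$, and put $e_\theta=e_{(\theta,\Omega)}$. Write $a^h=h^{-1}ah$. A \emph{basic configuration} $(G,H,K,L,\theta,\phi)$ over $F$ consists of a finite group $G=HK$ with $K\trianglelefteq G$, $H\le G$, $L=H\cap K$, and characters $\theta,\phi$ of simple projective modules over $\Omega K$ and $\Omega L$ respectively, such that $\phi$ occurs in $\theta_L$ with positive multiplicity, $F(\phi)=F(\theta)$, and for every $h\in H$ there is $\gamma\in\operatorname{Gal}(F(\phi)/F)$ with $\theta^{h\gamma}=\theta$ and $\phi^{h\gamma}=\phi$. For the data $(G,H,K,L,\theta,\phi)$ put $$i=\sum_{\gamma\in\operatorname{Gal}(F(\theta)/F)}e_\phi^\gamma e_\theta^\gamma,\qquad S=(iFKi)^L,\qquad Z=\mathrm Z(S),\qquad Z_0=Z^H ;$$ the algebra $S$ has unit element $i$. A \emph{scalar form}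 of $S$ is a subalgebra $S_0\subseteq S$ with $\mathrm Z(S_0)=Z_0$ and $S=S_0Z$; for $h\in H$ let then $\varepsilon(h)\colon S\to S$ be given by $(s_0z)^{\varepsilon(h)}=s_0z^h$ for $s_0\in S_0$, $z\in Z$. A \emph{magic crossed representation} with respect to $S_0$ is a map $\sigma\colon H/L\to S^*$ such that $\sigma(x)^{\varepsilon(y)}\sigma(y)=\sigma(xy)$ and $s^x=\sigma(x)^{-1}s^{\varepsilon(x)}\sigma(x)$ for all $x,y\in H$ and $s\in S$. For a subgroup $V$ with $K\le V\le G$ and $\chi\in\Omega[\operatorname{Irr}(V\mid e_{(\theta,F)})]$ (the span of the irreducible characters $\chi$ of $V$ over $\Omega$ with $\chi(e_{(\theta,F)})\ne0$), define a function $\chi^{\iota(\sigma)}$ on $V\cap H$ by $$\chi^{\iota(\sigma)}(h)=\chi\big(s_0\,\sigma(Lh)^{-1}h\big),$$ where $s_0\in S_0$ has reduced trace $\operatorname{tr}_{S_0/Z_0}(s_0)=1$. (When $F\le\Omega=\mathbb C$, this is the usual isometry $\mathbb C[\operatorname{Irr}(V\mid e_{(\theta,F)})]\to\mathbb C[\operatorname{Irr}(V\cap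 H\mid e_{(\phi,F)})]$ induced by $\sigma$.) \textbf{Proposition.} Let $G$ be a finite group, $H\le U\le G$, and let $(G,U,K,N,\theta,\eta)$ and $(U,H,N,L,\eta,\phi)$ be basic configurations over $F$. Let $S_1,S_2,S$ be the algebras associated as above with $(G,U,K,N,\theta,\eta)$, $(U,H,N,L,\eta,\phi)$ and $(G,H,K,L,\theta,\phi)$. Suppose that $S_{10}\subseteq S_1$, $S_{20}\subseteq S_2$ and $S_0\subseteq S$ are scalar forms with $S_{10}S_{20}\subseteq S_0$, and that $\sigma_1\colon U/N\to S_1$ and $\sigma_2\colon H/L\to S_2$ are magic crossed representations with respect to $S_{10}$ and $S_{20}$. Set $j=\sum_{\gamma\in\operatorname{Gal}(F(\theta)/F)}(e_\theta e_\eta e_\phi)^\gamma$. Then there is a magic crossed representation $\sigma\colon H/L\to S$ for $(G,H,K,L,\theta,\phi)$, with respect to $S_0$, such that $$\sigma(h)\,j=\sigma_1(h)\,\sigma_2(h)\qquad\text{for all }h\in H,$$ and such that $\iota(\sigma)=\iota(\sigma_1)\iota(\sigma_2)$, that is, for every $V$ with $K\le V\le G$ and every $\chi\in\Omega[\operatorname{Irr}(V\mid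 e_{(\theta,F)})]$ we have $\chi^{\iota(\sigma)}=\big(\chi^{\iota(\sigma_1)}\big)^{\iota(\sigma_2)}$ on $V\cap H$, where $\iota(\sigma_2)$ is taken for the subgroup $V\cap U$ of $U$. -/

import Mathlib

noncomputable section

namespace MagicRep

/-! ### Group algebras, characters and their idempotents

`Γ` is a finite ambient group, `F ⊆ Ω` are fields with `Ω` algebraically closed. The group algebras
`F K`, for subgroups `K` of `Γ`, are all realised inside the one algebra `Ω Γ`. -/

section Basic

variable {Γ : Type*} [Group Γ] (F : Type*) {Ω : Type*} [Field F] [Field Ω] [Algebra F Ω]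

/-- The group algebra `F K` of a subgroup `K ≤ Γ`, as an `F`-subalgebra of `Ω Γ`. -/
def grpAlg (K : Subgroup Γ) : Subalgebra F (MonoidAlgebra Ω Γ) :=
  Algebra.adjoin F ((fun k : Γ => MonoidAlgebra.single k (1 : Ω)) '' (K : Set Γ))

/-- The value `χ(a)` at `a ∈ Ω V` of the `Ω`-linear extension of a function `χ : V → Ω`. -/
def charEval {V : Subgroup Γ} (χ : V → Ω) (a : MonoidAlgebra Ω Γ) : Ω :=
  ∑ᶠ v : V, a.coeff (v : Γ) * χ v

/-- `χ ∈ Irr V`: the function `χ` is the character of a simple `Ω V`-module. -/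
def IsIrrChar {V : Subgroup Γ} (χ : V → Ω) : Prop :=
  ∃ (n : ℕ) (ρ : Representation Ω V (Fin n → Ω)),
    IsSimpleModule (MonoidAlgebra Ω V) ρ.asModule ∧ ρ.character = χ

/-- `e` is a primitive idempotent of the center of `B`. -/
def IsCentralPrimitiveIdempotent {R A : Type*} [CommSemiring R] [Semiring A] [Algebra R A]
    (B : Subalgebra R A) (e : A) : Prop :=
  e ∈ B ∧ (∀ b ∈ B, e * b = b * e) ∧ e * e = e ∧ e ≠ 0 ∧
    ∀ f ∈ B, (∀ b ∈ B, f * b = b * f) → f * f = f → f * e = f → f = 0 ∨ f = e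

/-- The idempotent `e_(θ,F)`: the central primitive idempotent `e` of `F K` for which
`θ(F K e) ≠ 0`. The idempotent `e_θ` is `e_(θ,Ω)`. -/
def charIdem {K : Subgroup Γ} (θ : K → Ω) : MonoidAlgebra Ω Γ :=
  Classical.epsilon fun e =>
    IsCentralPrimitiveIdempotent (grpAlg (Ω := Ω) F K) e ∧
      ∃ a ∈ grpAlg (Ω := Ω) F K, charEval θ (a * e) ≠ 0

/-- The space `Ω[Irr(V ∣ e)]`, spanned by the irreducible characters `χ` of `V` with
`χ(e) ≠ 0`. -/
def charSpan (V : Subgroup Γ) (e : MonoidAlgebra Ω Γ) : Submodule Ω (V → Ω) :=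
  Submodule.span Ω {χ | IsIrrChar χ ∧ charEval χ e ≠ 0}

/-- The field of values `F(θ)`. -/
def valueField {K : Subgroup Γ} (θ : K → Ω) : IntermediateField F Ω :=
  IntermediateField.adjoin F (Set.range θ)

/-- The right conjugation action `a ^ h = h⁻¹ a h`. -/
def conj (a : MonoidAlgebra Ω Γ) (h : Γ) : MonoidAlgebra Ω Γ :=
  MonoidAlgebra.single h⁻¹ 1 * a * MonoidAlgebra.single h 1

variable {F}

open Classical in
/-- The application of `γ ∈ Gal(E/F)` to an element of `E ⊆ Ω` (with junk value `0` outside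
`E`). -/
def galApply {E : IntermediateField F Ω} (γ : E ≃ₐ[F] E) (z : Ω) : Ω :=
  if hz : z ∈ E then (γ ⟨z, hz⟩ : Ω) else 0

theorem galApply_zero {E : IntermediateField F Ω} (γ : E ≃ₐ[F] E) : galApply γ (0 : Ω) = 0 := by
  unfold galApply
  split_ifs with h
  · have h0 : (⟨0, h⟩ : E) = 0 := rfl
    rw [h0, map_zero]; rfl
  · rfl

/-- The natural action of `γ ∈ Gal(E/F)` on elements of `E Γ ⊆ Ω Γ`; it fixes `Γ`. -/
def galAct {E : IntermediateField F Ω} (γ : E ≃ₐ[F] E) (a : MonoidAlgebra Ω Γ) :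
    MonoidAlgebra Ω Γ :=
  MonoidAlgebra.ofCoeff (Finsupp.mapRange (galApply γ) (galApply_zero γ) a.coeff)

end Basic

/-! ### Configurations -/

/-- The data `(G, H, K, L, θ, φ)`: subgroups of the ambient group, and functions on `K` and on `L`
with values in `Ω`. The conditions on them are collected in `IsBasic`. -/
structure Config (Γ Ω : Type*) [Group Γ] where
  G : Subgroup Γ
  H : Subgroup Γ
  K : Subgroup Γ
  L : Subgroup Γ
  θ : K → Ω
  φ : L → Ω

namespace Config

variable {Γ : Type*} [Group Γ] (F : Type*) {Ω : Type*} [Field F] [Field Ω] [Algebra F Ω]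

/-- The basic hypotheses on a configuration `(G, H, K, L, θ, φ)` over the field `F`:
`K ⊴ G`, `H ≤ G`, `G = HK`, `L = H ∩ K`; the functions `θ` and `φ` are the characters of simple
projective modules over `Ω K` and `Ω L`; the multiplicity of `φ` in the restriction of `θ` to `L`
is positive; `F(φ) = F(θ)`; and `θ`, `φ` are simultaneously semi-invariant in `H` over `F`. -/
structure IsBasic (c : Config Γ Ω) : Prop where
  K_le : c.K ≤ c.G
  H_le : c.H ≤ c.G
  normal : ∀ g ∈ c.G, ∀ k ∈ c.K, g * k * g⁻¹ ∈ c.K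
  factor : ∀ g ∈ c.G, ∃ h ∈ c.H, ∃ k ∈ c.K, g = h * k
  L_eq : c.L = c.H ⊓ c.K
  /-- `ρ` affords `θ`, `τ` affords `φ`, and `f` is a nonzero `L`-homomorphism from `τ` to the
  restriction of `ρ` (as `τ` is simple and projective, the dimension of the space of these
  homomorphisms is the multiplicity). -/
  chars : ∃ (m n : ℕ) (ρ : Representation Ω c.K (Fin m → Ω))
    (τ : Representation Ω c.L (Fin n → Ω)) (f : (Fin n → Ω) →ₗ[Ω] (Fin m → Ω)),
    IsSimpleModule (MonoidAlgebra Ω c.K) ρ.asModule ∧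
    Module.Projective (MonoidAlgebra Ω c.K) ρ.asModule ∧ ρ.character = c.θ ∧
    IsSimpleModule (MonoidAlgebra Ω c.L) τ.asModule ∧
    Module.Projective (MonoidAlgebra Ω c.L) τ.asModule ∧ τ.character = c.φ ∧
    f ≠ 0 ∧ ∀ (l : c.L) (k : c.K), (k : Γ) = (l : Γ) → ∀ w, f (τ l w) = ρ k (f w)
  values : valueField F c.φ = valueField F c.θ
  /-- `θ ^ (hγ) = θ` and `φ ^ (hγ) = φ`, where `θ ^ h (k) = θ (h k h⁻¹)`. -/
  semiInvariant : ∀ h ∈ c.H, ∃ γ : valueField F c.θ ≃ₐ[F] valueField F c.θ,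
    (∀ k k' : c.K, (k' : Γ) = h * k * h⁻¹ → galApply γ (c.θ k') = c.θ k) ∧
    (∀ l l' : c.L, (l' : Γ) = h * l * h⁻¹ → galApply γ (c.φ l') = c.φ l)

/-- The idempotent `i = ∑_γ e_φ ^ γ e_θ ^ γ`, with `γ` running over `Gal(F(θ)/F)`. -/
def i (c : Config Γ Ω) : MonoidAlgebra Ω Γ :=
  ∑ᶠ γ : valueField F c.θ ≃ₐ[F] valueField F c.θ,
    galAct γ (charIdem Ω c.φ) * galAct γ (charIdem Ω c.θ)

/-- The algebra `S = (i F K i) ^ L`: the elements of `i F K i` commuting with `L`.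
Its unit element is `i`. -/
def S (c : Config Γ Ω) : Set (MonoidAlgebra Ω Γ) :=
  {s | (∃ a ∈ grpAlg (Ω := Ω) F c.K, s = c.i F * a * c.i F) ∧ ∀ l ∈ c.L, conj s l = s}

/-- The center `Z` of `S`. -/
def Z (c : Config Γ Ω) : Set (MonoidAlgebra Ω Γ) :=
  {z | z ∈ c.S F ∧ ∀ s ∈ c.S F, z * s = s * z}

/-- The elements `Z₀ = Z ^ H` of `Z` that are fixed by `H`. -/
def Z₀ (c : Config Γ Ω) : Set (MonoidAlgebra Ω Γ) :=
  {z | z ∈ c.Z F ∧ ∀ h ∈ c.H, conj z h = z}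

variable {F}

/-- `S₀` is a subalgebra of `S` with center `Z₀` such that `S = S₀ Z`. (Then `S₀` is a central
simple `Z₀`-algebra, and `S` is obtained from it by extension of scalars from `Z₀` to `Z`.) -/
structure IsScalarForm (c : Config Γ Ω) (S₀ : NonUnitalSubalgebra F (MonoidAlgebra Ω Γ)) :
    Prop where
  subset : (S₀ : Set (MonoidAlgebra Ω Γ)) ⊆ c.S F
  center : {z | z ∈ S₀ ∧ ∀ s ∈ S₀, z * s = s * z} = c.Z₀ F
  span : (Submodule.span F {x | ∃ s ∈ S₀, ∃ z ∈ c.Z F, x = s * z} : Set (MonoidAlgebra Ω Γ))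
    = c.S F

/-- `σ : H/L → S` is a magic crossed representation with respect to `S₀ ⊆ S`.
For `h ∈ H`, the map `ε h` is the one given on `S = S₀ Z` by `(s₀ z) ^ ε(h) = s₀ z ^ h`; only its
values on `S` matter, and these are determined by `mul`. -/
def IsMagicCrossed (c : Config Γ Ω) (S₀ : NonUnitalSubalgebra F (MonoidAlgebra Ω Γ))
    (σ : c.H ⧸ c.L.subgroupOf c.H → MonoidAlgebra Ω Γ) : Prop :=
  c.IsScalarForm S₀ ∧
  (∀ x, σ x ∈ c.S F ∧ ∃ t ∈ c.S F, t * σ x = c.i F ∧ σ x * t = c.i F) ∧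
  ∃ ε : c.H → MonoidAlgebra Ω Γ →ₗ[F] MonoidAlgebra Ω Γ,
    (∀ h : c.H, ∀ s ∈ S₀, ∀ z ∈ c.Z F, ε h (s * z) = s * conj z h) ∧
    (∀ x y : c.H, ε y (σ x) * σ y = σ ((x * y : c.H))) ∧
    (∀ x : c.H, ∀ s ∈ c.S F, σ x * conj s x = ε x s * σ x)

/-- `z` is the reduced trace of `s`, for a central simple algebra `S₀` over its center: `ρ` is a
homomorphism to a full matrix algebra over the splitting field `Ω` whose image spans the matrix
algebra (that is, it comes from an isomorphism of `S₀ ⊗ Ω` with this matrix algebra, the tensor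
product taken over the center of `S₀`), and the matrix trace of `ρ(s)` is the scalar by which the
central element `z` acts. -/
def HasReducedTrace (S₀ : NonUnitalSubalgebra F (MonoidAlgebra Ω Γ)) (s z : S₀) : Prop :=
  (∀ t : S₀, z * t = t * z) ∧
  ∃ (n : ℕ) (ρ : S₀ →ₙₐ[F] Matrix (Fin n) (Fin n) Ω), 0 < n ∧
    Submodule.span Ω (Set.range ρ) = ⊤ ∧ ρ z = Matrix.scalar (Fin n) (Matrix.trace (ρ s))

/-- An element `s₀ ∈ S₀` of reduced trace `1` (the unit element of `S₀` is `i`). -/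
def traceOne (c : Config Γ Ω) (S₀ : NonUnitalSubalgebra F (MonoidAlgebra Ω Γ)) :
    MonoidAlgebra Ω Γ :=
  Classical.epsilon fun s₀ =>
    ∃ s z : S₀, (s : MonoidAlgebra Ω Γ) = s₀ ∧ (z : MonoidAlgebra Ω Γ) = c.i F ∧
      HasReducedTrace S₀ s z

variable (F) in
/-- The inverse of `s` in `S`. -/
def invS (c : Config Γ Ω) (s : MonoidAlgebra Ω Γ) : MonoidAlgebra Ω Γ :=
  Classical.epsilon fun t => t ∈ c.S F ∧ t * s = c.i F ∧ s * t = c.i F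

/-- The correspondence `ι(σ)` for a subgroup `V` with `K ≤ V ≤ G`:
`χ ^ ι (h) = χ(s₀ σ(Lh)⁻¹ h)` for `h ∈ V ∩ H`. -/
def iota (c : Config Γ Ω) (S₀ : NonUnitalSubalgebra F (MonoidAlgebra Ω Γ))
    (σ : c.H ⧸ c.L.subgroupOf c.H → MonoidAlgebra Ω Γ) (V : Subgroup Γ) (χ : V → Ω) :
    (V ⊓ c.H : Subgroup Γ) → Ω := fun h =>
  charEval χ (c.traceOne S₀ * c.invS F (σ (⟨h, h.2.2⟩ : c.H)) *
    MonoidAlgebra.single (h : Γ) 1)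

end Config

/-- The idempotent `j = ∑_γ (e_θ e_η e_φ) ^ γ`, with `γ` running over `Gal(F(θ)/F)`. -/
def jIdem {Γ : Type*} [Group Γ] (F : Type*) {Ω : Type*} [Field F] [Field Ω] [Algebra F Ω]
    {K N L : Subgroup Γ} (θ : K → Ω) (η : N → Ω) (φ : L → Ω) : MonoidAlgebra Ω Γ :=
  ∑ᶠ γ : valueField F θ ≃ₐ[F] valueField F θ,
    galAct γ (charIdem Ω θ * charIdem Ω η * charIdem Ω φ)

end MagicRep

end

/-!
# Composition of magic crossed representations

Let `E = F(θ) = F(η) = F(φ)`. The idea is to turn every algebra in sight into a form of a full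
matrix algebra over `Ω`, in which it is visible that `σ₁ σ₂`, defined on a corner of `S₀`, extends
uniquely to all of `S₀`.

*Splitting.* A simple projective module satisfies Schur's orthogonality relations with a nonzero
constant, so its block `Ω K e_θ` is a full matrix algebra, with trace `θ` (`exists_isSplit`). The
field `E` lies in a cyclotomic extension of `F`, hence is Galois over `F` (`isGalois_valueField`),
and the Galois conjugates of `e_θ` are orthogonal (`IsSplit.galAct_mul_eq_zero`).

*Compression.* Let `f` be a primitive idempotent of `Ω L e_φ`. The map `x ↦ f x f e_θ` sends the
centralizer `(Ω K)^L` multiplicatively onto a full matrix algebra (`Pair.P`); it is injective on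
`S`, and the image of a scalar form `S₀` spans. So `S₀` is a simple ring, its reduced trace is the
trace `t` of the compression (`Config.IsScalarForm.traceOne_spec`), and subspaces stable under the
center can be compared after extension of scalars (`IsMatrixForm.mem_of_mem_span`, by the
Artin-Whaples theorem). The trace is characterized by `θ(x e_φ y) = t(x) φ(y)` for `y ∈ Ω L`
(`Pair.charEval_mul`), which makes it multiplicative in towers (`Tower.t_mul`).

*The lift.* The idempotent `j` is the product `i₁ i₂` of the units of `S₁` and `S₂`. It lies in `S₀`
and is nonzero, thus `S₀ j S₀ = S₀` (`Tower.exists_sum_eq_i`), and the corner `j S₀ j` is spanned by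
`S₁₀ S₂₀` (`Tower.corner_mem`, a double centralizer argument). Since `S₁` and `S₂` commute, the
element `σ₁(h) σ₂(h)` intertwines the inclusion of `j S₀ j` with conjugation by `h`. As `j` is full,
it extends to exactly one intertwiner on `S₀` (`Tower.exists_lift`, `Tower.lift_unique`); this is
`σ(h)`. The same lift serves all representatives of a coset of `L`, and uniqueness yields the cocycle
identity (`Tower.isMagicCrossed`).

*The correspondences.* Let `s`, `s₁`, `s₂` have reduced trace `1` in `S₀`, `S₁₀`, `S₂₀`. Both sides
of the last assertion are of the form `χ(x σ(h)⁻¹ h)`, with `x = s` and `x = s₁ s₂`, which have the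
same reduced trace. This value depends only on the reduced trace of `x`
(`Config.IsScalarForm.charEval_eq_of_t_eq`): if `h` centralizes the center of `S`, it vanishes on
commutators in `x`, and otherwise it vanishes identically.
-/

noncomputable section

set_option linter.unusedSectionVars false

namespace MagicRep

/-! ### Simple rings with a spanning matrix representation -/

section SimpleRing

/-- The full matrix ring is prime. -/
theorem matrix_eq_zero_of_mul_mul_eq_zero {n Ω : Type*} [Fintype n] [DecidableEq n] [Field Ω]
    (X : Matrix n n Ω) (h : ∀ Y : Matrix n n Ω, X * Y * X = 0) : X = 0 := by
  ext a b
  have := congrFun (congrFun (h (Matrix.single b a 1)) a) b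
  simpa [Matrix.mul_apply, Matrix.single, Finset.sum_ite_eq, ite_and] using this

variable {R Ω : Type*} [Ring R] [Field Ω] {n : Type*} [Fintype n] [DecidableEq n]

theorem commute_of_span_eq_top {P : R →+* Matrix n n Ω}
    (hP : Submodule.span Ω (Set.range P) = ⊤) {X : Matrix n n Ω}
    (h : ∀ r, X * P r = P r * X) (Y : Matrix n n Ω) : X * Y = Y * X := by
  have hY : Y ∈ Submodule.span Ω (Set.range P) := hP ▸ Submodule.mem_top
  induction hY using Submodule.span_induction with
  | mem x hx => obtain ⟨r, rfl⟩ := hx; exact h r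
  | zero => simp
  | add x y _ _ hx hy => rw [mul_add, hx, hy, add_mul]
  | smul a x _ hx => rw [mul_smul_comm, hx, smul_mul_assoc]

theorem exists_scalar_of_commute [Nonempty n] {X : Matrix n n Ω} (h : ∀ Y, X * Y = Y * X) :
    ∃ c : Ω, X = Matrix.scalar n c := by
  have hX : X ∈ Subalgebra.center Ω (Matrix n n Ω) :=
    Subalgebra.mem_center_iff.2 fun b => (h b).symm
  rw [Algebra.IsCentral.center_eq_bot, Algebra.mem_bot] at hX
  obtain ⟨c, hc⟩ := hX
  exact ⟨c, hc.symm⟩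

theorem idempotent_commute_eq_zero_or_one [Nonempty n] {X : Matrix n n Ω}
    (h : ∀ Y, X * Y = Y * X) (hX : X * X = X) : X = 0 ∨ X = 1 := by
  obtain ⟨c, rfl⟩ := exists_scalar_of_commute h
  rw [← map_mul] at hX
  have hc : c * c = c := by
    obtain ⟨a⟩ := ‹Nonempty n›
    simpa using congrFun (congrFun hX a) a
  have h0 : c * (c - 1) = 0 := by rw [mul_sub, hc, mul_one, sub_self]
  rcases mul_eq_zero.1 h0 with h | h
  · left; simp [h]
  · right; simp [sub_eq_zero.1 h]

/-- An Artinian ring with a faithful matrix representation whose image spans the matrix algebra is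
simple: such a ring is semiprime, and its central idempotents are trivial. -/
theorem isSimpleRing_of_injective_of_span_eq_top [Nonempty n] [IsArtinianRing R]
    (P : R →+* Matrix n n Ω) (hinj : Function.Injective P)
    (hP : Submodule.span Ω (Set.range P) = ⊤) : IsSimpleRing R := by
  have hprime : ∀ x : R, (∀ y, x * y * x = 0) → x = 0 := by
    intro x hx
    apply hinj
    rw [map_zero]
    refine matrix_eq_zero_of_mul_mul_eq_zero _ fun Y => ?_
    have hY : Y ∈ Submodule.span Ω (Set.range P) := hP ▸ Submodule.mem_top
    induction hY using Submodule.span_induction with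
    | mem z hz => obtain ⟨r, rfl⟩ := hz; rw [← map_mul, ← map_mul, hx, map_zero]
    | zero => simp
    | add x y _ _ hx hy => rw [mul_add, add_mul, hx, hy, add_zero]
    | smul a x _ hx => rw [mul_smul_comm, smul_mul_assoc, hx, smul_zero]
  have hnon : Nontrivial R := by
    refine ⟨0, 1, fun h => ?_⟩
    have := congrArg P h
    rw [map_zero, map_one] at this
    exact zero_ne_one this
  have hss : IsSemisimpleRing R := by
    rw [IsArtinianRing.isSemisimpleRing_iff_jacobson]
    obtain ⟨k, hk⟩ := IsSemiprimaryRing.isNilpotent (R := R)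
    by_contra hne
    -- the last nonzero power of the radical squares to zero
    have hex : ∃ k, Ring.jacobson R ^ (k + 1) = 0 := by
      refine ⟨k, ?_⟩
      rw [Ideal.IsTwoSided.pow_succ, hk, mul_zero]
    classical
    have hl := Nat.find_spec hex
    set l := Nat.find hex
    have hl0 : l ≠ 0 := by
      intro h0
      rw [h0, zero_add, Submodule.pow_one] at hl
      exact hne hl
    obtain ⟨m, hm⟩ := Nat.exists_eq_succ_of_ne_zero hl0
    have hmn : Ring.jacobson R ^ (m + 1) ≠ 0 := Nat.find_min hex (by omega : m < l)
    apply hmn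
    rw [Submodule.zero_eq_bot, eq_bot_iff]
    intro x hx
    refine hprime x fun y => ?_
    have h1 : y * x ∈ Ring.jacobson R ^ (m + 1) := Ideal.mul_mem_left _ _ hx
    have h2 : x * (y * x) ∈ Ring.jacobson R ^ (m + 1) * Ring.jacobson R ^ (m + 1) :=
      Ideal.mul_mem_mul hx h1
    rw [← Ideal.IsTwoSided.pow_add] at h2
    have h3 : Ring.jacobson R ^ (m + 1 + (m + 1)) ≤ Ring.jacobson R ^ (l + 1) :=
      Ideal.pow_le_pow_right (by omega)
    have h4 := h3 h2
    rw [hl] at h4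
    rw [mul_assoc]
    exact h4
  rw [isSimpleRing_iff_isTwoSided_imp]
  refine ⟨hnon, fun I hI => ?_⟩
  obtain ⟨e, he, rfl⟩ := IsSemisimpleRing.ideal_eq_span_idempotent I
  have he' : e * e = e := he
  have hxe : ∀ x ∈ Ideal.span {e}, x * e = x := by
    intro x hx
    obtain ⟨a, rfl⟩ := Ideal.mem_span_singleton'.1 hx
    rw [mul_assoc, he']
  have h1 : ∀ r, e * r * e = e * r := fun r =>
    hxe _ (hI.mul_mem_of_left r (Ideal.mem_span_singleton_self e))
  -- the square of `(1 - e) R e` is zero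
  have h2 : ∀ r, e * r * e = r * e := by
    intro r
    have : (1 - e) * r * e = 0 := by
      refine hprime _ fun y => ?_
      have h3 : e * (y * (1 - e)) = 0 := by
        rw [← mul_assoc, mul_sub, mul_one, h1, sub_self]
      calc (1 - e) * r * e * y * ((1 - e) * r * e)
          = (1 - e) * r * (e * (y * (1 - e))) * r * e := by noncomm_ring
        _ = 0 := by rw [h3]; simp
    rw [sub_mul, sub_mul, one_mul, sub_eq_zero] at this
    exact this.symm
  have hcent : ∀ Y, P e * Y = Y * P e := commute_of_span_eq_top hP fun r => by
    rw [← map_mul, ← map_mul, ← h1, h2]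
  rcases idempotent_commute_eq_zero_or_one hcent (by rw [← map_mul, he']) with h | h
  · left
    rw [Ideal.span_singleton_eq_bot]
    exact hinj (h.trans (map_zero P).symm)
  · right
    rw [hinj (h.trans (map_one P).symm), Ideal.span_singleton_one]

/-- The extension to `M ⊗ R` of a homomorphism from `R` to an algebra over the field `M`. -/
def extendScalars {k R M A : Type*} [Field k] [Ring R] [Algebra k R] [Field M] [Algebra k M]
    [Ring A] [Algebra M A] [Algebra k A] [IsScalarTower k M A] (P : R →ₐ[k] A) :
    TensorProduct k M R →ₐ[M] A :=
  Algebra.TensorProduct.lift (Algebra.ofId M A) P fun c r => Algebra.commutes c (P r)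

theorem extendScalars_tmul {k R M A : Type*} [Field k] [Ring R] [Algebra k R] [Field M]
    [Algebra k M] [Ring A] [Algebra M A] [Algebra k A] [IsScalarTower k M A] (P : R →ₐ[k] A)
    (c : M) (r : R) : extendScalars P (TensorProduct.tmul k c r) = algebraMap M A c * P r :=
  Algebra.TensorProduct.lift_tmul ..

/-- The Artin-Whaples theorem: a central simple `k`-algebra inside an algebra over an extension field
`M` of `k` is linearly disjoint from `M` over `k`. -/
theorem extendScalars_injective {k R M A : Type*} [Field k] [Ring R] [IsSimpleRing R] [Algebra k R]
    (hk : ∀ x : R, (∀ y, x * y = y * x) → ∃ c : k, algebraMap k R c = x)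
    [Field M] [Algebra k M] [Ring A] [Nontrivial A] [Algebra M A] [Algebra k A]
    [IsScalarTower k M A] (P : R →ₐ[k] A) :
    Function.Injective (extendScalars (M := M) P) := by
  classical
  set b := Module.Basis.ofVectorSpace k M
  have key : ∀ s : Finset (Module.Basis.ofVectorSpaceIndex k M),
      ∀ w : Module.Basis.ofVectorSpaceIndex k M → R,
      ∑ q ∈ s, algebraMap M A (b q) * P (w q) = 0 → ∀ q ∈ s, w q = 0 := by
    classical
    intro s
    induction s using Finset.induction_on with
    | empty => intro w _ q hq; simp at hq
    | insert q₀ s hq₀ ih =>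
      intro w hw
      by_cases h0 : w q₀ = 0
      · rw [Finset.sum_insert hq₀, h0, map_zero, mul_zero, zero_add] at hw
        intro q hq
        rcases Finset.mem_insert.1 hq with rfl | hq
        · exact h0
        · exact ih w hw q hq
      · exfalso
        -- the coefficients at `q₀` of the relations supported on `insert q₀ s` form an ideal; it
        -- contains `1`, and commutators with such a relation are shorter
        let J : TwoSidedIdeal R := TwoSidedIdeal.mk'
          {x | ∃ v : Module.Basis.ofVectorSpaceIndex k M → R, v q₀ = x ∧
            ∑ q ∈ insert q₀ s, algebraMap M A (b q) * P (v q) = 0}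
          ⟨0, rfl, by simp⟩
          (by
            rintro _ _ ⟨v, rfl, hv⟩ ⟨v', rfl, hv'⟩
            refine ⟨v + v', rfl, ?_⟩
            simp only [Pi.add_apply, map_add, mul_add, Finset.sum_add_distrib, hv, hv', add_zero])
          (by
            rintro _ ⟨v, rfl, hv⟩
            refine ⟨-v, rfl, ?_⟩
            simp only [Pi.neg_apply, map_neg, mul_neg, Finset.sum_neg_distrib, hv, neg_zero])
          (by
            rintro x _ ⟨v, rfl, hv⟩
            refine ⟨fun q => x * v q, rfl, ?_⟩
            have : ∀ q, algebraMap M A (b q) * P (x * v q)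
                = P x * (algebraMap M A (b q) * P (v q)) := fun q => by
              rw [map_mul, ← mul_assoc, Algebra.commutes, mul_assoc]
            simp only [this, ← Finset.mul_sum, hv, mul_zero])
          (by
            rintro _ x ⟨v, rfl, hv⟩
            refine ⟨fun q => v q * x, rfl, ?_⟩
            simp only [map_mul, ← mul_assoc, ← Finset.sum_mul, hv, zero_mul])
        have hmem : w q₀ ∈ J := by
          rw [TwoSidedIdeal.mem_mk']
          exact ⟨w, rfl, hw⟩
        have h1 : (1 : R) ∈ J := IsSimpleRing.one_mem_of_ne_zero_mem J h0 hmem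
        rw [TwoSidedIdeal.mem_mk'] at h1
        obtain ⟨v, hv1, hv⟩ := h1
        have hcomm : ∀ a : R, ∀ q ∈ s, a * v q - v q * a = 0 := by
          intro a
          refine ih (fun q => a * v q - v q * a) ?_
          have h2 : ∑ q ∈ insert q₀ s, algebraMap M A (b q) * P (a * v q - v q * a) = 0 := by
            have : ∀ q, algebraMap M A (b q) * P (a * v q - v q * a)
                = P a * (algebraMap M A (b q) * P (v q))
                  - algebraMap M A (b q) * P (v q) * P a := fun q => by
              rw [map_sub, map_mul, map_mul, mul_sub, ← mul_assoc, Algebra.commutes, mul_assoc,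
                mul_assoc]
            simp only [this, Finset.sum_sub_distrib, ← Finset.mul_sum, ← Finset.sum_mul, hv,
              mul_zero, zero_mul, sub_zero]
          rw [Finset.sum_insert hq₀, hv1] at h2
          simpa using h2
        have hc : ∀ q ∈ insert q₀ s, ∃ c : k, algebraMap k R c = v q := by
          intro q hq
          rcases Finset.mem_insert.1 hq with rfl | hq
          · exact ⟨1, by rw [hv1, map_one]⟩
          · exact hk _ fun y => (sub_eq_zero.1 (hcomm y q hq)).symm
        choose! c hc using hc
        have h3 : algebraMap M A (∑ q ∈ insert q₀ s, c q • b q) = 0 := by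
          rw [map_sum, ← hv]
          refine Finset.sum_congr rfl fun q hq => ?_
          rw [← hc q hq, AlgHom.commutes, Algebra.smul_def, map_mul,
            ← IsScalarTower.algebraMap_apply, Algebra.commutes]
        rw [map_eq_zero_iff _ (algebraMap M A).injective] at h3
        have h4 := linearIndependent_iff'.1 b.linearIndependent (insert q₀ s) c h3 q₀
          (Finset.mem_insert_self _ _)
        have h5 := hc q₀ (Finset.mem_insert_self _ _)
        rw [h4, hv1, map_zero] at h5
        exact zero_ne_one h5
  rw [injective_iff_map_eq_zero]
  intro t ht
  have hrep := (TensorProduct.equivFinsuppOfBasisLeft (N := R) b).symm_apply_apply t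
  rw [TensorProduct.equivFinsuppOfBasisLeft_symm_apply] at hrep
  set w := TensorProduct.equivFinsuppOfBasisLeft (N := R) b t
  rw [← hrep, Finsupp.sum, map_sum] at ht
  have hw := key w.support w (by simpa only [extendScalars_tmul] using ht)
  rw [← hrep, Finsupp.sum]
  exact Finset.sum_eq_zero fun q hq => by rw [hw q hq, TensorProduct.tmul_zero]

end SimpleRing

/-! ### Descent to the center, and independence of the reduced trace -/

section Reps

variable {R Ω : Type*} [Ring R] [Field Ω] {n : Type*} [Fintype n] [DecidableEq n]
  [Nonempty n]

/-- A representation spanning a matrix algebra restricts to a map from the center to scalars. -/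
theorem exists_centralChar (P : R →+* Matrix n n Ω) (hP : Submodule.span Ω (Set.range P) = ⊤) :
    ∃ f : Subring.center R →+* Ω, ∀ z : Subring.center R, P z = Matrix.scalar n (f z) := by
  have hz : ∀ z : Subring.center R, ∃ c : Ω, P z = Matrix.scalar n c := fun z => by
    refine exists_scalar_of_commute (commute_of_span_eq_top hP fun r => ?_)
    rw [← map_mul, ← map_mul, Subring.mem_center_iff.1 z.2 r]
  choose f hf using hz
  have hinj : Function.Injective (Matrix.scalar n : Ω →+* Matrix n n Ω) :=
    (Matrix.scalar n : Ω →+* Matrix n n Ω).injective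
  refine ⟨⟨⟨⟨f, ?_⟩, ?_⟩, ?_, ?_⟩, hf⟩
  · apply hinj; rw [← hf, map_one]; simp
  · intro x y; apply hinj; rw [← hf, map_mul, ← hf, ← hf]; simp
  · apply hinj; change Matrix.scalar n (f 0) = _; rw [← hf, map_zero]; simp
  · intro x y; apply hinj; change Matrix.scalar n (f (x + y)) = Matrix.scalar n (f x + f y)
    rw [← hf, map_add, ← hf, ← hf]; simp

/-- Rationality: in a simple ring `R` with a representation spanning a matrix algebra over `Ω`, an
element that is an `Ω`-combination of a subspace over the center lies in this subspace. -/
theorem mem_of_mem_span_map [IsSimpleRing R] (P : R →+* Matrix n n Ω)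
    (hP : Submodule.span Ω (Set.range P) = ⊤) (W : AddSubgroup R)
    (hW : ∀ z : R, (∀ y, z * y = y * z) → ∀ w ∈ W, z * w ∈ W) {x : R}
    (hx : P x ∈ Submodule.span Ω (P '' W)) : x ∈ W := by
  obtain ⟨f, hf⟩ := exists_centralChar P hP
  let k := Subring.center R
  let : Field k := (IsSimpleRing.isField_center R).toField
  let : Algebra k Ω := f.toAlgebra
  let : Algebra k R := (Subring.center R).subtype.toAlgebra' (by
    intro c x; exact (Subring.mem_center_iff.1 c.2 x).symm)
  let P' : R →ₐ[k] Matrix n n Ω := { P with commutes' := fun z => hf z }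
  have hinj := extendScalars_injective (k := k) (R := R) (M := Ω) (A := Matrix n n Ω)
    (fun x hx => ⟨⟨x, Subring.mem_center_iff.2 fun y => (hx y).symm⟩, rfl⟩) P'
  let W' : Submodule k R := { W with
    smul_mem' := fun c w hw => hW c (fun y => (Subring.mem_center_iff.1 c.2 y).symm) w hw }
  obtain ⟨l, hl⟩ : ∃ l : Ω →ₗ[k] k, l 1 = 1 := Module.Projective.exists_dual_eq_one k one_ne_zero
  -- the tensors mapping to the span of `P(W)` come from `Ω ⊗ W`
  obtain ⟨t, ht, htx⟩ : ∃ t : TensorProduct k Ω R,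
      (TensorProduct.lid k R (l.rTensor R t)) ∈ W' ∧ extendScalars P' t = P x := by
    clear hl
    revert hx
    generalize P x = y
    intro hx
    have : ∃ t : TensorProduct k Ω R,
      (∀ l : Ω →ₗ[k] k, (TensorProduct.lid k R (l.rTensor R t)) ∈ W') ∧
        extendScalars P' t = y := by
      induction hx using Submodule.span_induction with
      | mem y hy =>
        obtain ⟨w, hw, rfl⟩ := hy
        refine ⟨TensorProduct.tmul k 1 w, fun l => ?_, ?_⟩
        · rw [LinearMap.rTensor_tmul, TensorProduct.lid_tmul]
          exact W'.smul_mem _ hw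
        · rw [extendScalars_tmul, map_one, one_mul]; rfl
      | zero => exact ⟨0, fun l => by simp, by simp⟩
      | add y y' _ _ hy hy' =>
        obtain ⟨t, h1, h2⟩ := hy
        obtain ⟨t', h1', h2'⟩ := hy'
        refine ⟨t + t', fun l => ?_, ?_⟩
        · rw [map_add, map_add]; exact W'.add_mem (h1 l) (h1' l)
        · rw [map_add, h2, h2']
      | smul a y _ hy =>
        obtain ⟨t, h1, h2⟩ := hy
        refine ⟨a • t, fun l => ?_, ?_⟩
        · have h3 : TensorProduct.lid k R (l.rTensor R (a • t))
              = TensorProduct.lid k R ((l ∘ₗ LinearMap.mulLeft k a).rTensor R t) := by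
            clear h1 h2
            induction t using TensorProduct.induction_on with
            | zero => simp
            | tmul c w => simp [TensorProduct.smul_tmul']
            | add t t' h h' => simp only [smul_add, map_add, h, h']
          rw [h3]; exact h1 _
        · rw [map_smul, h2]
    obtain ⟨t, h1, h2⟩ := this
    exact ⟨t, h1 l, h2⟩
  have hteq : t = TensorProduct.tmul k 1 x := by
    apply hinj
    rw [htx, extendScalars_tmul, map_one, one_mul]; rfl
  rw [hteq, LinearMap.rTensor_tmul, TensorProduct.lid_tmul, hl, one_smul] at ht
  exact ht

universe u v in
/-- Two extensions of a field have a common extension. -/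
theorem exists_compositum (k : Type*) {Ω : Type u} {Ω' : Type v} [Field k] [Field Ω] [Field Ω']
    [Algebra k Ω] [Algebra k Ω'] :
    ∃ (M : Type max u v) (_ : Field M) (a : Ω →+* M) (b : Ω' →+* M),
      ∀ c : k, a (algebraMap k Ω c) = b (algebraMap k Ω' c) := by
  obtain ⟨I, hI⟩ := Ideal.exists_maximal (TensorProduct k Ω Ω')
  refine ⟨TensorProduct k Ω Ω' ⧸ I, Ideal.Quotient.field I, (Ideal.Quotient.mk I).comp
    (Algebra.TensorProduct.includeLeft : Ω →ₐ[k] TensorProduct k Ω Ω').toRingHom,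
    (Ideal.Quotient.mk I).comp
    (Algebra.TensorProduct.includeRight : Ω' →ₐ[k] TensorProduct k Ω Ω').toRingHom, fun c => ?_⟩
  simp

omit [Nonempty n] in
theorem mapMatrix_scalar {K K' : Type*} [Field K] [Field K'] (a : K →+* K') (c : K) :
    a.mapMatrix (Matrix.scalar n c) = Matrix.scalar n (a c) := by
  ext i j
  simp [Matrix.scalar, Matrix.diagonal_apply, apply_ite a]

omit [Nonempty n] in
theorem trace_mapMatrix {K K' : Type*} [Field K] [Field K'] (a : K →+* K') (X : Matrix n n K) :
    (a.mapMatrix X).trace = a X.trace := by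
  simp [Matrix.trace]

omit [Nonempty n] in
theorem span_range_mapMatrix {M : Type*} [Field M] (a : Ω →+* M) (P : R →+* Matrix n n Ω)
    (hP : Submodule.span Ω (Set.range P) = ⊤) :
    Submodule.span M (Set.range (a.mapMatrix.comp P)) = ⊤ := by
  have h : ∀ X : Matrix n n Ω, a.mapMatrix X ∈ Submodule.span M (Set.range (a.mapMatrix.comp P)) := by
    intro X
    have hX : X ∈ Submodule.span Ω (Set.range P) := hP ▸ Submodule.mem_top
    induction hX using Submodule.span_induction with
    | mem x hx => obtain ⟨r, rfl⟩ := hx; exact Submodule.subset_span ⟨r, rfl⟩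
    | zero => rw [map_zero]; exact Submodule.zero_mem _
    | add x y _ _ hx hy => rw [map_add]; exact Submodule.add_mem _ hx hy
    | smul c x _ hx =>
      have : a.mapMatrix (c • x) = a c • a.mapMatrix x := by ext; simp
      rw [this]; exact Submodule.smul_mem _ _ hx
  rw [eq_top_iff]
  intro X _
  rw [Matrix.matrix_eq_sum_single X]
  refine Submodule.sum_mem _ fun i _ => Submodule.sum_mem _ fun j _ => ?_
  have : Matrix.single i j (X i j) = X i j • a.mapMatrix (Matrix.single i j 1) := by
    rw [RingHom.mapMatrix_apply, Matrix.map_single]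
    simp [Matrix.smul_single]
  rw [this]
  exact Submodule.smul_mem _ _ (h _)

omit [Nonempty n] in
/-- Isomorphisms between matrix algebras are conjugations, so they preserve traces. -/
theorem trace_algEquiv {m : Type*} [Fintype m] [DecidableEq m]
    (e : Matrix n n Ω ≃ₐ[Ω] Matrix m m Ω) (X : Matrix n n Ω) : (e X).trace = X.trace := by
  let f : Module.End Ω (n → Ω) ≃ₐ[Ω] Module.End Ω (m → Ω) :=
    (Matrix.toLinAlgEquiv'.symm.trans e).trans Matrix.toLinAlgEquiv'
  obtain ⟨T, hT⟩ := f.eq_linearEquivConjAlgEquiv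
  have h := congrArg (LinearMap.trace Ω _) (DFunLike.congr_fun hT (Matrix.toLinAlgEquiv' X))
  rw [LinearEquiv.conjAlgEquiv_apply] at h
  have h2 : LinearMap.trace Ω (m → Ω) (T ∘ₗ (Matrix.toLinAlgEquiv' X) ∘ₗ T.symm)
      = LinearMap.trace Ω (n → Ω) (Matrix.toLinAlgEquiv' X) :=
    LinearMap.trace_conj' (Matrix.toLinAlgEquiv' X) T
  rw [h2] at h
  simp only [f, AlgEquiv.trans_apply, AlgEquiv.symm_apply_apply] at h
  exact (Matrix.trace_toLin'_eq (e X)).symm.trans (h.trans (Matrix.trace_toLin'_eq X))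

omit [Nonempty n] in
theorem extendScalars_surjective {k M A : Type*} [Field k] [Algebra k R] [Field M] [Algebra k M]
    [Ring A] [Algebra M A] [Algebra k A] [IsScalarTower k M A] (T : R →ₐ[k] A)
    (hT : Submodule.span M (Set.range T) = ⊤) :
    Function.Surjective (extendScalars (M := M) T) := by
  have : (extendScalars (M := M) T).toLinearMap.range = ⊤ := by
    rw [eq_top_iff, ← hT, Submodule.span_le]
    rintro _ ⟨r, rfl⟩
    refine ⟨TensorProduct.tmul k 1 r, ?_⟩
    exact (extendScalars_tmul T 1 r).trans (by rw [map_one, one_mul])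
  exact LinearMap.range_eq_top.1 this

/-- Representations of a simple ring spanning matrix algebras and agreeing on the center have the
same trace. -/
theorem trace_eq_trace_of_center [IsSimpleRing R] {m : Type*} [Fintype m] [DecidableEq m]
    [Nonempty m] (P : R →+* Matrix n n Ω) (Q : R →+* Matrix m m Ω)
    (hP : Submodule.span Ω (Set.range P) = ⊤) (hQ : Submodule.span Ω (Set.range Q) = ⊤)
    (f : Subring.center R →+* Ω) (hf : ∀ z : Subring.center R, P z = Matrix.scalar n (f z))
    (hg : ∀ z : Subring.center R, Q z = Matrix.scalar m (f z)) (s : R) :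
    (P s).trace = (Q s).trace := by
  let k := Subring.center R
  let : Field k := (IsSimpleRing.isField_center R).toField
  let : Algebra k Ω := f.toAlgebra
  let : Algebra k R := (Subring.center R).subtype.toAlgebra' (by
    intro c x; exact (Subring.mem_center_iff.1 c.2 x).symm)
  let P' : R →ₐ[k] Matrix n n Ω := { P with commutes' := fun z => hf z }
  let Q' : R →ₐ[k] Matrix m m Ω := { Q with commutes' := fun z => hg z }
  have hk : ∀ x : R, (∀ y, x * y = y * x) → ∃ c : k, algebraMap k R c = x :=
    fun x hx => ⟨⟨x, Subring.mem_center_iff.2 fun y => (hx y).symm⟩, rfl⟩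
  let eP := AlgEquiv.ofBijective (extendScalars (M := Ω) P')
    ⟨extendScalars_injective hk P', extendScalars_surjective P' hP⟩
  let eQ := AlgEquiv.ofBijective (extendScalars (M := Ω) Q')
    ⟨extendScalars_injective hk Q', extendScalars_surjective Q' hQ⟩
  have h1 : eP (TensorProduct.tmul k 1 s) = P s :=
    (extendScalars_tmul P' 1 s).trans (by rw [map_one, one_mul]; rfl)
  have h2 : eQ (TensorProduct.tmul k 1 s) = Q s :=
    (extendScalars_tmul Q' 1 s).trans (by rw [map_one, one_mul]; rfl)
  rw [← h1, ← h2, ← trace_algEquiv (eP.symm.trans eQ)]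
  simp

/-- Whether the trace of an element is `1` does not depend on the representation: over a common
extension field any two representations spanning matrix algebras become conjugate. -/
theorem trace_eq_one_of_trace_eq_one [IsSimpleRing R] {m : Type*} [Fintype m] [DecidableEq m]
    [Nonempty m] (P : R →+* Matrix n n Ω) (Q : R →+* Matrix m m Ω)
    (hP : Submodule.span Ω (Set.range P) = ⊤) (hQ : Submodule.span Ω (Set.range Q) = ⊤) {s : R}
    (hs : (P s).trace = 1) : (Q s).trace = 1 := by
  obtain ⟨f, hf⟩ := exists_centralChar P hP
  obtain ⟨g, hg⟩ := exists_centralChar Q hQ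
  let : Field (Subring.center R) := (IsSimpleRing.isField_center R).toField
  obtain ⟨M, _, a, b, hab⟩ := @exists_compositum (Subring.center R) Ω Ω _ _ _ f.toAlgebra
    g.toAlgebra
  have hfg : ∀ z, a (f z) = b (g z) := hab
  have htr := trace_eq_trace_of_center (a.mapMatrix.comp P) (b.mapMatrix.comp Q)
    (span_range_mapMatrix a P hP) (span_range_mapMatrix b Q hQ) (a.comp f)
    (fun z => by rw [RingHom.comp_apply, hf, mapMatrix_scalar, RingHom.comp_apply])
    (fun z => by rw [RingHom.comp_apply, hg, mapMatrix_scalar, RingHom.comp_apply, hfg]) s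
  rw [RingHom.comp_apply, RingHom.comp_apply, trace_mapMatrix, trace_mapMatrix, hs, map_one] at htr
  exact b.injective (htr.symm.trans (map_one b).symm)

end Reps

/-! ### The group algebras inside `Ω Γ` -/

section GroupAlgebra

variable {Γ : Type*} [Group Γ] {F : Type*} {Ω : Type*} [Field F] [Field Ω] [Algebra F Ω]

theorem single_mem_grpAlg {K : Subgroup Γ} {k : Γ} (hk : k ∈ K) :
    MonoidAlgebra.single k (1 : Ω) ∈ grpAlg (Ω := Ω) F K :=
  Algebra.subset_adjoin ⟨k, hk, rfl⟩

theorem grpAlg_eq_span (K : Subgroup Γ) :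
    Subalgebra.toSubmodule (grpAlg (Ω := Ω) F K)
      = Submodule.span F ((fun k : Γ => MonoidAlgebra.single k (1 : Ω)) '' (K : Set Γ)) := by
  apply Algebra.adjoin_eq_span_of_subset
  refine subset_trans ?_ Submodule.subset_span
  let M : Submonoid (MonoidAlgebra Ω Γ) := K.toSubmonoid.map (MonoidAlgebra.of Ω Γ)
  exact (Submonoid.closure_le (S := M)).2 fun x hx => hx

@[elab_as_elim]
theorem grpAlg_induction {K : Subgroup Γ}
    {p : (x : MonoidAlgebra Ω Γ) → x ∈ grpAlg (Ω := Ω) F K → Prop}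
    (single : ∀ k (hk : k ∈ K), p (MonoidAlgebra.single k 1) (single_mem_grpAlg hk))
    (zero : p 0 (zero_mem _))
    (add : ∀ x y hx hy, p x hx → p y hy → p (x + y) (add_mem hx hy))
    (smul : ∀ (c : F) x hx, p x hx → p (c • x) (Subalgebra.smul_mem _ hx c))
    {x : MonoidAlgebra Ω Γ} (hx : x ∈ grpAlg (Ω := Ω) F K) : p x hx := by
  have hx' : x ∈ Submodule.span F ((fun k : Γ => MonoidAlgebra.single k (1 : Ω)) '' (K : Set Γ)) := by
    rw [← grpAlg_eq_span]; exact hx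
  have key : ∃ h : x ∈ grpAlg (Ω := Ω) F K, p x h := by
    clear hx
    induction hx' using Submodule.span_induction with
    | mem x hx => obtain ⟨k, hk, rfl⟩ := hx; exact ⟨_, single k hk⟩
    | zero => exact ⟨_, zero⟩
    | add x y _ _ ihx ihy =>
      obtain ⟨h1, h2⟩ := ihx
      obtain ⟨h3, h4⟩ := ihy
      exact ⟨_, add x y _ _ h2 h4⟩
    | smul c x _ ihx =>
      obtain ⟨h1, h2⟩ := ihx
      exact ⟨_, smul c x _ h2⟩
  exact key.2

theorem mem_grpAlg_iff {K : Subgroup Γ} {x : MonoidAlgebra Ω Γ} :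
    x ∈ grpAlg (Ω := Ω) F K ↔
      (∀ g, x.coeff g ∈ (algebraMap F Ω).range) ∧ ∀ g ∉ K, x.coeff g = 0 := by
  classical
  constructor
  · intro hx
    induction hx using grpAlg_induction with
    | single k hk =>
      refine ⟨fun g => ?_, fun g hg => ?_⟩
      · rw [MonoidAlgebra.coeff_single, Finsupp.single_apply]
        split_ifs
        · exact one_mem _
        · exact zero_mem _
      · rw [MonoidAlgebra.coeff_single, Finsupp.single_apply, if_neg]
        rintro rfl
        exact hg hk
    | zero => exact ⟨fun g => by simp, fun g _ => by simp⟩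
    | add x y _ _ hx hy =>
      refine ⟨fun g => ?_, fun g hg => ?_⟩
      · rw [MonoidAlgebra.coeff_add, Finsupp.add_apply]; exact add_mem (hx.1 g) (hy.1 g)
      · rw [MonoidAlgebra.coeff_add, Finsupp.add_apply, hx.2 g hg, hy.2 g hg, add_zero]
    | smul c x _ hx =>
      refine ⟨fun g => ?_, fun g hg => ?_⟩
      · rw [MonoidAlgebra.coeff_smul_apply, Algebra.smul_def]
        exact mul_mem ⟨c, rfl⟩ (hx.1 g)
      · rw [MonoidAlgebra.coeff_smul_apply, hx.2 g hg, smul_zero]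
  · rintro ⟨h1, h2⟩
    rw [← MonoidAlgebra.sum_coeff_single x]
    refine Subalgebra.sum_mem _ fun g hg => ?_
    have hgK : g ∈ K := by
      by_contra h
      exact Finsupp.mem_support_iff.1 hg (h2 g h)
    obtain ⟨c, hc⟩ := h1 g
    rw [← hc, ← mul_one (algebraMap F Ω c), ← Algebra.smul_def, ← MonoidAlgebra.smul_single]
    exact Subalgebra.smul_mem _ (single_mem_grpAlg hgK) c

theorem grpAlg_mono {K K' : Subgroup Γ} (h : K ≤ K') {x : MonoidAlgebra Ω Γ}
    (hx : x ∈ grpAlg (Ω := Ω) F K) : x ∈ grpAlg (Ω := Ω) F K' :=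
  Algebra.adjoin_mono (Set.image_mono h) hx

theorem mem_grpAlg_of_tower {E : Type*} [Field E] [Algebra F E] [Algebra E Ω] [IsScalarTower F E Ω]
    {K : Subgroup Γ} {x : MonoidAlgebra Ω Γ} (hx : x ∈ grpAlg (Ω := Ω) F K) :
    x ∈ grpAlg (Ω := Ω) E K := by
  rw [mem_grpAlg_iff] at hx ⊢
  refine ⟨fun g => ?_, hx.2⟩
  obtain ⟨c, hc⟩ := hx.1 g
  exact ⟨algebraMap F E c, by rw [← hc, IsScalarTower.algebraMap_apply F E Ω]⟩

theorem mem_grpAlg_self {K : Subgroup Γ} {x : MonoidAlgebra Ω Γ}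
    (hx : x ∈ grpAlg (Ω := Ω) F K) : x ∈ grpAlg (Ω := Ω) Ω K :=
  mem_grpAlg_of_tower hx

/-- An element commuting with the group elements of `K` commutes with `Ω K`. -/
theorem commute_of_mem_grpAlg {K : Subgroup Γ} {x y : MonoidAlgebra Ω Γ}
    (hx : ∀ k ∈ K, x * MonoidAlgebra.single k 1 = MonoidAlgebra.single k 1 * x)
    (hy : y ∈ grpAlg (Ω := Ω) F K) : x * y = y * x := by
  induction hy using grpAlg_induction with
  | single k hk => exact hx k hk
  | zero => simp
  | add y z _ _ hy hz => rw [mul_add, hy, hz, add_mul]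
  | smul c y _ hy => rw [mul_smul_comm, hy, smul_mul_assoc]

/-! #### Conjugation -/

/-- Conjugation `a ↦ a ^ h` as an algebra endomorphism. -/
def conjHom (h : Γ) : MonoidAlgebra Ω Γ →ₐ[Ω] MonoidAlgebra Ω Γ where
  toFun a := conj a h
  map_one' := by
    rw [conj, mul_one, MonoidAlgebra.single_mul_single, inv_mul_cancel, mul_one,
      MonoidAlgebra.one_def]
  map_mul' a b := by
    have : (MonoidAlgebra.single h 1 : MonoidAlgebra Ω Γ) * MonoidAlgebra.single h⁻¹ 1 = 1 := by
      rw [MonoidAlgebra.single_mul_single, mul_inv_cancel, mul_one, MonoidAlgebra.one_def]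
    simp only [conj, mul_assoc]
    rw [← mul_assoc (MonoidAlgebra.single h (1 : Ω)), this, one_mul]
  map_zero' := by simp [conj]
  map_add' a b := by simp [conj, mul_add, add_mul]
  commutes' c := by
    have : (MonoidAlgebra.single h⁻¹ 1 : MonoidAlgebra Ω Γ) * MonoidAlgebra.single h 1 = 1 := by
      rw [MonoidAlgebra.single_mul_single, inv_mul_cancel, mul_one, MonoidAlgebra.one_def]
    rw [conj, ← Algebra.commutes, mul_assoc, this, mul_one]

theorem conj_mul (a b : MonoidAlgebra Ω Γ) (h : Γ) : conj (a * b) h = conj a h * conj b h :=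
  map_mul (conjHom h) a b

theorem conj_add (a b : MonoidAlgebra Ω Γ) (h : Γ) : conj (a + b) h = conj a h + conj b h :=
  map_add (conjHom h) a b

theorem conj_zero (h : Γ) : conj (0 : MonoidAlgebra Ω Γ) h = 0 := map_zero (conjHom h)

theorem conj_smul (c : F) (a : MonoidAlgebra Ω Γ) (h : Γ) : conj (c • a) h = c • conj a h := by
  simp [conj]

theorem conj_sum {ι : Type*} (s : Finset ι) (f : ι → MonoidAlgebra Ω Γ) (h : Γ) :
    conj (∑ x ∈ s, f x) h = ∑ x ∈ s, conj (f x) h :=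
  map_sum (conjHom h) f s

theorem conj_conj (a : MonoidAlgebra Ω Γ) (g h : Γ) : conj (conj a g) h = conj a (g * h) := by
  simp only [conj, mul_assoc, MonoidAlgebra.single_mul_single, mul_inv_rev, mul_one]
  simp only [← mul_assoc, MonoidAlgebra.single_mul_single, mul_one]

theorem conj_one (a : MonoidAlgebra Ω Γ) : conj a 1 = a := by
  rw [conj, inv_one, ← MonoidAlgebra.one_def, one_mul, mul_one]

theorem conj_inv_conj (a : MonoidAlgebra Ω Γ) (h : Γ) : conj (conj a h⁻¹) h = a := by
  rw [conj_conj, inv_mul_cancel, conj_one]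

theorem single_mul_conj (a : MonoidAlgebra Ω Γ) (h : Γ) :
    MonoidAlgebra.single h 1 * conj a h = a * MonoidAlgebra.single h 1 := by
  rw [conj, ← mul_assoc, ← mul_assoc, MonoidAlgebra.single_mul_single, mul_inv_cancel, mul_one,
    ← MonoidAlgebra.one_def, one_mul]

theorem conj_single (g h : Γ) (c : Ω) :
    conj (MonoidAlgebra.single g c) h = MonoidAlgebra.single (h⁻¹ * g * h) c := by
  rw [conj, MonoidAlgebra.single_mul_single, MonoidAlgebra.single_mul_single, one_mul, mul_one]

theorem conj_eq_self_iff (a : MonoidAlgebra Ω Γ) (h : Γ) :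
    conj a h = a ↔ a * MonoidAlgebra.single h 1 = MonoidAlgebra.single h 1 * a := by
  constructor
  · intro e
    rw [← single_mul_conj, e]
  · intro e
    rw [conj, mul_assoc, e, ← mul_assoc, MonoidAlgebra.single_mul_single, inv_mul_cancel, mul_one,
      ← MonoidAlgebra.one_def, one_mul]

theorem commute_of_conj_eq {K : Subgroup Γ} {x y : MonoidAlgebra Ω Γ}
    (hx : ∀ k ∈ K, conj x k = x) (hy : y ∈ grpAlg (Ω := Ω) F K) : x * y = y * x :=
  commute_of_mem_grpAlg (fun k hk => (conj_eq_self_iff x k).1 (hx k hk)) hy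

theorem conj_eq_of_commute {K : Subgroup Γ} {x : MonoidAlgebra Ω Γ}
    (hx : ∀ y ∈ grpAlg (Ω := Ω) F K, x * y = y * x) : ∀ k ∈ K, conj x k = x :=
  fun k hk => (conj_eq_self_iff x k).2 (hx _ (single_mem_grpAlg hk))

theorem conj_mem_grpAlg {K : Subgroup Γ} {h : Γ} (hh : ∀ k ∈ K, h⁻¹ * k * h ∈ K)
    {x : MonoidAlgebra Ω Γ} (hx : x ∈ grpAlg (Ω := Ω) F K) : conj x h ∈ grpAlg (Ω := Ω) F K := by
  induction hx using grpAlg_induction with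
  | single k hk => rw [conj_single]; exact single_mem_grpAlg (hh k hk)
  | zero => rw [conj_zero]; exact zero_mem _
  | add x y _ _ hx hy => rw [conj_add]; exact add_mem hx hy
  | smul c x _ hx => rw [conj_smul]; exact Subalgebra.smul_mem _ hx c

/-! #### Extending characters linearly -/

section CharEval

variable [Finite Γ]

theorem charEval_add {V : Subgroup Γ} (χ : V → Ω) (a b : MonoidAlgebra Ω Γ) :
    charEval χ (a + b) = charEval χ a + charEval χ b := by
  have := Fintype.ofFinite V
  simp only [charEval, finsum_eq_sum_of_fintype, MonoidAlgebra.coeff_add, Finsupp.add_apply,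
    add_mul, Finset.sum_add_distrib]

theorem charEval_smul {V : Subgroup Γ} (χ : V → Ω) (c : Ω) (a : MonoidAlgebra Ω Γ) :
    charEval χ (c • a) = c * charEval χ a := by
  have := Fintype.ofFinite V
  simp only [charEval, finsum_eq_sum_of_fintype, MonoidAlgebra.coeff_smul_apply, smul_eq_mul,
    Finset.mul_sum, mul_assoc]

/-- The evaluation `a ↦ χ(a)` as a linear map. -/
def evalLin {V : Subgroup Γ} (χ : V → Ω) : MonoidAlgebra Ω Γ →ₗ[Ω] Ω where
  toFun := charEval χ
  map_add' := charEval_add χ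
  map_smul' := charEval_smul χ

theorem evalLin_apply {V : Subgroup Γ} (χ : V → Ω) (a : MonoidAlgebra Ω Γ) :
    evalLin χ a = charEval χ a := rfl

theorem charEval_single {V : Subgroup Γ} (χ : V → Ω) (v : V) :
    charEval χ (MonoidAlgebra.single (v : Γ) 1) = χ v := by
  classical
  have := Fintype.ofFinite V
  rw [charEval, finsum_eq_sum_of_fintype, Finset.sum_eq_single v]
  · simp
  · intro w _ hw
    rw [MonoidAlgebra.coeff_single, Finsupp.single_apply, if_neg, zero_mul]
    exact fun h => hw (Subtype.ext h.symm)
  · simp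

theorem charEval_mul_comm {V : Subgroup Γ} {χ : V → Ω} (hχ : ∀ v w : V, χ (v * w) = χ (w * v))
    {x y : MonoidAlgebra Ω Γ} (hx : x ∈ grpAlg (Ω := Ω) Ω V) (hy : y ∈ grpAlg (Ω := Ω) Ω V) :
    charEval χ (x * y) = charEval χ (y * x) := by
  simp only [← evalLin_apply]
  induction hx using grpAlg_induction with
  | zero => simp
  | add x x' _ _ hx hx' => rw [add_mul, mul_add, map_add, map_add, hx, hx']
  | smul c x _ hx => rw [smul_mul_assoc, mul_smul_comm, map_smul, map_smul, hx]
  | single k hk =>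
    induction hy using grpAlg_induction with
    | zero => simp
    | add x x' _ _ hx hx' => rw [add_mul, mul_add, map_add, map_add, hx, hx']
    | smul c x _ hx => rw [smul_mul_assoc, mul_smul_comm, map_smul, map_smul, hx]
    | single l hl =>
      rw [MonoidAlgebra.single_mul_single, MonoidAlgebra.single_mul_single, mul_one]
      have h1 := charEval_single χ (⟨k, hk⟩ * ⟨l, hl⟩)
      have h2 := charEval_single χ (⟨l, hl⟩ * ⟨k, hk⟩)
      simp only [Subgroup.coe_mul] at h1 h2
      rw [evalLin_apply, evalLin_apply, h1, h2, hχ]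

end CharEval

/-! #### The Galois action on coefficients -/

section Galois

variable {E : IntermediateField F Ω}

omit [Group Γ] in
theorem coeff_galAct (γ : E ≃ₐ[F] E) (a : MonoidAlgebra Ω Γ) (g : Γ) :
    (galAct γ a).coeff g = galApply γ (a.coeff g) := by
  simp [galAct]

theorem galApply_coe (γ : E ≃ₐ[F] E) (z : E) : galApply γ (z : Ω) = (γ z : Ω) := by
  rw [galApply, dif_pos z.2]

theorem galApply_add (γ : E ≃ₐ[F] E) {y z : Ω} (hy : y ∈ E) (hz : z ∈ E) :
    galApply γ (y + z) = galApply γ y + galApply γ z := by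
  have := galApply_coe γ (⟨y, hy⟩ + ⟨z, hz⟩)
  rw [map_add] at this
  exact this.trans (congrArg₂ (· + ·) (galApply_coe γ ⟨y, hy⟩).symm (galApply_coe γ ⟨z, hz⟩).symm)

theorem galApply_mul (γ : E ≃ₐ[F] E) {y z : Ω} (hy : y ∈ E) (hz : z ∈ E) :
    galApply γ (y * z) = galApply γ y * galApply γ z := by
  have := galApply_coe γ (⟨y, hy⟩ * ⟨z, hz⟩)
  rw [map_mul] at this
  exact this.trans (congrArg₂ (· * ·) (galApply_coe γ ⟨y, hy⟩).symm (galApply_coe γ ⟨z, hz⟩).symm)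

theorem galApply_mem (γ : E ≃ₐ[F] E) {z : Ω} (hz : z ∈ E) : galApply γ z ∈ E := by
  rw [galApply, dif_pos hz]; exact (γ _).2

theorem galApply_algebraMap (γ : E ≃ₐ[F] E) (c : F) :
    galApply γ (algebraMap F Ω c) = algebraMap F Ω c := by
  have := galApply_coe γ (algebraMap F E c)
  rwa [AlgEquiv.commutes] at this

theorem galApply_galApply (γ δ : E ≃ₐ[F] E) {z : Ω} (hz : z ∈ E) :
    galApply γ (galApply δ z) = galApply (γ * δ) z := by
  lift z to E using hz
  rw [galApply_coe, galApply_coe, galApply_coe]; rfl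

theorem galApply_one {z : Ω} (hz : z ∈ E) : galApply (1 : E ≃ₐ[F] E) z = z := by
  lift z to E using hz
  rw [galApply_coe]; rfl

/-- The inclusion `E Γ → Ω Γ`. -/
def inclE (E : IntermediateField F Ω) : MonoidAlgebra E Γ →+* MonoidAlgebra Ω Γ :=
  MonoidAlgebra.mapRingHom Γ (algebraMap E Ω)

theorem mem_grpAlg_iff_coeff_mem {K : Subgroup Γ} {x : MonoidAlgebra Ω Γ} :
    x ∈ grpAlg (Ω := Ω) E K ↔ (∀ g, x.coeff g ∈ E) ∧ ∀ g ∉ K, x.coeff g = 0 := by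
  rw [mem_grpAlg_iff]
  have : ∀ z : Ω, z ∈ (algebraMap E Ω).range ↔ z ∈ E :=
    fun z => ⟨fun ⟨c, hc⟩ => hc ▸ c.2, fun h => ⟨⟨z, h⟩, rfl⟩⟩
  simp only [this]

theorem exists_inclE {x : MonoidAlgebra Ω Γ} (hx : x ∈ grpAlg (Ω := Ω) E ⊤) :
    ∃ y : MonoidAlgebra E Γ, inclE E y = x := by
  classical
  rw [mem_grpAlg_iff_coeff_mem] at hx
  refine ⟨MonoidAlgebra.ofCoeff (Finsupp.mapRange
    (fun z => if h : z ∈ E then (⟨z, h⟩ : E) else 0) (by simp; rfl) x.coeff), ?_⟩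
  ext g
  simp [inclE, hx.1 g]

theorem galAct_inclE (γ : E ≃ₐ[F] E) (y : MonoidAlgebra E Γ) :
    galAct γ (inclE E y) = inclE E (MonoidAlgebra.mapRingHom Γ (γ : E →+* E) y) := by
  ext g
  rw [coeff_galAct, inclE, MonoidAlgebra.coeff_mapRingHom, MonoidAlgebra.coeff_mapRingHom,
    MonoidAlgebra.coeff_mapRingHom]
  exact galApply_coe γ _

theorem galAct_mul (γ : E ≃ₐ[F] E) {x y : MonoidAlgebra Ω Γ} (hx : x ∈ grpAlg (Ω := Ω) E ⊤)
    (hy : y ∈ grpAlg (Ω := Ω) E ⊤) : galAct γ (x * y) = galAct γ x * galAct γ y := by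
  obtain ⟨x, rfl⟩ := exists_inclE hx
  obtain ⟨y, rfl⟩ := exists_inclE hy
  rw [← map_mul, galAct_inclE, galAct_inclE, galAct_inclE, map_mul, map_mul]

theorem galAct_add (γ : E ≃ₐ[F] E) {x y : MonoidAlgebra Ω Γ} (hx : x ∈ grpAlg (Ω := Ω) E ⊤)
    (hy : y ∈ grpAlg (Ω := Ω) E ⊤) : galAct γ (x + y) = galAct γ x + galAct γ y := by
  obtain ⟨x, rfl⟩ := exists_inclE hx
  obtain ⟨y, rfl⟩ := exists_inclE hy
  rw [← map_add, galAct_inclE, galAct_inclE, galAct_inclE, map_add, map_add]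

theorem galAct_zero (γ : E ≃ₐ[F] E) : galAct γ (0 : MonoidAlgebra Ω Γ) = 0 := by
  ext g; simp [coeff_galAct, galApply_zero]

theorem galAct_smul (γ : E ≃ₐ[F] E) {c : Ω} (hc : c ∈ E) {x : MonoidAlgebra Ω Γ}
    (hx : x ∈ grpAlg (Ω := Ω) E ⊤) : galAct γ (c • x) = galApply γ c • galAct γ x := by
  ext g
  rw [coeff_galAct, MonoidAlgebra.coeff_smul_apply, MonoidAlgebra.coeff_smul_apply, coeff_galAct,
    smul_eq_mul, smul_eq_mul, galApply_mul γ hc ((mem_grpAlg_iff_coeff_mem.1 hx).1 g)]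

theorem galAct_sum (γ : E ≃ₐ[F] E) {ι : Type*} (s : Finset ι) (f : ι → MonoidAlgebra Ω Γ)
    (hf : ∀ a ∈ s, f a ∈ grpAlg (Ω := Ω) E ⊤) :
    galAct γ (∑ a ∈ s, f a) = ∑ a ∈ s, galAct γ (f a) := by
  classical
  induction s using Finset.induction_on with
  | empty => simp [galAct_zero]
  | insert a s ha ih =>
    rw [Finset.sum_insert ha, Finset.sum_insert ha, galAct_add γ (hf a (Finset.mem_insert_self _ _))
      (sum_mem fun b hb => hf b (Finset.mem_insert_of_mem hb)),
      ih fun b hb => hf b (Finset.mem_insert_of_mem hb)]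

theorem galAct_galAct (γ δ : E ≃ₐ[F] E) {x : MonoidAlgebra Ω Γ}
    (hx : x ∈ grpAlg (Ω := Ω) E ⊤) : galAct γ (galAct δ x) = galAct (γ * δ) x := by
  ext g
  rw [coeff_galAct, coeff_galAct, coeff_galAct,
    galApply_galApply _ _ ((mem_grpAlg_iff_coeff_mem.1 hx).1 g)]

theorem galAct_one {x : MonoidAlgebra Ω Γ} (hx : x ∈ grpAlg (Ω := Ω) E ⊤) :
    galAct (1 : E ≃ₐ[F] E) x = x := by
  ext g
  rw [coeff_galAct, galApply_one ((mem_grpAlg_iff_coeff_mem.1 hx).1 g)]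

theorem galAct_mem (γ : E ≃ₐ[F] E) {K : Subgroup Γ} {x : MonoidAlgebra Ω Γ}
    (hx : x ∈ grpAlg (Ω := Ω) E K) : galAct γ x ∈ grpAlg (Ω := Ω) E K := by
  rw [mem_grpAlg_iff_coeff_mem] at hx ⊢
  simp only [coeff_galAct]
  exact ⟨fun g => galApply_mem γ (hx.1 g), fun g hg => by rw [hx.2 g hg, galApply_zero]⟩

theorem galAct_eq_self (γ : E ≃ₐ[F] E) {K : Subgroup Γ} {x : MonoidAlgebra Ω Γ}
    (hx : x ∈ grpAlg (Ω := Ω) F K) : galAct γ x = x := by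
  ext g
  obtain ⟨c, hc⟩ := (mem_grpAlg_iff.1 hx).1 g
  rw [coeff_galAct, ← hc, galApply_algebraMap]

theorem galAct_conj (γ : E ≃ₐ[F] E) {x : MonoidAlgebra Ω Γ} (hx : x ∈ grpAlg (Ω := Ω) E ⊤)
    (h : Γ) : galAct γ (conj x h) = conj (galAct γ x) h := by
  have h1 : ∀ g : Γ, MonoidAlgebra.single g (1 : Ω) ∈ grpAlg (Ω := Ω) F ⊤ :=
    fun g => single_mem_grpAlg (Subgroup.mem_top g)
  have h2 : ∀ g : Γ, MonoidAlgebra.single g (1 : Ω) ∈ grpAlg (Ω := Ω) E ⊤ :=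
    fun g => single_mem_grpAlg (Subgroup.mem_top g)
  rw [conj, conj, galAct_mul γ (mul_mem (h2 _) hx) (h2 _), galAct_mul γ (h2 _) hx,
    galAct_eq_self γ (h1 _), galAct_eq_self γ (h1 _)]

/-- Galois descent for `E Γ`. -/
theorem mem_grpAlg_of_galAct_eq [FiniteDimensional F E] [IsGalois F E] {K : Subgroup Γ}
    {x : MonoidAlgebra Ω Γ} (hx : x ∈ grpAlg (Ω := Ω) E K)
    (h : ∀ γ : E ≃ₐ[F] E, galAct γ x = x) : x ∈ grpAlg (Ω := Ω) F K := by
  have hx' := mem_grpAlg_iff_coeff_mem.1 hx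
  rw [mem_grpAlg_iff]
  refine ⟨fun g => ?_, hx'.2⟩
  have h1 : ∀ γ : E ≃ₐ[F] E, γ ⟨x.coeff g, hx'.1 g⟩ = ⟨x.coeff g, hx'.1 g⟩ := by
    intro γ
    apply Subtype.ext
    rw [← galApply_coe, ← coeff_galAct, h]
  obtain ⟨c, hc⟩ := (IsGalois.mem_range_algebraMap_iff_fixed _).2 h1
  exact ⟨c, congrArg Subtype.val hc⟩

end Galois

/-! #### Coordinates over a subfield -/

/-- Applying an `F`-linear functional of `Ω` to the coefficients. -/
def coeffMap (f : Ω →ₗ[F] F) : MonoidAlgebra Ω Γ →ₗ[F] MonoidAlgebra Ω Γ where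
  toFun x := MonoidAlgebra.ofCoeff (Finsupp.mapRange
    ((Algebra.linearMap F Ω) ∘ₗ f) (map_zero _) x.coeff)
  map_add' x y := by ext g; simp
  map_smul' c x := by ext g; simp [← Algebra.smul_def]

omit [Group Γ] in
theorem coeff_coeffMap (f : Ω →ₗ[F] F) (x : MonoidAlgebra Ω Γ) (g : Γ) :
    (coeffMap f x).coeff g = algebraMap F Ω (f (x.coeff g)) := by
  simp [coeffMap]

theorem coeffMap_mem (f : Ω →ₗ[F] F) {K : Subgroup Γ} {x : MonoidAlgebra Ω Γ}
    (hx : x ∈ grpAlg (Ω := Ω) Ω K) : coeffMap f x ∈ grpAlg (Ω := Ω) F K := by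
  rw [mem_grpAlg_iff] at hx ⊢
  simp only [coeff_coeffMap]
  exact ⟨fun g => ⟨_, rfl⟩, fun g hg => by rw [hx.2 g hg, map_zero, map_zero]⟩

theorem coeffMap_mul_left (f : Ω →ₗ[F] F) {K : Subgroup Γ} {a : MonoidAlgebra Ω Γ}
    (ha : a ∈ grpAlg (Ω := Ω) F K) (x : MonoidAlgebra Ω Γ) :
    coeffMap f (a * x) = a * coeffMap f x := by
  induction ha using grpAlg_induction with
  | single k hk => ext g; simp [coeff_coeffMap, MonoidAlgebra.coeff_single_mul_apply]
  | zero => simp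
  | add a b _ _ ha hb => rw [add_mul, map_add, ha, hb, add_mul]
  | smul c a _ ha => rw [smul_mul_assoc, map_smul, ha, smul_mul_assoc]

theorem coeffMap_mul_right (f : Ω →ₗ[F] F) {K : Subgroup Γ} {a : MonoidAlgebra Ω Γ}
    (ha : a ∈ grpAlg (Ω := Ω) F K) (x : MonoidAlgebra Ω Γ) :
    coeffMap f (x * a) = coeffMap f x * a := by
  induction ha using grpAlg_induction with
  | single k hk => ext g; simp [coeff_coeffMap, MonoidAlgebra.coeff_mul_single_apply]
  | zero => simp
  | add a b _ _ ha hb => rw [mul_add, map_add, ha, hb, mul_add]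
  | smul c a _ ha => rw [mul_smul_comm, map_smul, ha, mul_smul_comm]

variable (F) in
/-- Expand the coefficients with respect to an `F`-basis of `Ω`. -/
theorem mem_span_coeffMap (x : MonoidAlgebra Ω Γ) :
    x ∈ Submodule.span Ω (Set.range fun f : Ω →ₗ[F] F => coeffMap f x) := by
  classical
  let b := Module.Basis.ofVectorSpace F Ω
  let T := x.coeff.support.biUnion fun g => (b.repr (x.coeff g)).support
  have hx : x = ∑ t ∈ T, b t • coeffMap (b.coord t) x := by
    ext g
    rw [MonoidAlgebra.coeff_sum, Finsupp.finsetSum_apply]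
    simp only [MonoidAlgebra.coeff_smul_apply, coeff_coeffMap]
    by_cases hg : x.coeff g = 0
    · simp [hg]
    · have h1 := b.linearCombination_repr (x.coeff g)
      rw [Finsupp.linearCombination_apply, Finsupp.sum_of_support_subset (s := T)] at h1
      · rw [← h1]
        refine Finset.sum_congr rfl fun t _ => ?_
        rw [h1, Module.Basis.coord_apply, Algebra.smul_def, smul_eq_mul, mul_comm]
      · exact Finset.subset_biUnion_of_mem (fun g => (b.repr (x.coeff g)).support)
          (Finsupp.mem_support_iff.2 hg)
      · simp
  rw [hx]
  refine Submodule.sum_mem _ fun t _ => Submodule.smul_mem _ _ (Submodule.subset_span ?_)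
  exact ⟨b.coord t, by rw [← hx]⟩

end GroupAlgebra

/-! ### Simple projective representations -/

section SimpleProjective

variable {G Ω : Type*} [Group G] [Finite G] [Field Ω] {m : ℕ}

open Matrix

/-- The matrices of a representation on `Ω ^ m`. -/
def repMatrix (ρ : Representation Ω G (Fin m → Ω)) (g : G) : Matrix (Fin m) (Fin m) Ω :=
  LinearMap.toMatrix' (ρ g)

omit [Finite G] in
theorem repMatrix_mul (ρ : Representation Ω G (Fin m → Ω)) (g h : G) :
    repMatrix ρ (g * h) = repMatrix ρ g * repMatrix ρ h := by
  rw [repMatrix, map_mul, LinearMap.toMatrix'_mul]; rfl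

omit [Finite G] in
theorem repMatrix_one (ρ : Representation Ω G (Fin m → Ω)) : repMatrix ρ 1 = 1 := by
  rw [repMatrix, map_one]; exact LinearMap.toMatrix'_one

omit [Finite G] in
theorem repMatrix_inv_mul (ρ : Representation Ω G (Fin m → Ω)) (g : G) :
    repMatrix ρ g⁻¹ * repMatrix ρ g = 1 := by
  rw [← repMatrix_mul, inv_mul_cancel, repMatrix_one]

omit [Finite G] in
theorem trace_repMatrix (ρ : Representation Ω G (Fin m → Ω)) (g : G) :
    (repMatrix ρ g).trace = ρ.character g := by
  rw [repMatrix, Representation.character, LinearMap.trace_eq_matrix_trace Ω (Pi.basisFun Ω _)]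
  rfl

omit [Finite G] in
theorem nonempty_of_isSimpleModule (ρ : Representation Ω G (Fin m → Ω))
    [hs : IsSimpleModule (MonoidAlgebra Ω G) ρ.asModule] : Nonempty (Fin m) := by
  by_contra h
  rw [not_nonempty_iff] at h
  have h1 : Nontrivial ρ.asModule := IsSimpleModule.nontrivial (MonoidAlgebra Ω G) _
  have h2 : Subsingleton (Fin m → Ω) := inferInstance
  exact not_subsingleton ρ.asModule h2

omit [Finite G] in
/-- Schur's lemma in matrix form. -/
theorem exists_scalar_of_commute_repMatrix [IsAlgClosed Ω] (ρ : Representation Ω G (Fin m → Ω))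
    [hs : IsSimpleModule (MonoidAlgebra Ω G) ρ.asModule] {X : Matrix (Fin m) (Fin m) Ω}
    (hX : ∀ g, X * repMatrix ρ g = repMatrix ρ g * X) : ∃ c : Ω, X = c • 1 := by
  have hne := nonempty_of_isSimpleModule ρ
  have : Nontrivial (Fin m → Ω) := inferInstance
  obtain ⟨μ, hμ⟩ := Module.End.exists_eigenvalue (toLin' X)
  obtain ⟨v, hv⟩ := hμ.exists_hasEigenvector
  have hcomm : ∀ g w, toLin' X (ρ g w) = ρ g (toLin' X w) := by
    intro g w
    have h1 := congrArg (fun Y => toLin' Y w) (hX g)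
    simpa [repMatrix, Matrix.toLin'_mul] using h1
  let N : Submodule (MonoidAlgebra Ω G) ρ.asModule :=
    { carrier := {w | toLin' X (ρ.asModuleEquiv w) = μ • ρ.asModuleEquiv w}
      add_mem' := fun {a b} ha hb => by
        simp only [Set.mem_ofPred_eq, map_add, smul_add] at *
        rw [ha, hb]
      zero_mem' := by simp
      smul_mem' := fun c w hw => by
        simp only [Set.mem_ofPred_eq, Representation.asModuleEquiv_map_smul] at *
        induction c using MonoidAlgebra.induction_linear with
        | zero => simp
        | add x y hx hy => simp only [map_add, LinearMap.add_apply, smul_add, hx, hy]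
        | single g c =>
          rw [Representation.asAlgebraHom_single, LinearMap.smul_apply, map_smul, hcomm, hw,
            map_smul, smul_comm] }
  refine ⟨μ, ?_⟩
  rcases eq_bot_or_eq_top N with h | h
  · exfalso
    have hvN : ρ.asModuleEquiv.symm v ∈ N := by
      change toLin' X (ρ.asModuleEquiv _) = μ • ρ.asModuleEquiv _
      rw [LinearEquiv.apply_symm_apply]
      exact hv.apply_eq_smul
    rw [h, Submodule.mem_bot] at hvN
    exact hv.2 ((LinearEquiv.map_eq_zero_iff _).1 hvN)
  · apply Matrix.toLin'.injective
    ext1 i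
    ext1
    have hw : ρ.asModuleEquiv.symm (Pi.single i 1) ∈ N := h ▸ Submodule.mem_top
    have h2 : toLin' X (Pi.single i 1) = μ • (Pi.single i 1 : Fin m → Ω) := by
      have h3 : toLin' X (ρ.asModuleEquiv _) = μ • ρ.asModuleEquiv _ := hw
      rwa [LinearEquiv.apply_symm_apply] at h3
    simpa using h2

omit [Finite G] in
/-- Higman's criterion: the identity of a projective module is an average over the group. -/
theorem exists_sum_conj_eq_one (ρ : Representation Ω G (Fin m → Ω)) [Fintype G]
    [hp : Module.Projective (MonoidAlgebra Ω G) ρ.asModule] :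
    ∃ U : Matrix (Fin m) (Fin m) Ω, ∑ g, repMatrix ρ g * U * repMatrix ρ g⁻¹ = 1 := by
  let b : Fin m → ρ.asModule := fun i => ρ.asModuleEquiv.symm (Pi.single i 1)
  let π : (Fin m → MonoidAlgebra Ω G) →ₗ[MonoidAlgebra Ω G] ρ.asModule :=
    Fintype.linearCombination _ b
  have hπ : Function.Surjective π := by
    intro v
    refine ⟨fun i => algebraMap Ω _ (ρ.asModuleEquiv v i), ?_⟩
    rw [Fintype.linearCombination_apply]
    apply ρ.asModuleEquiv.injective
    rw [map_sum]
    conv_rhs => rw [pi_eq_sum_univ' (ρ.asModuleEquiv v)]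
    refine Finset.sum_congr rfl fun i _ => ?_
    rw [algebraMap_smul, map_smul, LinearEquiv.apply_symm_apply]
  obtain ⟨σ, hσ⟩ := Module.projective_lifting_property π LinearMap.id hπ
  -- the coefficient at the unit element of a section `σ` of a free cover
  let u : (Fin m → Ω) →ₗ[Ω] (Fin m → Ω) :=
    { toFun := fun v i => (σ (ρ.asModuleEquiv.symm v) i).coeff 1
      map_add' := fun v w => by ext i; simp
      map_smul' := fun c v => by
        ext i
        have h1 : ρ.asModuleEquiv.symm (c • v)
            = algebraMap Ω (MonoidAlgebra Ω G) c • ρ.asModuleEquiv.symm v :=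
          Representation.asModuleEquiv_symm_map_smul ..
        rw [h1, map_smul]
        simp }
  refine ⟨LinearMap.toMatrix' u, ?_⟩
  have hu : ∀ (g : G) (v : Fin m → Ω) (i : Fin m),
      u (ρ g⁻¹ v) i = (σ (ρ.asModuleEquiv.symm v) i).coeff g := by
    intro g v i
    change (σ (ρ.asModuleEquiv.symm (ρ g⁻¹ v)) i).coeff 1 = _
    rw [Representation.asModuleEquiv_symm_map_rho, map_smul]
    simp [MonoidAlgebra.of_apply, MonoidAlgebra.coeff_single_mul_apply]
  have hsum : ∀ v : Fin m → Ω, ∑ g, ρ g (u (ρ g⁻¹ v)) = v := by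
    intro v
    have h1 : π (σ (ρ.asModuleEquiv.symm v)) = ρ.asModuleEquiv.symm v :=
      LinearMap.congr_fun hσ _
    have h2 := congrArg ρ.asModuleEquiv h1
    rw [Fintype.linearCombination_apply, map_sum, LinearEquiv.apply_symm_apply] at h2
    refine Eq.trans ?_ h2
    have h3 : ∀ g, ρ g (u (ρ g⁻¹ v))
        = ∑ i, (σ (ρ.asModuleEquiv.symm v) i).coeff g • ρ g (Pi.single i 1) := by
      intro g
      conv_lhs => rw [pi_eq_sum_univ' (u (ρ g⁻¹ v))]
      rw [map_sum]
      refine Finset.sum_congr rfl fun i _ => ?_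
      rw [map_smul, hu]
    simp only [h3]
    rw [Finset.sum_comm]
    refine Finset.sum_congr rfl fun i _ => ?_
    rw [Representation.asModuleEquiv_map_smul, Representation.asAlgebraHom_def,
      MonoidAlgebra.lift_apply, Finsupp.sum_fintype _ _ (by simp), LinearMap.sum_apply]
    refine Finset.sum_congr rfl fun g _ => ?_
    rw [LinearMap.smul_apply, LinearEquiv.apply_symm_apply]
  apply Matrix.toLin'.injective
  rw [map_sum, Matrix.toLin'_one]
  ext1 j
  ext1
  rw [LinearMap.comp_apply, LinearMap.sum_apply, LinearMap.comp_apply, LinearMap.id_apply]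
  refine Eq.trans (Finset.sum_congr rfl fun g _ => ?_) (hsum _)
  rw [Matrix.toLin'_mul, Matrix.toLin'_mul, LinearMap.comp_apply, LinearMap.comp_apply, repMatrix,
    repMatrix, Matrix.toLin'_toMatrix', Matrix.toLin'_toMatrix', Matrix.toLin'_toMatrix']

omit [Finite G] in
/-- Schur's orthogonality relations. The constant is nonzero because the module is projective. -/
theorem exists_orthogonality [IsAlgClosed Ω] [Fintype G] (ρ : Representation Ω G (Fin m → Ω))
    [hs : IsSimpleModule (MonoidAlgebra Ω G) ρ.asModule]
    [hp : Module.Projective (MonoidAlgebra Ω G) ρ.asModule] :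
    ∃ d : Ω, d ≠ 0 ∧ ∀ i j k l : Fin m, ∑ g, repMatrix ρ g i j * repMatrix ρ g⁻¹ k l
      = if j = k ∧ i = l then d else 0 := by
  classical
  have havg : ∀ X : Matrix (Fin m) (Fin m) Ω,
      ∃ c : Ω, ∑ g, repMatrix ρ g * X * repMatrix ρ g⁻¹ = c • 1 := by
    intro X
    refine exists_scalar_of_commute_repMatrix ρ fun h => ?_
    rw [Finset.sum_mul, Finset.mul_sum]
    refine Fintype.sum_equiv (Equiv.mulLeft h⁻¹) _ _ fun g => ?_
    rw [Equiv.coe_mulLeft, _root_.mul_inv_rev, inv_inv, mul_assoc _ _ (repMatrix ρ h), ← repMatrix_mul,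
      ← mul_assoc, ← mul_assoc, ← repMatrix_mul, mul_inv_cancel_left]
  choose lam hlam using havg
  have hent : ∀ i j k l : Fin m, ∑ g, repMatrix ρ g i j * repMatrix ρ g⁻¹ k l
      = if i = l then lam (Matrix.single j k 1) else 0 := by
    intro i j k l
    have h1 := congrFun (congrFun (hlam (Matrix.single j k 1)) i) l
    rw [Matrix.sum_apply] at h1
    simp only [Matrix.smul_apply, Matrix.one_apply, smul_eq_mul, mul_ite, mul_one, mul_zero] at h1
    rw [← h1]
    refine Finset.sum_congr rfl fun g _ => ?_
    simp [Matrix.mul_apply, Matrix.single, ite_and, Finset.sum_ite_eq]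
  have hne := nonempty_of_isSimpleModule ρ
  obtain ⟨i₀⟩ := hne
  -- replacing `g` by its inverse exchanges the two factors
  have hsymm : ∀ i j k l : Fin m, (if i = l then lam (Matrix.single j k 1) else 0)
      = if k = j then lam (Matrix.single l i 1) else 0 := by
    intro i j k l
    rw [← hent, ← hent]
    refine Fintype.sum_equiv (Equiv.inv G) _ _ fun g => ?_
    rw [Equiv.inv_apply, inv_inv, mul_comm]
  have hval : ∀ j k : Fin m, lam (Matrix.single j k 1)
      = if j = k then lam (Matrix.single i₀ i₀ 1) else 0 := by
    intro j k
    have := hsymm i₀ j k i₀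
    rw [if_pos rfl] at this
    rw [this]
    simp only [eq_comm]
  have hfin : ∀ i j k l : Fin m, ∑ g, repMatrix ρ g i j * repMatrix ρ g⁻¹ k l
      = if j = k ∧ i = l then lam (Matrix.single i₀ i₀ 1) else 0 := by
    intro i j k l
    rw [hent, hval]
    by_cases h1 : i = l <;> by_cases h2 : j = k <;> simp [h1, h2]
  refine ⟨_, ?_, hfin⟩
  -- otherwise all averages over the group vanish, against projectivity
  intro h0
  obtain ⟨U, hU⟩ := exists_sum_conj_eq_one ρ
  have h1 := congrFun (congrFun hU i₀) i₀
  rw [Matrix.sum_apply, Matrix.one_apply_eq] at h1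
  have h2 : ∑ g, (repMatrix ρ g * U * repMatrix ρ g⁻¹) i₀ i₀
      = ∑ k, ∑ j, U j k * ∑ g, repMatrix ρ g i₀ j * repMatrix ρ g⁻¹ k i₀ := by
    simp only [Matrix.mul_apply, Finset.sum_mul, Finset.mul_sum]
    rw [Finset.sum_comm]
    refine Finset.sum_congr rfl fun k _ => ?_
    rw [Finset.sum_comm]
    refine Finset.sum_congr rfl fun j _ => Finset.sum_congr rfl fun g _ => by ring
  rw [h2] at h1
  simp only [hfin, h0, ite_self, mul_zero, Finset.sum_const_zero] at h1
  exact zero_ne_one h1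

end SimpleProjective

/-! ### Matrix coordinates on the block of a simple projective module -/

section Split

variable {Γ : Type*} [Group Γ] {Ω : Type*} [Field Ω]

/-- The central idempotent `e` of `Ω K` cuts out a full matrix algebra: `r` maps `Ω K` onto the
matrix algebra, with trace `θ`, and `s` is the inverse on `Ω K e`. Both are linear maps on the
whole of `Ω Γ`, but only the values of `r` on `Ω K` are meaningful. -/
structure IsSplit {K : Subgroup Γ} (θ : K → Ω) (e : MonoidAlgebra Ω Γ) {n : ℕ}
    (r : MonoidAlgebra Ω Γ →ₗ[Ω] Matrix (Fin n) (Fin n) Ω)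
    (s : Matrix (Fin n) (Fin n) Ω →ₗ[Ω] MonoidAlgebra Ω Γ) : Prop where
  pos : Nonempty (Fin n)
  map_mul : ∀ x ∈ grpAlg (Ω := Ω) Ω K, ∀ y ∈ grpAlg (Ω := Ω) Ω K, r (x * y) = r x * r y
  map_one : r 1 = 1
  s_mem : ∀ X, s X ∈ grpAlg (Ω := Ω) Ω K
  r_s : ∀ X, r (s X) = X
  s_r : ∀ x ∈ grpAlg (Ω := Ω) Ω K, s (r x) = x * e
  comm : ∀ x ∈ grpAlg (Ω := Ω) Ω K, x * e = e * x
  trace : ∀ x ∈ grpAlg (Ω := Ω) Ω K, (r x).trace = charEval θ x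
  coeff : ∃ c : Ω, ∀ k : K, e.coeff (k : Γ) = c * θ k⁻¹

/-- The block of a simple projective representation is split: by the orthogonality relations, Fourier
inversion with the constant `d` gives a section of the representation, although the order of the
group need not be invertible in `Ω`. -/
theorem exists_isSplit [Finite Γ] [IsAlgClosed Ω] {K : Subgroup Γ} {m : ℕ}
    (ρ : Representation Ω K (Fin m → Ω))
    [hs : IsSimpleModule (MonoidAlgebra Ω K) ρ.asModule]
    [hp : Module.Projective (MonoidAlgebra Ω K) ρ.asModule] :
    ∃ (e : MonoidAlgebra Ω Γ) (r : MonoidAlgebra Ω Γ →ₗ[Ω] Matrix (Fin m) (Fin m) Ω)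
      (s : Matrix (Fin m) (Fin m) Ω →ₗ[Ω] MonoidAlgebra Ω Γ), IsSplit ρ.character e r s ∧
      ∀ k : K, r (MonoidAlgebra.single (k : Γ) 1) = repMatrix ρ k := by
  classical
  have := Fintype.ofFinite K
  obtain ⟨d, hd, horth⟩ := exists_orthogonality ρ
  let r : MonoidAlgebra Ω Γ →ₗ[Ω] Matrix (Fin m) (Fin m) Ω :=
    { toFun := fun x => ∑ k : K, x.coeff (k : Γ) • repMatrix ρ k
      map_add' := fun x y => by
        simp only [MonoidAlgebra.coeff_add, Finsupp.add_apply, add_smul, Finset.sum_add_distrib]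
      map_smul' := fun c x => by
        simp only [MonoidAlgebra.coeff_smul_apply, smul_eq_mul, mul_smul, ← Finset.smul_sum,
          RingHom.id_apply] }
  let s : Matrix (Fin m) (Fin m) Ω →ₗ[Ω] MonoidAlgebra Ω Γ :=
    { toFun := fun X => d⁻¹ • ∑ k : K, (X * repMatrix ρ k⁻¹).trace • MonoidAlgebra.single (k : Γ) 1
      map_add' := fun X Y => by
        simp only [add_mul, Matrix.trace_add, add_smul, Finset.sum_add_distrib, smul_add]
      map_smul' := fun c X => by
        simp only [smul_mul_assoc, Matrix.trace_smul, smul_eq_mul, mul_smul, ← Finset.smul_sum,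
          RingHom.id_apply]
        rw [smul_comm] }
  have hr1 : ∀ k : K, r (MonoidAlgebra.single (k : Γ) 1) = repMatrix ρ k := by
    intro k
    change ∑ l : K, (MonoidAlgebra.single (k : Γ) (1 : Ω)).coeff (l : Γ) • repMatrix ρ l = _
    rw [Finset.sum_eq_single k]
    · simp
    · intro l _ hl
      rw [MonoidAlgebra.coeff_single, Finsupp.single_apply, if_neg, zero_smul]
      exact fun h => hl (Subtype.ext h.symm)
    · simp
  have hsX : ∀ X, s X = d⁻¹ • ∑ k : K, (X * repMatrix ρ k⁻¹).trace • MonoidAlgebra.single (k : Γ) 1 :=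
    fun X => rfl
  have hleft : ∀ (k : K) (X), MonoidAlgebra.single (k : Γ) 1 * s X = s (repMatrix ρ k * X) := by
    intro k X
    rw [hsX, hsX, mul_smul_comm, Finset.mul_sum]
    congr 1
    refine Fintype.sum_equiv (Equiv.mulLeft k) _ _ fun g => ?_
    rw [Equiv.coe_mulLeft, mul_smul_comm, MonoidAlgebra.single_mul_single, mul_one,
      Subgroup.coe_mul, _root_.mul_inv_rev, repMatrix_mul, mul_assoc (repMatrix ρ k) X,
      Matrix.trace_mul_comm (repMatrix ρ k), mul_assoc X, mul_assoc (repMatrix ρ g⁻¹),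
      repMatrix_inv_mul, mul_one]
  have hright : ∀ (k : K) (X), s X * MonoidAlgebra.single (k : Γ) 1 = s (X * repMatrix ρ k) := by
    intro k X
    rw [hsX, hsX, smul_mul_assoc, Finset.sum_mul]
    congr 1
    refine Fintype.sum_equiv (Equiv.mulRight k) _ _ fun g => ?_
    rw [Equiv.coe_mulRight, smul_mul_assoc, MonoidAlgebra.single_mul_single, mul_one,
      Subgroup.coe_mul, _root_.mul_inv_rev, mul_assoc, ← repMatrix_mul, mul_inv_cancel_left]
  have hone : ∀ k : K, s (repMatrix ρ k) = MonoidAlgebra.single (k : Γ) 1 * s 1 := fun k => by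
    rw [hleft, mul_one]
  refine ⟨s 1, r, s, ⟨nonempty_of_isSimpleModule ρ, ?_, ?_, ?_, ?_, ?_, ?_, ?_, ?_⟩, hr1⟩
  · intro x hx y hy
    induction hx using grpAlg_induction with
    | zero => simp
    | add x x' _ _ hx hx' => rw [add_mul, _root_.map_add, _root_.map_add, hx, hx', add_mul]
    | smul c x _ hx => rw [smul_mul_assoc, map_smul, map_smul, hx, smul_mul_assoc]
    | single k hk =>
      induction hy using grpAlg_induction with
      | zero => simp
      | add x x' _ _ hx hx' => rw [mul_add, _root_.map_add, _root_.map_add, hx, hx', mul_add]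
      | smul c x _ hx => rw [mul_smul_comm, map_smul, map_smul, hx, mul_smul_comm]
      | single l hl =>
        rw [MonoidAlgebra.single_mul_single, mul_one]
        have := hr1 (⟨k, hk⟩ * ⟨l, hl⟩)
        rw [repMatrix_mul, ← hr1, ← hr1] at this
        exact this
  · have := hr1 1
    rw [repMatrix_one] at this
    exact this
  · intro X
    rw [hsX]
    exact Subalgebra.smul_mem _ (sum_mem fun k _ =>
      Subalgebra.smul_mem _ (single_mem_grpAlg k.2) _) _
  · intro X
    rw [hsX, map_smul, map_sum]
    simp only [map_smul, hr1]
    ext i j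
    rw [Matrix.smul_apply, Matrix.sum_apply]
    have h1 : ∑ g : K, ((X * repMatrix ρ g⁻¹).trace • repMatrix ρ g) i j
        = ∑ a, ∑ b, X a b * ∑ g : K, repMatrix ρ g i j * repMatrix ρ g⁻¹ b a := by
      simp only [Matrix.smul_apply, smul_eq_mul, Matrix.trace, Matrix.diag_apply, Matrix.mul_apply,
        Finset.sum_mul, Finset.mul_sum]
      rw [Finset.sum_comm]
      refine Finset.sum_congr rfl fun k _ => ?_
      rw [Finset.sum_comm]
      refine Finset.sum_congr rfl fun j _ => Finset.sum_congr rfl fun g _ => by ring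
    rw [h1]
    simp only [horth, mul_ite, mul_zero, ite_and, Finset.sum_ite_eq, Finset.mem_univ, if_true]
    rw [smul_eq_mul, mul_comm, mul_assoc, mul_inv_cancel₀ hd, mul_one]
  · intro x hx
    induction hx using grpAlg_induction with
    | zero => simp
    | add x x' _ _ hx hx' => rw [_root_.map_add, _root_.map_add, hx, hx', add_mul]
    | smul c x _ hx => rw [map_smul, map_smul, hx, smul_mul_assoc]
    | single k hk =>
      have := hone ⟨k, hk⟩
      rwa [← hr1] at this
  · intro x hx
    induction hx using grpAlg_induction with
    | zero => simp
    | add x x' _ _ hx hx' => rw [add_mul, mul_add, hx, hx']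
    | smul c x _ hx => rw [smul_mul_assoc, mul_smul_comm, hx]
    | single k hk =>
      have h1 := hleft ⟨k, hk⟩ 1
      have h2 := hright ⟨k, hk⟩ 1
      rw [mul_one] at h1
      rw [one_mul] at h2
      exact h1.trans h2.symm
  · intro x hx
    simp only [← evalLin_apply]
    induction hx using grpAlg_induction with
    | zero => simp
    | add x x' _ _ hx hx' => rw [_root_.map_add, _root_.map_add, Matrix.trace_add, hx, hx']
    | smul c x _ hx => rw [map_smul, map_smul, Matrix.trace_smul, hx]
    | single k hk =>
      have h1 := hr1 ⟨k, hk⟩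
      have h2 := charEval_single ρ.character ⟨k, hk⟩
      simp only at h1 h2
      rw [h1, evalLin_apply, h2, trace_repMatrix]
  · refine ⟨d⁻¹, fun k => ?_⟩
    rw [hsX, MonoidAlgebra.coeff_smul_apply, MonoidAlgebra.coeff_sum, Finsupp.finsetSum_apply,
      Finset.sum_eq_single k]
    · rw [one_mul, trace_repMatrix]; simp
    · intro l _ hl
      rw [MonoidAlgebra.coeff_smul_apply, MonoidAlgebra.coeff_single, Finsupp.single_apply, if_neg,
        smul_zero]
      exact fun h => hl (Subtype.ext h)
    · simp

end Split

section SplitLemmas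

variable {Γ : Type*} [Group Γ] {Ω : Type*} [Field Ω] {K : Subgroup Γ} {θ : K → Ω}
  {e : MonoidAlgebra Ω Γ} {n : ℕ} {r : MonoidAlgebra Ω Γ →ₗ[Ω] Matrix (Fin n) (Fin n) Ω}
  {s : Matrix (Fin n) (Fin n) Ω →ₗ[Ω] MonoidAlgebra Ω Γ}

namespace IsSplit

theorem e_eq (h : IsSplit θ e r s) : e = s 1 := by
  have := h.s_r 1 (one_mem _)
  rwa [h.map_one, one_mul, eq_comm] at this

theorem e_mem (h : IsSplit θ e r s) : e ∈ grpAlg (Ω := Ω) Ω K := h.e_eq ▸ h.s_mem 1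

theorem r_e (h : IsSplit θ e r s) : r e = 1 := by rw [h.e_eq, h.r_s]

theorem e_ne_zero (h : IsSplit θ e r s) : e ≠ 0 := by
  have := h.pos
  rintro rfl
  have h1 := h.r_e
  rw [map_zero] at h1
  exact zero_ne_one h1

theorem e_mul_e (h : IsSplit θ e r s) : e * e = e := by
  rw [← h.s_r e h.e_mem, h.r_e, ← h.e_eq]

theorem r_mul_e (h : IsSplit θ e r s) {x : MonoidAlgebra Ω Γ} (hx : x ∈ grpAlg (Ω := Ω) Ω K) :
    r (x * e) = r x := by
  rw [h.map_mul x hx e h.e_mem, h.r_e, mul_one]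

theorem s_mul_e (h : IsSplit θ e r s) (X) : s X * e = s X := by
  rw [← h.s_r _ (h.s_mem X), h.r_s]

theorem s_mul (h : IsSplit θ e r s) (X Y) : s X * s Y = s (X * Y) := by
  have h1 := h.s_r (s X * s Y) (mul_mem (h.s_mem X) (h.s_mem Y))
  rw [h.map_mul _ (h.s_mem X) _ (h.s_mem Y), h.r_s, h.r_s, mul_assoc, h.s_mul_e] at h1
  exact h1.symm

theorem mul_e_eq_of_r_eq (h : IsSplit θ e r s) {x y : MonoidAlgebra Ω Γ}
    (hx : x ∈ grpAlg (Ω := Ω) Ω K) (hy : y ∈ grpAlg (Ω := Ω) Ω K) (hxy : r x = r y) :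
    x * e = y * e := by
  rw [← h.s_r x hx, ← h.s_r y hy, hxy]

theorem mul_e_eq_zero_of_r_eq_zero (h : IsSplit θ e r s) {x : MonoidAlgebra Ω Γ}
    (hx : x ∈ grpAlg (Ω := Ω) Ω K) (hr : r x = 0) : x * e = 0 := by
  rw [← h.s_r x hx, hr, map_zero]

/-- A central idempotent of `Ω K` either annihilates the block `Ω K e` or contains it. -/
theorem central_idem_mul_e (h : IsSplit θ e r s) {f : MonoidAlgebra Ω Γ}
    (hf : f ∈ grpAlg (Ω := Ω) Ω K) (hc : ∀ b ∈ grpAlg (Ω := Ω) Ω K, f * b = b * f)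
    (hi : f * f = f) : f * e = 0 ∨ f * e = e := by
  have := h.pos
  have h1 : r f = 0 ∨ r f = 1 := by
    refine idempotent_commute_eq_zero_or_one (fun Y => ?_) ?_
    · rw [← h.r_s Y, ← h.map_mul _ hf _ (h.s_mem Y), ← h.map_mul _ (h.s_mem Y) _ hf,
        hc _ (h.s_mem Y)]
    · rw [← h.map_mul _ hf _ hf, hi]
  rcases h1 with h1 | h1
  · exact Or.inl (h.mul_e_eq_zero_of_r_eq_zero hf h1)
  · right
    rw [← h.s_r _ hf, h1, ← h.e_eq]

theorem exists_charEval_eq_one (h : IsSplit θ e r s) :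
    ∃ a ∈ grpAlg (Ω := Ω) Ω K, charEval θ a = 1 := by
  obtain ⟨i⟩ := h.pos
  refine ⟨s (Matrix.single i i 1), h.s_mem _, ?_⟩
  rw [← h.trace _ (h.s_mem _), h.r_s, Matrix.trace_single_eq_same]

theorem charEval_mul_e (h : IsSplit θ e r s) {x : MonoidAlgebra Ω Γ}
    (hx : x ∈ grpAlg (Ω := Ω) Ω K) : charEval θ (x * e) = charEval θ x := by
  rw [← h.trace _ (mul_mem hx h.e_mem), h.r_mul_e hx, h.trace _ hx]

theorem isCentralPrimitiveIdempotent (h : IsSplit θ e r s) :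
    IsCentralPrimitiveIdempotent (grpAlg (Ω := Ω) Ω K) e :=
  ⟨h.e_mem, fun b hb => (h.comm b hb).symm, h.e_mul_e, h.e_ne_zero, fun f hf hc hi hfe => by
    rcases h.central_idem_mul_e hf hc hi with h1 | h1
    · exact Or.inl (hfe.symm.trans h1)
    · exact Or.inr (hfe.symm.trans h1)⟩

section Fin

variable [Finite Γ]

omit [Finite Γ] in
theorem exists_apply_ne_zero (h : IsSplit θ e r s) : ∃ k : K, θ k ≠ 0 := by
  by_contra hcon
  push Not at hcon
  obtain ⟨a, -, ha⟩ := h.exists_charEval_eq_one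
  rw [charEval] at ha
  simp only [hcon, mul_zero, finsum_zero] at ha
  exact zero_ne_one ha

theorem charIdem_eq (h : IsSplit θ e r s) : charIdem Ω θ = e := by
  have hex : ∃ e' : MonoidAlgebra Ω Γ, IsCentralPrimitiveIdempotent (grpAlg (Ω := Ω) Ω K) e' ∧
      ∃ a ∈ grpAlg (Ω := Ω) Ω K, charEval θ (a * e') ≠ 0 := by
    obtain ⟨a, ha, ha1⟩ := h.exists_charEval_eq_one
    exact ⟨e, h.isCentralPrimitiveIdempotent, a, ha, by rw [h.charEval_mul_e ha, ha1]; simp⟩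
  have hspec := Classical.epsilon_spec hex
  change IsCentralPrimitiveIdempotent (grpAlg (Ω := Ω) Ω K) (charIdem Ω θ) ∧
      ∃ a ∈ grpAlg (Ω := Ω) Ω K, charEval θ (a * charIdem Ω θ) ≠ 0 at hspec
  set f := charIdem Ω θ
  obtain ⟨⟨hf, hc, hi, -, hprim⟩, a, ha, hne⟩ := hspec
  rcases h.central_idem_mul_e hf hc hi with h1 | h1
  · exfalso
    apply hne
    rw [← h.charEval_mul_e (mul_mem ha hf), mul_assoc, h1, mul_zero, ← evalLin_apply, map_zero]
  · rcases hprim e h.e_mem (fun b hb => (h.comm b hb).symm) h.e_mul_e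
      ((h.comm f hf).symm.trans h1) with h2 | h2
    · exact absurd h2 h.e_ne_zero
    · exact h2.symm

omit [Finite Γ] in
theorem sum_coeff (h : IsSplit θ e r s) [Fintype K] :
    e = ∑ k : K, e.coeff (k : Γ) • MonoidAlgebra.single (k : Γ) 1 := by
  classical
  ext g
  rw [MonoidAlgebra.coeff_sum, Finsupp.finsetSum_apply]
  by_cases hg : g ∈ K
  · rw [Finset.sum_eq_single ⟨g, hg⟩]
    · simp
    · intro l _ hl
      rw [MonoidAlgebra.coeff_smul_apply, MonoidAlgebra.coeff_single, Finsupp.single_apply, if_neg,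
        smul_zero]
      exact fun h => hl (Subtype.ext h)
    · simp
  · rw [(mem_grpAlg_iff.1 h.e_mem).2 g hg, eq_comm]
    refine Finset.sum_eq_zero fun l _ => ?_
    rw [MonoidAlgebra.coeff_smul_apply, MonoidAlgebra.coeff_single, Finsupp.single_apply, if_neg,
      smul_zero]
    rintro rfl
    exact hg l.2

/-- The coefficients of `e` lie in the field of values. -/
theorem e_mem_grpAlg (h : IsSplit θ e r s) {F : Type*} [Field F] [Algebra F Ω]
    {E : IntermediateField F Ω} (hE : ∀ k, θ k ∈ E) : e ∈ grpAlg (Ω := Ω) E K := by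
  have := Fintype.ofFinite K
  rw [mem_grpAlg_iff_coeff_mem]
  refine ⟨fun g => ?_, (mem_grpAlg_iff.1 h.e_mem).2⟩
  obtain ⟨c, hc⟩ := h.coeff
  have hcE : c ∈ E := by
    obtain ⟨k, hk⟩ := h.exists_apply_ne_zero
    -- this is the identity `θ(k e) = θ(k)`
    have h1 : c * ∑ l : K, θ l⁻¹ * θ (k * l) = θ k := by
      rw [← charEval_single θ k, ← h.charEval_mul_e (single_mem_grpAlg k.2)]
      conv_rhs => rw [h.sum_coeff]
      rw [Finset.mul_sum, Finset.mul_sum, ← evalLin_apply, map_sum]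
      refine Finset.sum_congr rfl fun l _ => ?_
      rw [mul_smul_comm, map_smul, MonoidAlgebra.single_mul_single, mul_one, evalLin_apply,
        ← Subgroup.coe_mul, charEval_single, hc, smul_eq_mul, mul_assoc]
    have h2 : (∑ l : K, θ l⁻¹ * θ (k * l)) ≠ 0 := by
      intro h0
      rw [h0, mul_zero] at h1
      exact hk h1.symm
    rw [eq_div_of_mul_eq h2 h1]
    exact div_mem (hE _) (sum_mem fun l _ => mul_mem (hE _) (hE _))
  by_cases hg : g ∈ K
  · rw [show g = ((⟨g, hg⟩ : K) : Γ) from rfl, hc]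
    exact mul_mem hcE (hE _)
  · rw [(mem_grpAlg_iff.1 h.e_mem).2 g hg]
    exact zero_mem _

end Fin

end IsSplit

end SplitLemmas

/-! ### The field of values -/

section ValueField

variable {F Ω : Type*} [Field F] [Field Ω] [Algebra F Ω]

theorem pow_eq_one_of_isRoot_charpoly {m N : ℕ} {X : Matrix (Fin m) (Fin m) Ω} (hX : X ^ N = 1)
    {z : Ω} (hz : X.charpoly.IsRoot z) : z ^ N = 1 := by
  have h1 : Module.End.HasEigenvalue (Matrix.toLin' X) z := by
    rw [Module.End.hasEigenvalue_iff_isRoot_charpoly]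
    rwa [Matrix.charpoly_toLin']
  obtain ⟨v, hv⟩ := h1.exists_hasEigenvector
  have h2 := hv.pow_apply N
  rw [← Matrix.toLin'_pow, hX, Matrix.toLin'_one, LinearMap.id_apply] at h2
  have h3 : (z ^ N - 1) • v = 0 := by rw [sub_smul, ← h2, one_smul, sub_self]
  rcases smul_eq_zero.1 h3 with h | h
  · exact sub_eq_zero.1 h
  · exact absurd h hv.2

variable (F Ω) in
/-- The subfield of `Ω` generated over `F` by all roots of unity. Only orders that are nonzero in `F`
are used; in positive characteristic the other roots of unity are among these. -/
def cycloField : IntermediateField F Ω :=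
  IntermediateField.adjoin F {x : Ω | ∃ n ∈ {n : ℕ | (n : F) ≠ 0}, n ≠ 0 ∧ x ^ n = 1}

/-- In positive characteristic a root of unity has order prime to the characteristic. -/
theorem mem_cycloField_of_pow_eq_one {N : ℕ} (hN : N ≠ 0) {z : Ω} (hz : z ^ N = 1) :
    z ∈ cycloField F Ω := by
  have key : ∃ n : ℕ, (n : F) ≠ 0 ∧ z ^ n = 1 := by
    obtain ⟨p, hp⟩ := CharP.exists F
    rcases CharP.char_is_prime_or_zero F p with hp' | rfl
    · have : Fact p.Prime := ⟨hp'⟩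
      have : CharP Ω p := charP_of_injective_algebraMap (algebraMap F Ω).injective p
      obtain ⟨a, n, hn, rfl⟩ := Nat.exists_eq_pow_mul_and_not_dvd hN p hp'.ne_one
      refine ⟨n, fun h => hn ((CharP.cast_eq_zero_iff F p n).1 h), ?_⟩
      rw [mul_comm, pow_mul] at hz
      have h1 : (z ^ n - 1) ^ p ^ a = 0 := by rw [sub_pow_char_pow, hz, one_pow, sub_self]
      exact sub_eq_zero.1 (pow_eq_zero_iff (pow_ne_zero a hp'.ne_zero) |>.1 h1)
    · have := CharP.charP_to_charZero F
      exact ⟨N, Nat.cast_ne_zero.2 hN, hz⟩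
  obtain ⟨n, hn, h⟩ := key
  exact IntermediateField.subset_adjoin F _ ⟨n, hn, by rintro rfl; simp at hn, h⟩

instance [IsAlgClosed Ω] : IsAbelianGalois F (cycloField F Ω) := by
  have : IsCyclotomicExtension {n : ℕ | (n : F) ≠ 0} F (cycloField F Ω) :=
    IntermediateField.isCyclotomicExtension_adjoin_of_exists_isPrimitiveRoot
    {n : ℕ | (n : F) ≠ 0} F Ω (by
      intro n hn _
      have : NeZero (n : Ω) := ⟨by
        rw [← map_natCast (algebraMap F Ω)]
        exact (map_ne_zero _).2 hn⟩
      exact HasEnoughRootsOfUnity.exists_primitiveRoot Ω n)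
  exact IsCyclotomicExtension.isAbelianGalois {n : ℕ | (n : F) ≠ 0} F _

theorem isGalois_of_le_cycloField [IsAlgClosed Ω] {E : IntermediateField F Ω}
    (h : E ≤ cycloField F Ω) : IsGalois F E := by
  have := IsAbelianGalois.of_algHom (IntermediateField.inclusion h)
  infer_instance

theorem trace_mem_cycloField [IsAlgClosed Ω] {m N : ℕ} (hN : N ≠ 0) {X : Matrix (Fin m) (Fin m) Ω}
    (hX : X ^ N = 1) : X.trace ∈ cycloField F Ω := by
  rw [Matrix.trace_eq_sum_roots_charpoly]
  refine multiset_sum_mem _ fun z hz => ?_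
  exact mem_cycloField_of_pow_eq_one hN
    (pow_eq_one_of_isRoot_charpoly hX (Polynomial.isRoot_of_mem_roots hz))

variable {Γ : Type*} [Group Γ] [Finite Γ] [IsAlgClosed Ω]

theorem character_mem_cycloField {K : Subgroup Γ} {m : ℕ}
    (ρ : Representation Ω K (Fin m → Ω)) (k : K) : ρ.character k ∈ cycloField F Ω := by
  rw [← trace_repMatrix]
  refine trace_mem_cycloField (N := Nat.card K) Nat.card_pos.ne' ?_
  have : ∀ N : ℕ, repMatrix ρ k ^ N = repMatrix ρ (k ^ N) := by
    intro N
    induction N with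
    | zero => rw [pow_zero, pow_zero, repMatrix_one]
    | succ N ih => rw [pow_succ, pow_succ, repMatrix_mul, ih]
  rw [this, pow_card_eq_one', repMatrix_one]

/-- Character values are sums of roots of unity, so the field of values is contained in an abelian
extension. -/
theorem isGalois_valueField {K : Subgroup Γ} {m : ℕ} (ρ : Representation Ω K (Fin m → Ω)) :
    IsGalois F (valueField F ρ.character) := by
  refine isGalois_of_le_cycloField (IntermediateField.adjoin_le_iff.2 ?_)
  rintro _ ⟨k, rfl⟩
  exact character_mem_cycloField ρ k

theorem finiteDimensional_valueField {K : Subgroup Γ} {m : ℕ}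
    (ρ : Representation Ω K (Fin m → Ω)) : FiniteDimensional F (valueField F ρ.character) := by
  refine IntermediateField.finiteDimensional_adjoin ?_
  rintro _ ⟨k, rfl⟩
  have h1 : IsIntegral F (⟨ρ.character k, character_mem_cycloField ρ k⟩ : cycloField F Ω) :=
    Algebra.IsIntegral.isIntegral _
  exact h1.map (cycloField F Ω).val

end ValueField

/-! ### Galois conjugates of a block idempotent -/

section Conjugates

variable {Γ : Type*} [Group Γ] {F Ω : Type*} [Field F] [Field Ω] [Algebra F Ω]
  {K : Subgroup Γ} {θ : K → Ω}
  {e : MonoidAlgebra Ω Γ} {n : ℕ} {r : MonoidAlgebra Ω Γ →ₗ[Ω] Matrix (Fin n) (Fin n) Ω}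
  {s : Matrix (Fin n) (Fin n) Ω →ₗ[Ω] MonoidAlgebra Ω Γ} {E : IntermediateField F Ω}

theorem apply_mem_of_valueField_eq (hE : valueField F θ = E) (k : K) : θ k ∈ E :=
  hE ▸ IntermediateField.subset_adjoin F _ ⟨k, rfl⟩

theorem gal_ext (hE : valueField F θ = E) {γ δ : E ≃ₐ[F] E}
    (h : ∀ k, galApply γ (θ k) = galApply δ (θ k)) : γ = δ := by
  apply AlgEquiv.coe_toAlgHom_injective
  refine IntermediateField.algHom_ext_of_eq_adjoin F hE.symm ?_
  rintro _ ⟨k, rfl⟩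
  apply Subtype.ext
  have h1 := h k
  rw [galApply, galApply, dif_pos (apply_mem_of_valueField_eq hE k),
    dif_pos (apply_mem_of_valueField_eq hE k)] at h1
  exact h1

/-- The representation `r` restricted to `E K`. -/
def IsSplit.repE (h : IsSplit θ e r s) (E : IntermediateField F Ω) :
    grpAlg (Ω := Ω) E K →ₐ[E] Matrix (Fin n) (Fin n) Ω where
  toFun x := r x
  map_one' := h.map_one
  map_mul' x y := h.map_mul _ (mem_grpAlg_self x.2) _ (mem_grpAlg_self y.2)
  map_zero' := map_zero r
  map_add' x y := map_add r _ _
  commutes' c := by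
    have h1 : ((algebraMap E (grpAlg (Ω := Ω) E K) c : grpAlg (Ω := Ω) E K) : MonoidAlgebra Ω Γ)
        = algebraMap E Ω c • 1 := by
      rw [Subalgebra.coe_algebraMap, Algebra.algebraMap_eq_smul_one, algebraMap_smul]
    rw [h1, map_smul, h.map_one, algebraMap_smul, Algebra.algebraMap_eq_smul_one]

/-- The Galois action on `E K` as a ring homomorphism. -/
def galRingHom (γ : E ≃ₐ[F] E) (K : Subgroup Γ) :
    grpAlg (Ω := Ω) E K →+* grpAlg (Ω := Ω) E K where
  toFun x := ⟨galAct γ x, galAct_mem γ x.2⟩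
  map_one' := Subtype.ext (galAct_eq_self γ (one_mem (grpAlg (Ω := Ω) F K)))
  map_mul' x y := Subtype.ext (galAct_mul γ (grpAlg_mono le_top x.2) (grpAlg_mono le_top y.2))
  map_zero' := Subtype.ext (galAct_zero γ)
  map_add' x y := Subtype.ext (galAct_add γ (grpAlg_mono le_top x.2) (grpAlg_mono le_top y.2))

theorem IsSplit.mem_span_r (h : IsSplit θ e r s) (X : Matrix (Fin n) (Fin n) Ω) :
    X ∈ Submodule.span Ω (r '' {x | ∃ k ∈ K, x = MonoidAlgebra.single k 1}) := by
  rw [← h.r_s X]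
  have hX := h.s_mem X
  generalize s X = x at hX
  induction hX using grpAlg_induction with
  | zero => rw [map_zero]; exact zero_mem _
  | add x y _ _ hx hy => rw [map_add]; exact add_mem hx hy
  | smul c x _ hx => rw [map_smul]; exact Submodule.smul_mem _ _ hx
  | single k hk => exact Submodule.subset_span ⟨_, ⟨k, hk, rfl⟩, rfl⟩

variable [Finite Γ]

instance : Module.Finite F (grpAlg (Ω := Ω) F K) := by
  have h1 : (Subalgebra.toSubmodule (grpAlg (Ω := Ω) F K)).FG := by
    rw [grpAlg_eq_span]
    exact Submodule.fg_span (Set.toFinite _)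
  exact Module.Finite.iff_fg.2 h1

/-- If a Galois automorphism fixes the idempotent, it fixes the character: `r` and its twist are two
representations of the simple ring `r(E K)`, hence have the same trace. -/
theorem IsSplit.eq_one_of_galAct_eq (h : IsSplit θ e r s) (hE : valueField F θ = E)
    {γ : E ≃ₐ[F] E} (hγ : galAct γ e = e) : γ = 1 := by
  have hn := h.pos
  have heE : e ∈ grpAlg (Ω := Ω) E K := h.e_mem_grpAlg (apply_mem_of_valueField_eq hE)
  let P := h.repE E
  let Q : grpAlg (Ω := Ω) E K →+* Matrix (Fin n) (Fin n) Ω :=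
    (P : grpAlg (Ω := Ω) E K →+* _).comp (galRingHom γ K)
  have hPr : ∀ x : grpAlg (Ω := Ω) E K, P x = r x := fun _ => rfl
  have hQr : ∀ x : grpAlg (Ω := Ω) E K, Q x = r (galAct γ x) := fun _ => rfl
  let R := P.range
  have hfin : Module.Finite E R := Module.Finite.range P.toLinearMap
  have hart : IsArtinianRing R := IsArtinianRing.of_finite E R
  let I : R →+* Matrix (Fin n) (Fin n) Ω := R.val
  have hI : Submodule.span Ω (Set.range I) = ⊤ := by
    rw [eq_top_iff]
    intro X _
    refine Submodule.span_mono ?_ (h.mem_span_r X)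
    rintro _ ⟨_, ⟨k, hk, rfl⟩, rfl⟩
    exact ⟨⟨_, ⟨⟨_, single_mem_grpAlg hk⟩, rfl⟩⟩, rfl⟩
  have hsimple : IsSimpleRing R :=
    isSimpleRing_of_injective_of_span_eq_top I Subtype.val_injective hI
  have hker : ∀ x : grpAlg (Ω := Ω) E K, P x = 0 → Q x = 0 := by
    intro x hx
    have h1 : (x : MonoidAlgebra Ω Γ) * e = 0 :=
      h.mul_e_eq_zero_of_r_eq_zero (mem_grpAlg_self x.2) hx
    have h2 := congrArg (galAct γ) h1
    rw [galAct_mul γ (grpAlg_mono le_top x.2) (grpAlg_mono le_top heE), hγ, galAct_zero] at h2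
    rw [hQr, ← h.r_mul_e (mem_grpAlg_self (galAct_mem γ x.2)), h2, map_zero]
  let J : R →+* Matrix (Fin n) (Fin n) Ω :=
    RingHom.liftOfSurjective (P.rangeRestrict : grpAlg (Ω := Ω) E K →+* R)
      P.rangeRestrict_surjective ⟨Q, fun x hx => hker x (congrArg Subtype.val hx)⟩
  have hJ : ∀ x : grpAlg (Ω := Ω) E K, J (P.rangeRestrict x) = Q x := fun x =>
    RingHom.liftOfRightInverse_comp_apply ..
  have hJspan : Submodule.span Ω (Set.range J) = ⊤ := by
    rw [eq_top_iff]
    intro X _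
    refine Submodule.span_mono ?_ (h.mem_span_r X)
    rintro _ ⟨_, ⟨k, hk, rfl⟩, rfl⟩
    refine ⟨P.rangeRestrict ⟨_, single_mem_grpAlg hk⟩, ?_⟩
    rw [hJ, hQr, galAct_eq_self γ (single_mem_grpAlg hk)]
  refine gal_ext hE fun k => ?_
  have hkE := apply_mem_of_valueField_eq hE k
  rw [galApply_one hkE]
  by_cases hk : θ k = 0
  · rw [hk, galApply_zero]
  let x : grpAlg (Ω := Ω) E K :=
    ⟨(⟨(θ k)⁻¹, inv_mem hkE⟩ : E) • MonoidAlgebra.single (k : Γ) 1,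
      Subalgebra.smul_mem _ (single_mem_grpAlg k.2) _⟩
  have hx : (x : MonoidAlgebra Ω Γ) = (θ k)⁻¹ • MonoidAlgebra.single (k : Γ) 1 := rfl
  have htr : (r (MonoidAlgebra.single (k : Γ) 1)).trace = θ k := by
    rw [h.trace _ (single_mem_grpAlg k.2), charEval_single]
  have h1 : (I (P.rangeRestrict x)).trace = 1 := by
    change (r x).trace = 1
    rw [hx, map_smul, Matrix.trace_smul, htr, smul_eq_mul, inv_mul_cancel₀ hk]
  have h2 := trace_eq_one_of_trace_eq_one I J hI hJspan h1
  rw [hJ, hQr, hx, galAct_smul γ (inv_mem hkE) (single_mem_grpAlg (Subgroup.mem_top _)),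
    galAct_eq_self γ (single_mem_grpAlg (F := F) (Subgroup.mem_top _)), map_smul, Matrix.trace_smul,
    htr, smul_eq_mul] at h2
  have h3 : galApply γ (θ k)⁻¹ * galApply γ (θ k) = 1 := by
    rw [← galApply_mul γ (inv_mem hkE) hkE, inv_mul_cancel₀ hk, ← _root_.map_one (algebraMap F Ω),
      galApply_algebraMap]
  have h4 : galApply γ (θ k)⁻¹ ≠ 0 := left_ne_zero_of_mul_eq_one h3
  exact mul_left_cancel₀ h4 (h3.trans h2.symm)

theorem IsSplit.galAct_comm (h : IsSplit θ e r s) (hE : valueField F θ = E) (γ : E ≃ₐ[F] E)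
    {x : MonoidAlgebra Ω Γ} (hx : x ∈ grpAlg (Ω := Ω) Ω K) :
    galAct γ e * x = x * galAct γ e := by
  have heE : e ∈ grpAlg (Ω := Ω) E K := h.e_mem_grpAlg (apply_mem_of_valueField_eq hE)
  refine commute_of_conj_eq (fun k hk => ?_) hx
  rw [← galAct_conj γ (grpAlg_mono le_top heE), (conj_eq_self_iff e k).2]
  exact (h.comm _ (single_mem_grpAlg hk)).symm

theorem IsSplit.galAct_mul_self (h : IsSplit θ e r s) (hE : valueField F θ = E) (γ : E ≃ₐ[F] E) :
    galAct γ e * galAct γ e = galAct γ e := by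
  have heE : e ∈ grpAlg (Ω := Ω) E ⊤ :=
    grpAlg_mono le_top (h.e_mem_grpAlg (apply_mem_of_valueField_eq hE))
  rw [← galAct_mul γ heE heE, h.e_mul_e]

/-- Different Galois conjugates of the idempotent are orthogonal. -/
theorem IsSplit.galAct_mul_eq_zero [FiniteDimensional F E] (h : IsSplit θ e r s)
    (hE : valueField F θ = E) {γ : E ≃ₐ[F] E} (hγ : γ ≠ 1) : galAct γ e * e = 0 := by
  have heK : e ∈ grpAlg (Ω := Ω) E K := h.e_mem_grpAlg (apply_mem_of_valueField_eq hE)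
  have heE : e ∈ grpAlg (Ω := Ω) E ⊤ := grpAlg_mono le_top heK
  have hmem : ∀ δ : E ≃ₐ[F] E, galAct δ e ∈ grpAlg (Ω := Ω) E ⊤ := fun δ => galAct_mem δ heE
  refine (h.central_idem_mul_e (mem_grpAlg_self (galAct_mem γ heK)) (fun b hb =>
    h.galAct_comm hE γ hb) (h.galAct_mul_self hE γ)).resolve_right fun h1 => hγ ?_
  refine h.eq_one_of_galAct_eq hE ?_
  -- if `e^γ e = e`, the same holds for all powers of `γ`, including its inverse, whence `e^γ = e`
  have hpow : ∀ m : ℕ, galAct (γ ^ m) e * e = e := by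
    intro m
    induction m with
    | zero => rw [pow_zero, galAct_one heE, h.e_mul_e]
    | succ m ih =>
      have h2 := congrArg (galAct (γ ^ m)) h1
      rw [galAct_mul _ (hmem γ) heE, galAct_galAct _ _ heE, ← pow_succ] at h2
      calc galAct (γ ^ (m + 1)) e * e = galAct (γ ^ (m + 1)) e * (galAct (γ ^ m) e * e) := by
            rw [ih]
        _ = e := by rw [← mul_assoc, h2, ih]
  have hinv : galAct γ⁻¹ e * e = e := by
    have hfin : IsOfFinOrder γ := isOfFinOrder_of_finite γ
    have : γ⁻¹ = γ ^ (orderOf γ - 1) := by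
      rw [inv_eq_iff_mul_eq_one, ← pow_succ', Nat.sub_add_cancel hfin.orderOf_pos,
        pow_orderOf_eq_one]
    rw [this, hpow]
  have h3 := congrArg (galAct γ) hinv
  rw [galAct_mul _ (hmem _) heE, galAct_galAct _ _ heE, mul_inv_cancel, galAct_one heE,
    ← h.galAct_comm hE γ h.e_mem, h1] at h3
  exact h3.symm

omit [Finite Γ] in
theorem coeff_conj (x : MonoidAlgebra Ω Γ) (h g : Γ) :
    (conj x h).coeff g = x.coeff (h * g * h⁻¹) := by
  rw [conj, MonoidAlgebra.coeff_mul_single_apply, MonoidAlgebra.coeff_single_mul_apply]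
  simp [mul_assoc]

/-- Semi-invariance of the character gives semi-invariance of the idempotent. -/
theorem IsSplit.galAct_conj_eq (hs : IsSplit θ e r s) (hE : valueField F θ = E) {h : Γ}
    (hK : ∀ k, k ∈ K ↔ h * k * h⁻¹ ∈ K) {γ : E ≃ₐ[F] E}
    (hγ : ∀ k k' : K, (k' : Γ) = h * k * h⁻¹ → galApply γ (θ k') = θ k) :
    galAct γ (conj e h) = e := by
  have heK : e ∈ grpAlg (Ω := Ω) E K := hs.e_mem_grpAlg (apply_mem_of_valueField_eq hE)
  have heE : e ∈ grpAlg (Ω := Ω) E ⊤ := grpAlg_mono le_top heK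
  obtain ⟨c, hc⟩ := hs.coeff
  have hcE : c ∈ E := by
    obtain ⟨k, hk⟩ := hs.exists_apply_ne_zero
    have h1 : c * θ k ∈ E := by
      have := (mem_grpAlg_iff_coeff_mem.1 heK).1 ((k⁻¹ : K) : Γ)
      rwa [hc, inv_inv] at this
    have h2 := div_mem h1 (apply_mem_of_valueField_eq hE k)
    rwa [mul_div_cancel_right₀ _ hk] at h2
  have hc0 : c ≠ 0 := by
    rintro rfl
    apply hs.e_ne_zero
    ext g
    by_cases hg : g ∈ K
    · have := hc ⟨g, hg⟩
      simpa using this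
    · simpa using (mem_grpAlg_iff.1 heK).2 g hg
  -- the coefficients of `e` are proportional to the character values, so the two idempotents are
  -- proportional, hence equal
  have hprop : galAct γ (conj e h) = (galApply γ c * c⁻¹) • e := by
    ext g
    rw [coeff_galAct, coeff_conj, MonoidAlgebra.coeff_smul_apply, smul_eq_mul]
    by_cases hg : g ∈ K
    · have h1 := hc ⟨h * g * h⁻¹, (hK g).1 hg⟩
      have h2 := hc ⟨g, hg⟩
      simp only at h1 h2
      rw [h1, h2, galApply_mul γ hcE (apply_mem_of_valueField_eq hE _),
        hγ ⟨g, hg⟩⁻¹ _ (by simp [mul_assoc])]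
      field_simp
    · rw [(mem_grpAlg_iff.1 heK).2 g hg, (mem_grpAlg_iff.1 heK).2 _ (fun h1 => hg ((hK g).2 h1)),
        galApply_zero, mul_zero]
  have hconjE : conj e h ∈ grpAlg (Ω := Ω) E ⊤ :=
    conj_mem_grpAlg (fun _ _ => Subgroup.mem_top _) heE
  have hidem : galAct γ (conj e h) * galAct γ (conj e h) = galAct γ (conj e h) := by
    rw [← galAct_mul γ hconjE hconjE, ← conj_mul, hs.e_mul_e]
  set a := galApply γ c * c⁻¹ with ha
  have ha0 : a ≠ 0 := by
    refine mul_ne_zero ?_ (inv_ne_zero hc0)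
    intro h0
    have := galApply_galApply γ⁻¹ γ hcE
    rw [h0, galApply_zero, inv_mul_cancel, galApply_one hcE] at this
    exact hc0 this.symm
  rw [hprop, smul_mul_smul_comm, hs.e_mul_e] at hidem
  have h1 : (a * a - a) • e = 0 := by rw [sub_smul, hidem, sub_self]
  rcases smul_eq_zero.1 h1 with h2 | h2
  · have : a * a = a * 1 := by rw [mul_one]; exact sub_eq_zero.1 h2
    rw [hprop, mul_left_cancel₀ ha0 this, one_smul]
  · exact absurd h2 hs.e_ne_zero

end Conjugates

/-! ### Compression of the centralizer algebra to a matrix algebra -/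

section Compression

/-- An idempotent matrix factors through its image. -/
theorem exists_factor_of_idempotent {Ω : Type*} [Field Ω] {n : ℕ} {q : Matrix (Fin n) (Fin n) Ω}
    (hq : q * q = q) (h0 : q ≠ 0) :
    ∃ (k : ℕ) (_ : Nonempty (Fin k)) (α : Matrix (Fin n) (Fin k) Ω) (β : Matrix (Fin k) (Fin n) Ω),
      α * β = q ∧ β * α = 1 := by
  classical
  let f := Matrix.toLin' q
  have hf : ∀ x, f (f x) = f x := fun x => by
    rw [← LinearMap.comp_apply, ← Matrix.toLin'_mul, hq]
  let V := LinearMap.range f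
  let b := Module.finBasis Ω V
  let i : V →ₗ[Ω] (Fin n → Ω) := V.subtype
  let g : (Fin n → Ω) →ₗ[Ω] V := f.rangeRestrict
  have h1 : i ∘ₗ g = f := LinearMap.ext fun x => rfl
  have h2 : g ∘ₗ i = LinearMap.id := by
    refine LinearMap.ext fun x => Subtype.ext ?_
    obtain ⟨_, y, rfl⟩ := x
    exact hf y
  let c := Pi.basisFun Ω (Fin n)
  have h3 : LinearMap.toMatrix b c i * LinearMap.toMatrix c b g = q := by
    rw [← LinearMap.toMatrix_comp, h1]
    exact LinearMap.toMatrix'_toLin' q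
  have h4 : LinearMap.toMatrix c b g * LinearMap.toMatrix b c i = 1 := by
    rw [← LinearMap.toMatrix_comp, h2, LinearMap.toMatrix_id]
  refine ⟨Module.finrank Ω V, ?_, _, _, h3, h4⟩
  by_contra hk
  have := not_nonempty_iff.1 hk
  apply h0
  rw [← h3]
  ext a b
  simp [Matrix.mul_apply]

variable {Γ : Type*} [Group Γ] {F Ω : Type*} [Field F] [Field Ω] [Algebra F Ω]

/-- The subalgebra `(Ω K)^L` of the elements of `Ω K` centralizing `Ω L`. -/
def relCent (Ω : Type*) [Field Ω] (K L : Subgroup Γ) : Subalgebra Ω (MonoidAlgebra Ω Γ) :=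
  grpAlg (Ω := Ω) Ω K ⊓ Subalgebra.centralizer Ω (grpAlg (Ω := Ω) Ω L : Set (MonoidAlgebra Ω Γ))

theorem mem_relCent {K L : Subgroup Γ} {x : MonoidAlgebra Ω Γ} :
    x ∈ relCent Ω K L ↔
      x ∈ grpAlg (Ω := Ω) Ω K ∧ ∀ y ∈ grpAlg (Ω := Ω) Ω L, x * y = y * x := by
  rw [relCent, Algebra.mem_inf, Subalgebra.mem_centralizer_iff]
  exact and_congr_right fun _ => forall₂_congr fun _ _ => eq_comm

/-- Splitting data for a pair of characters `θ` of `K` and `φ` of `L ≤ K` whose idempotents satisfy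
`e_φ e_θ ≠ 0`, with common field of values `E`: matrix representations `r` and `u` affording the
characters, sections `s` and `v` of these, and a factorization `α β` of the image under `r` of the
primitive idempotent of `Ω L e_φ` at the diagonal position `a₀`. -/
structure Pair {K L : Subgroup Γ} (θ : K → Ω) (φ : L → Ω) (E : IntermediateField F Ω) where
  {n m k : ℕ}
  r : MonoidAlgebra Ω Γ →ₗ[Ω] Matrix (Fin n) (Fin n) Ω
  s : Matrix (Fin n) (Fin n) Ω →ₗ[Ω] MonoidAlgebra Ω Γ
  u : MonoidAlgebra Ω Γ →ₗ[Ω] Matrix (Fin m) (Fin m) Ω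
  v : Matrix (Fin m) (Fin m) Ω →ₗ[Ω] MonoidAlgebra Ω Γ
  a₀ : Fin m
  α : Matrix (Fin n) (Fin k) Ω
  β : Matrix (Fin k) (Fin n) Ω
  split : IsSplit θ (charIdem Ω θ) r s
  split' : IsSplit φ (charIdem Ω φ) u v
  le : L ≤ K
  field : valueField F θ = E
  field' : valueField F φ = E
  pos : Nonempty (Fin k)
  α_mul_β : α * β = r (v (Matrix.single a₀ a₀ 1))
  β_mul_α : β * α = 1

namespace Pair

variable {K L : Subgroup Γ} {θ : K → Ω} {φ : L → Ω} {E : IntermediateField F Ω} (p : Pair θ φ E)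

attribute [instance] Pair.pos

/-- The matrix units of the block `Ω L e_φ`. -/
def mu (a b : Fin p.m) : MonoidAlgebra Ω Γ := p.v (Matrix.single a b 1)

/-- The compression of `Ω K` to a matrix algebra by a primitive idempotent of `Ω L e_φ`. It is
multiplicative on the centralizer `(Ω K)^L`. -/
def P : MonoidAlgebra Ω Γ →ₗ[Ω] Matrix (Fin p.k) (Fin p.k) Ω where
  toFun x := p.β * p.r x * p.α
  map_add' x y := by rw [map_add, Matrix.mul_add, Matrix.add_mul]
  map_smul' c x := by rw [map_smul, Matrix.mul_smul, Matrix.smul_mul]; rfl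

theorem P_apply (x : MonoidAlgebra Ω Γ) : p.P x = p.β * p.r x * p.α := rfl

theorem mu_mem (a b : Fin p.m) : p.mu a b ∈ grpAlg (Ω := Ω) Ω L := p.split'.s_mem _

theorem mu_mem' (a b : Fin p.m) : p.mu a b ∈ grpAlg (Ω := Ω) Ω K := grpAlg_mono p.le (p.mu_mem a b)

theorem mu_mul_mu (a b c : Fin p.m) : p.mu a b * p.mu b c = p.mu a c := by
  rw [mu, mu, p.split'.s_mul, Matrix.single_mul_single_same, mul_one, mu]

theorem mu_mul_mu_of_ne {b c : Fin p.m} (h : b ≠ c) (a d : Fin p.m) :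
    p.mu a b * p.mu c d = 0 := by
  rw [mu, mu, p.split'.s_mul, Matrix.single_mul_single_of_ne _ _ _ _ h, map_zero]

theorem sum_mu : ∑ a, p.mu a a = charIdem Ω φ := by
  rw [p.split'.e_eq]
  simp only [mu]
  rw [← map_sum]
  congr 1
  ext a b
  simp [Matrix.sum_apply, Matrix.single_apply, Matrix.one_apply, ite_and]

theorem mu_mul_d (a b : Fin p.m) : p.mu a b * charIdem Ω φ = p.mu a b := p.split'.s_mul_e _

theorem d_mem (p : Pair θ φ E) : charIdem Ω φ ∈ grpAlg (Ω := Ω) Ω L := p.split'.e_mem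

theorem d_mem' (p : Pair θ φ E) : charIdem Ω φ ∈ grpAlg (Ω := Ω) Ω K := grpAlg_mono p.le p.d_mem

theorem d_mem_relCent (p : Pair θ φ E) : charIdem Ω φ ∈ relCent Ω K L :=
  mem_relCent.2 ⟨p.d_mem', fun y hy => (p.split'.comm y hy).symm⟩

theorem e_mem_relCent (p : Pair θ φ E) : charIdem Ω θ ∈ relCent Ω K L :=
  mem_relCent.2 ⟨p.split.e_mem, fun y hy => (p.split.comm y (grpAlg_mono p.le hy)).symm⟩

theorem αβ : p.α * p.β = p.r (p.mu p.a₀ p.a₀) := p.α_mul_β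

theorem r_mul {x y : MonoidAlgebra Ω Γ} (hx : x ∈ grpAlg (Ω := Ω) Ω K)
    (hy : y ∈ grpAlg (Ω := Ω) Ω K) : p.r (x * y) = p.r x * p.r y := p.split.map_mul x hx y hy

theorem α_mul_P {x : MonoidAlgebra Ω Γ} (hx : x ∈ grpAlg (Ω := Ω) Ω K) :
    p.α * p.P x * p.β = p.r (p.mu p.a₀ p.a₀ * x * p.mu p.a₀ p.a₀) := by
  rw [p.r_mul (mul_mem (p.mu_mem' _ _) hx) (p.mu_mem' _ _), p.r_mul (p.mu_mem' _ _) hx, ← p.αβ,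
    P_apply]
  simp only [Matrix.mul_assoc]

theorem P_mul_aux {x y : MonoidAlgebra Ω Γ} (hx : x ∈ grpAlg (Ω := Ω) Ω K)
    (hy : y ∈ grpAlg (Ω := Ω) Ω K) : p.P x * p.P y = p.P (x * p.mu p.a₀ p.a₀ * y) := by
  rw [P_apply, P_apply, P_apply, p.r_mul (mul_mem hx (p.mu_mem' _ _)) hy,
    p.r_mul hx (p.mu_mem' _ _), ← p.αβ]
  simp only [Matrix.mul_assoc]

theorem P_mu_mul {x : MonoidAlgebra Ω Γ} (hx : x ∈ grpAlg (Ω := Ω) Ω K) :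
    p.P (p.mu p.a₀ p.a₀ * x) = p.P x := by
  rw [P_apply, p.r_mul (p.mu_mem' _ _) hx, ← p.αβ, ← Matrix.mul_assoc, ← Matrix.mul_assoc,
    p.β_mul_α, Matrix.one_mul, P_apply]

theorem P_mul_mu {x : MonoidAlgebra Ω Γ} (hx : x ∈ grpAlg (Ω := Ω) Ω K) :
    p.P (x * p.mu p.a₀ p.a₀) = p.P x := by
  rw [P_apply, p.r_mul hx (p.mu_mem' _ _), ← p.αβ, Matrix.mul_assoc, Matrix.mul_assoc,
    Matrix.mul_assoc, p.β_mul_α, Matrix.mul_one, ← Matrix.mul_assoc, P_apply]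

theorem P_mul {x y : MonoidAlgebra Ω Γ} (hx : x ∈ relCent Ω K L) (hy : y ∈ grpAlg (Ω := Ω) Ω K) :
    p.P (x * y) = p.P x * p.P y := by
  rw [mem_relCent] at hx
  rw [p.P_mul_aux hx.1 hy, hx.2 _ (p.mu_mem _ _), mul_assoc, p.P_mu_mul (mul_mem hx.1 hy)]

theorem P_mul' {x y : MonoidAlgebra Ω Γ} (hx : x ∈ grpAlg (Ω := Ω) Ω K) (hy : y ∈ relCent Ω K L) :
    p.P (x * y) = p.P x * p.P y := by
  rw [mem_relCent] at hy
  rw [p.P_mul_aux hx hy.1, mul_assoc, ← hy.2 _ (p.mu_mem _ _), ← mul_assoc,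
    p.P_mul_mu (mul_mem hx hy.1)]

theorem P_one : p.P 1 = 1 := by
  rw [P_apply, p.split.map_one, Matrix.mul_one, p.β_mul_α]

theorem P_d : p.P (charIdem Ω φ) = 1 := by
  rw [← p.P_mul_mu p.d_mem', (mem_relCent.1 p.d_mem_relCent).2 _ (p.mu_mem _ _), p.mu_mul_d, ← one_mul (p.mu _ _), p.P_mul_mu (one_mem _), p.P_one]

theorem P_mul_e {x : MonoidAlgebra Ω Γ} (hx : x ∈ grpAlg (Ω := Ω) Ω K) :
    p.P (x * charIdem Ω θ) = p.P x := by
  rw [P_apply, p.split.r_mul_e hx, P_apply]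

/-- On `(Ω K)^L e_φ e_θ` the compression is injective. -/
theorem mul_eq_zero_of_P_eq_zero {x : MonoidAlgebra Ω Γ} (hx : x ∈ relCent Ω K L)
    (h : p.P x = 0) : x * charIdem Ω φ * charIdem Ω θ = 0 := by
  have hx' := mem_relCent.1 hx
  have h1 : x * p.mu p.a₀ p.a₀ * charIdem Ω θ = 0 := by
    refine p.split.mul_e_eq_zero_of_r_eq_zero (mul_mem hx'.1 (p.mu_mem' _ _)) ?_
    have h2 := p.α_mul_P hx'.1
    rw [h, Matrix.mul_zero, Matrix.zero_mul, ← hx'.2 _ (p.mu_mem _ _), mul_assoc, p.mu_mul_mu] at h2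
    exact h2.symm
  rw [← p.sum_mu, Finset.mul_sum, Finset.sum_mul]
  refine Finset.sum_eq_zero fun a _ => ?_
  calc x * p.mu a a * charIdem Ω θ
      = x * (p.mu a p.a₀ * (p.mu p.a₀ p.a₀ * p.mu p.a₀ a)) * charIdem Ω θ := by
        rw [p.mu_mul_mu, p.mu_mul_mu]
    _ = x * p.mu a p.a₀ * p.mu p.a₀ p.a₀ * (p.mu p.a₀ a * charIdem Ω θ) := by
        simp only [mul_assoc]
    _ = p.mu a p.a₀ * (x * p.mu p.a₀ p.a₀ * charIdem Ω θ) * p.mu p.a₀ a := by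
        rw [hx'.2 _ (p.mu_mem _ _), p.split.comm _ (p.mu_mem' _ _)]
        simp only [mul_assoc]
    _ = 0 := by rw [h1, mul_zero, zero_mul]

theorem v_eq_sum (X : Matrix (Fin p.m) (Fin p.m) Ω) : p.v X = ∑ a, ∑ b, X a b • p.mu a b := by
  conv_lhs => rw [Matrix.matrix_eq_sum_single X]
  simp only [map_sum, mu]
  refine Finset.sum_congr rfl fun a _ => Finset.sum_congr rfl fun b _ => ?_
  rw [← map_smul, Matrix.smul_single, smul_eq_mul, mul_one]

/-- The element `∑_k f_{ka} y f_{bk}`, where the `f_{ab}` are the matrix units of `Ω L e_φ`. It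
centralizes `Ω L`. -/
def spread (a b : Fin p.m) (y : MonoidAlgebra Ω Γ) : MonoidAlgebra Ω Γ :=
  ∑ c, p.mu c a * y * p.mu b c

theorem mu_mul_spread (a b c d : Fin p.m) (y : MonoidAlgebra Ω Γ) :
    p.mu c d * p.spread a b y = p.mu c a * y * p.mu b d := by
  rw [spread, Finset.mul_sum, Finset.sum_eq_single d]
  · rw [← mul_assoc, ← mul_assoc, p.mu_mul_mu]
  · intro k _ hk
    rw [← mul_assoc, ← mul_assoc, p.mu_mul_mu_of_ne (Ne.symm hk), zero_mul, zero_mul]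
  · simp

theorem spread_mul_mu (a b c d : Fin p.m) (y : MonoidAlgebra Ω Γ) :
    p.spread a b y * p.mu c d = p.mu c a * y * p.mu b d := by
  rw [spread, Finset.sum_mul, Finset.sum_eq_single c]
  · rw [mul_assoc, p.mu_mul_mu]
  · intro k _ hk
    rw [mul_assoc, p.mu_mul_mu_of_ne hk, mul_zero]
  · simp

theorem spread_mul_d (a b : Fin p.m) (y : MonoidAlgebra Ω Γ) :
    p.spread a b y * charIdem Ω φ = p.spread a b y := by
  rw [spread, Finset.sum_mul]
  exact Finset.sum_congr rfl fun a _ => by rw [mul_assoc, p.mu_mul_d]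

theorem spread_mem (a b : Fin p.m) {y : MonoidAlgebra Ω Γ} (hy : y ∈ grpAlg (Ω := Ω) Ω K) :
    p.spread a b y ∈ relCent Ω K L := by
  have hdx : charIdem Ω φ * p.spread a b y = p.spread a b y := by
    rw [spread, Finset.mul_sum]
    refine Finset.sum_congr rfl fun a _ => ?_
    rw [← mul_assoc, ← mul_assoc, ← p.split'.comm _ (p.mu_mem _ _), p.mu_mul_d]
  have hv : ∀ X, p.spread a b y * p.v X = p.v X * p.spread a b y := by
    intro X
    rw [p.v_eq_sum, Finset.mul_sum, Finset.sum_mul]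
    refine Finset.sum_congr rfl fun c _ => ?_
    rw [Finset.mul_sum, Finset.sum_mul]
    refine Finset.sum_congr rfl fun d _ => ?_
    rw [mul_smul_comm, smul_mul_assoc, p.mu_mul_spread, p.spread_mul_mu]
  refine mem_relCent.2 ⟨sum_mem fun c _ => mul_mem (mul_mem (p.mu_mem' _ _) hy) (p.mu_mem' _ _),
    fun z hz => ?_⟩
  calc p.spread a b y * z = p.spread a b y * (z * charIdem Ω φ) := by
        rw [p.split'.comm z hz, ← mul_assoc, p.spread_mul_d]
    _ = z * charIdem Ω φ * p.spread a b y := by rw [← p.split'.s_r z hz, hv]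
    _ = z * p.spread a b y := by rw [mul_assoc, hdx]

/-- The block `Ω L e_φ` is a matrix algebra, so it splits off as a tensor factor: `e_φ Ω K e_φ` is spanned
by products of elements of `(Ω K)^L` and matrix units. -/
theorem d_mul_mul_d (y : MonoidAlgebra Ω Γ) :
    charIdem Ω φ * y * charIdem Ω φ = ∑ a, ∑ b, p.spread a b y * p.mu a b := by
  simp only [p.spread_mul_mu]
  rw [← p.sum_mu, Finset.sum_mul, Finset.sum_mul_sum]

/-- Every matrix is the compression of an element of `(Ω K)^L`. -/
theorem exists_P_eq (M : Matrix (Fin p.k) (Fin p.k) Ω) : ∃ x ∈ relCent Ω K L, p.P x = M := by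
  have hy : p.s (p.α * M * p.β) ∈ grpAlg (Ω := Ω) Ω K := p.split.s_mem _
  have hx := p.spread_mem p.a₀ p.a₀ hy
  refine ⟨_, hx, ?_⟩
  rw [← p.P_mu_mul (mem_relCent.1 hx).1, p.mu_mul_spread,
    p.P_mul_mu (mul_mem (p.mu_mem' _ _) hy), p.P_mu_mul hy, P_apply, p.split.r_s,
    ← Matrix.mul_assoc, ← Matrix.mul_assoc, p.β_mul_α, Matrix.one_mul, Matrix.mul_assoc,
    p.β_mul_α, Matrix.mul_one]

/-- The character `θ` restricted to `(Ω K)^L Ω L e_φ`: it is the product of the trace of the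
compression and `φ`. -/
theorem charEval_mul {x y : MonoidAlgebra Ω Γ} (hx : x ∈ relCent Ω K L)
    (hy : y ∈ grpAlg (Ω := Ω) Ω L) :
    charEval θ (x * charIdem Ω φ * y) = (p.P x).trace * charEval φ y := by
  have hx' := mem_relCent.1 hx
  have h1 : ∀ a b, (p.r (x * p.mu a b)).trace = if a = b then (p.P x).trace else 0 := by
    intro a b
    rw [← p.mu_mul_mu a p.a₀ b, ← mul_assoc, p.r_mul (mul_mem hx'.1 (p.mu_mem' _ _)) (p.mu_mem' _ _),
      Matrix.trace_mul_comm, ← p.r_mul (p.mu_mem' _ _) (mul_mem hx'.1 (p.mu_mem' _ _)), ← mul_assoc,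
      ← hx'.2 _ (p.mu_mem _ _), mul_assoc]
    split_ifs with hab
    · rw [hab, p.mu_mul_mu, p.r_mul hx'.1 (p.mu_mem' _ _), ← p.αβ, Matrix.trace_mul_comm, P_apply,
        Matrix.trace_mul_comm (p.β * p.r x), Matrix.mul_assoc, ← Matrix.mul_assoc]
    · rw [p.mu_mul_mu_of_ne (Ne.symm hab), mul_zero, map_zero, Matrix.trace_zero]
  have h2 : ∀ X, (p.r (x * p.v X)).trace = (p.P x).trace * X.trace := by
    intro X
    have h3 : X.trace = ∑ a, X a a := rfl
    rw [p.v_eq_sum, Finset.mul_sum, map_sum, Matrix.trace_sum, h3, Finset.mul_sum]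
    refine Finset.sum_congr rfl fun a _ => ?_
    rw [Finset.mul_sum, map_sum, Matrix.trace_sum, Finset.sum_eq_single a]
    · rw [mul_smul_comm, map_smul, Matrix.trace_smul, h1, if_pos rfl, smul_eq_mul, mul_comm]
    · intro b _ hb
      rw [mul_smul_comm, map_smul, Matrix.trace_smul, h1, if_neg (Ne.symm hb), smul_zero]
    · simp
  rw [mul_assoc, ← p.split'.comm y hy, ← p.split'.s_r y hy,
    ← p.split.trace _ (mul_mem hx'.1 (grpAlg_mono p.le (p.split'.s_mem _))), h2,
    p.split'.trace y hy]

end Pair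

/-- Splitting data for two characters with `e_φ e_θ ≠ 0` extend to a `Pair`, with a prescribed
primitive idempotent of `Ω L e_φ`. -/
theorem exists_pair {K L : Subgroup Γ} {θ : K → Ω} {φ : L → Ω} {E : IntermediateField F Ω}
    {n m : ℕ} {r : MonoidAlgebra Ω Γ →ₗ[Ω] Matrix (Fin n) (Fin n) Ω}
    {s : Matrix (Fin n) (Fin n) Ω →ₗ[Ω] MonoidAlgebra Ω Γ}
    {u : MonoidAlgebra Ω Γ →ₗ[Ω] Matrix (Fin m) (Fin m) Ω}
    {v : Matrix (Fin m) (Fin m) Ω →ₗ[Ω] MonoidAlgebra Ω Γ}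
    (split : IsSplit θ (charIdem Ω θ) r s) (split' : IsSplit φ (charIdem Ω φ) u v)
    (le : L ≤ K) (field : valueField F θ = E) (field' : valueField F φ = E)
    (hne : charIdem Ω φ * charIdem Ω θ ≠ 0) (a₀ : Fin m) :
    ∃ p : Pair θ φ E, p.mu p.a₀ p.a₀ = v (Matrix.single a₀ a₀ 1) := by
  have hv : ∀ X, v X ∈ grpAlg (Ω := Ω) Ω K := fun X => grpAlg_mono le (split'.s_mem X)
  have hq : r (v (Matrix.single a₀ a₀ 1)) * r (v (Matrix.single a₀ a₀ 1))
      = r (v (Matrix.single a₀ a₀ 1)) := by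
    rw [← split.map_mul _ (hv _) _ (hv _), split'.s_mul, Matrix.single_mul_single_same, mul_one]
  have h0 : r (v (Matrix.single a₀ a₀ 1)) ≠ 0 := by
    intro h0
    apply hne
    have h1 : r (charIdem Ω φ) = 0 := by
      have h2 : (1 : Matrix (Fin m) (Fin m) Ω)
          = ∑ a, Matrix.single a a₀ 1 * Matrix.single a₀ a₀ 1 * Matrix.single a₀ a 1 := by
        ext a b
        simp [Matrix.sum_apply, Matrix.single_apply, Matrix.one_apply, ite_and]
      rw [split'.e_eq, h2, map_sum, map_sum]
      refine Finset.sum_eq_zero fun a _ => ?_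
      rw [← split'.s_mul, ← split'.s_mul, split.map_mul _ (mul_mem (hv _) (hv _)) _ (hv _),
        split.map_mul _ (hv _) _ (hv _), h0, mul_zero, zero_mul]
    exact split.mul_e_eq_zero_of_r_eq_zero (grpAlg_mono le split'.e_mem) h1
  obtain ⟨k, pos, α, β, h1, h2⟩ := exists_factor_of_idempotent hq h0
  exact ⟨⟨r, s, u, v, a₀, α, β, split, split', le, field, field', pos,
    h1, h2⟩, rfl⟩

end Compression

/-! ### Galois traces of block elements, and the algebra of a pair -/

section GaloisTrace

variable {Γ : Type*} [Group Γ] {F Ω : Type*} [Field F] [Field Ω] [Algebra F Ω]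
  (E : IntermediateField F Ω) [FiniteDimensional F E]

/-- The sum of the Galois conjugates of an element of `E Γ`. -/
def galTrace (x : MonoidAlgebra Ω Γ) : MonoidAlgebra Ω Γ := ∑ γ : E ≃ₐ[F] E, galAct γ x

variable {E}

theorem galTrace_mem [IsGalois F E] {K : Subgroup Γ} {x : MonoidAlgebra Ω Γ}
    (hx : x ∈ grpAlg (Ω := Ω) E K) : galTrace E x ∈ grpAlg (Ω := Ω) F K := by
  have hx' : x ∈ grpAlg (Ω := Ω) E ⊤ := grpAlg_mono le_top hx
  refine mem_grpAlg_of_galAct_eq (sum_mem fun γ _ => galAct_mem γ hx) fun γ => ?_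
  rw [galTrace, galAct_sum γ _ _ fun δ _ => galAct_mem δ hx']
  simp only [galAct_galAct _ _ hx']
  exact Equiv.sum_comp (Equiv.mulLeft γ) fun δ => galAct δ x

theorem mul_galTrace {a x : MonoidAlgebra Ω Γ} (ha : a ∈ grpAlg (Ω := Ω) F ⊤)
    (hx : x ∈ grpAlg (Ω := Ω) E ⊤) : a * galTrace E x = galTrace E (a * x) := by
  rw [galTrace, galTrace, Finset.mul_sum]
  refine Finset.sum_congr rfl fun γ _ => ?_
  rw [galAct_mul γ (mem_grpAlg_of_tower ha) hx, galAct_eq_self γ ha]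

theorem galTrace_zero : galTrace E (0 : MonoidAlgebra Ω Γ) = 0 :=
  Finset.sum_eq_zero fun γ _ => galAct_zero γ

/-- If conjugation by `h` followed by `γ` maps `x` to `y`, it maps the Galois trace of `x` to that
of `y`. -/
theorem conj_galTrace {x y : MonoidAlgebra Ω Γ} (hx : x ∈ grpAlg (Ω := Ω) E ⊤) {h : Γ}
    {γ : E ≃ₐ[F] E} (hxy : galAct γ (conj x h) = y) : conj (galTrace E x) h = galTrace E y := by
  have hc : conj x h ∈ grpAlg (Ω := Ω) E ⊤ := conj_mem_grpAlg (fun _ _ => Subgroup.mem_top _) hx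
  rw [galTrace, conj_sum, galTrace, ← Equiv.sum_comp (Equiv.mulRight γ)]
  refine Finset.sum_congr rfl fun δ _ => ?_
  rw [Equiv.coe_mulRight, ← galAct_conj _ hx, ← galAct_galAct _ _ hc, hxy]

variable {K : Subgroup Γ} {θ : K → Ω}
  {e : MonoidAlgebra Ω Γ} {n : ℕ} {r : MonoidAlgebra Ω Γ →ₗ[Ω] Matrix (Fin n) (Fin n) Ω}
  {s : Matrix (Fin n) (Fin n) Ω →ₗ[Ω] MonoidAlgebra Ω Γ}

/-- The conjugates of `e` are orthogonal, so multiplication by `e` picks out of the Galois trace of an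
element of the block the summand of the identity. -/
theorem IsSplit.galTrace_mul [Finite Γ] (h : IsSplit θ e r s) (hE : valueField F θ = E)
    {x : MonoidAlgebra Ω Γ} (hx : x ∈ grpAlg (Ω := Ω) E ⊤) (hxe : x * e = x) :
    galTrace E x * e = x := by
  have heE : e ∈ grpAlg (Ω := Ω) E ⊤ :=
    grpAlg_mono le_top (h.e_mem_grpAlg (apply_mem_of_valueField_eq hE))
  rw [galTrace, Finset.sum_mul, Finset.sum_eq_single 1]
  · rw [galAct_one hx, hxe]
  · intro γ _ hγ
    rw [← hxe, galAct_mul γ hx heE, mul_assoc, h.galAct_mul_eq_zero hE hγ, mul_zero]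
  · simp

/-- Semi-invariance `θ ^ (h γ) = θ` of a function on a subgroup normalized by `h`. -/
def SemiInv {K : Subgroup Γ} (θ : K → Ω) (h : Γ) (γ : E ≃ₐ[F] E) : Prop :=
  (∀ k, k ∈ K ↔ h * k * h⁻¹ ∈ K) ∧
    ∀ k k' : K, (k' : Γ) = h * k * h⁻¹ → galApply γ (θ k') = θ k

theorem SemiInv.inv_conj_mem {h : Γ} {γ : E ≃ₐ[F] E} (hs : SemiInv θ h γ) :
    ∀ k ∈ K, h⁻¹ * k * h ∈ K := fun k hk => by
  rw [hs.1]
  simpa [mul_assoc] using hk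

theorem SemiInv.apply {h : Γ} {γ : E ≃ₐ[F] E} (hs : SemiInv θ h γ) (k : K) :
    galApply γ (θ k) = θ ⟨h⁻¹ * k * h, hs.inv_conj_mem k k.2⟩ :=
  hs.2 _ _ (by simp [mul_assoc])

variable [Finite Γ]

theorem charEval_mem (hθ : ∀ k, θ k ∈ E) {x : MonoidAlgebra Ω Γ}
    (hx : x ∈ grpAlg (Ω := Ω) E K) : charEval θ x ∈ E := by
  rw [← evalLin_apply]
  induction hx using grpAlg_induction with
  | single k hk => rw [evalLin_apply, charEval_single θ ⟨k, hk⟩]; exact hθ _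
  | zero => rw [map_zero]; exact zero_mem _
  | add x y _ _ hx hy => rw [map_add]; exact add_mem hx hy
  | smul c x _ hx =>
    rw [← algebraMap_smul Ω c x, map_smul]
    exact mul_mem c.2 hx

theorem SemiInv.galApply_charEval (hθ : ∀ k, θ k ∈ E) {h : Γ} {γ : E ≃ₐ[F] E} (hs : SemiInv θ h γ)
    {x : MonoidAlgebra Ω Γ} (hx : x ∈ grpAlg (Ω := Ω) E K) :
    galApply γ (charEval θ x) = charEval θ (conj (galAct γ x) h) := by
  induction hx using grpAlg_induction with
  | single k hk =>
    have h1 : galAct γ (MonoidAlgebra.single k (1 : Ω)) = MonoidAlgebra.single k 1 :=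
      galAct_eq_self γ (single_mem_grpAlg hk)
    rw [h1, charEval_single θ ⟨k, hk⟩, conj_single, hs.apply]
    exact (charEval_single θ ⟨_, hs.inv_conj_mem k hk⟩).symm
  | zero => rw [galAct_zero, conj_zero, ← evalLin_apply, map_zero, galApply_zero]
  | add x y hx' hy' hx hy =>
    rw [galAct_add γ (grpAlg_mono le_top hx') (grpAlg_mono le_top hy'), conj_add, charEval_add,
      charEval_add, galApply_add γ (charEval_mem hθ hx') (charEval_mem hθ hy'), hx, hy]
  | smul c x hx' hx =>
    have h1 : c • x = (c : Ω) • x := (algebraMap_smul Ω c x).symm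
    rw [h1, galAct_smul γ c.2 (grpAlg_mono le_top hx'), conj_smul, charEval_smul, charEval_smul,
      galApply_mul γ c.2 (charEval_mem hθ hx'), hx]

end GaloisTrace

namespace Pair

variable {Γ : Type*} [Group Γ] {F Ω : Type*} [Field F] [Field Ω] [Algebra F Ω]
  {K L : Subgroup Γ} {θ : K → Ω} {φ : L → Ω} {E : IntermediateField F Ω} (p : Pair θ φ E)
  [Finite Γ]

theorem θ_mem (p : Pair θ φ E) (k : K) : θ k ∈ E := apply_mem_of_valueField_eq p.field k

theorem φ_mem (p : Pair θ φ E) (l : L) : φ l ∈ E := apply_mem_of_valueField_eq p.field' l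

theorem e_memE (p : Pair θ φ E) : charIdem Ω θ ∈ grpAlg (Ω := Ω) E K := p.split.e_mem_grpAlg p.θ_mem

theorem d_memE (p : Pair θ φ E) : charIdem Ω φ ∈ grpAlg (Ω := Ω) E L := p.split'.e_mem_grpAlg p.φ_mem

theorem de_memE (p : Pair θ φ E) : charIdem Ω φ * charIdem Ω θ ∈ grpAlg (Ω := Ω) E K :=
  mul_mem (grpAlg_mono p.le p.d_memE) p.e_memE

theorem de_comm (p : Pair θ φ E) :
    charIdem Ω φ * charIdem Ω θ = charIdem Ω θ * charIdem Ω φ := p.split.comm _ p.d_mem'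

variable [FiniteDimensional F E]

/-- The idempotent `i`, the Galois trace of `e_φ e_θ`. -/
def i (_p : Pair θ φ E) : MonoidAlgebra Ω Γ := galTrace E (charIdem Ω φ * charIdem Ω θ)

/-- The element `∑_γ λ^γ e_θ^γ` of the center of `F K`, on which `e_θ` projects to `λ e_θ`. -/
def zeta (_p : Pair θ φ E) (c : Ω) : MonoidAlgebra Ω Γ := galTrace E (c • charIdem Ω θ)

theorem i_eq_sum : p.i = ∑ γ : E ≃ₐ[F] E, galAct γ (charIdem Ω φ) * galAct γ (charIdem Ω θ) :=
  Finset.sum_congr rfl fun γ _ =>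
    galAct_mul γ (grpAlg_mono le_top p.d_memE) (grpAlg_mono le_top p.e_memE)

theorem smul_e_mem (p : Pair θ φ E) {c : Ω} (hc : c ∈ E) :
    c • charIdem Ω θ ∈ grpAlg (Ω := Ω) E K :=
  Subalgebra.smul_mem _ p.e_memE (⟨c, hc⟩ : E)

theorem conj_i {h : Γ} {γ : E ≃ₐ[F] E} (hθ : SemiInv θ h γ) (hφ : SemiInv φ h γ) :
    conj p.i h = p.i := by
  refine conj_galTrace (γ := γ) (grpAlg_mono le_top p.de_memE) ?_
  have hE : ∀ {M : Subgroup Γ} {x : MonoidAlgebra Ω Γ}, x ∈ grpAlg (Ω := Ω) E M →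
      conj x h ∈ grpAlg (Ω := Ω) E ⊤ := fun hx =>
    conj_mem_grpAlg (fun _ _ => Subgroup.mem_top _) (grpAlg_mono le_top hx)
  rw [conj_mul, galAct_mul γ (hE p.d_memE) (hE p.e_memE),
    p.split.galAct_conj_eq p.field hθ.1 hθ.2, p.split'.galAct_conj_eq p.field' hφ.1 hφ.2]

theorem conj_zeta {h : Γ} {γ : E ≃ₐ[F] E} (hθ : SemiInv θ h γ) {c : Ω} (hc : c ∈ E) :
    conj (p.zeta c) h = p.zeta (galApply γ c) := by
  refine conj_galTrace (γ := γ) (grpAlg_mono le_top (p.smul_e_mem hc)) ?_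
  rw [conj_smul, galAct_smul γ hc
    (conj_mem_grpAlg (fun _ _ => Subgroup.mem_top _) (grpAlg_mono le_top p.e_memE)),
    p.split.galAct_conj_eq p.field hθ.1 hθ.2]

variable [IsGalois F E]

theorem i_memF : p.i ∈ grpAlg (Ω := Ω) F K := galTrace_mem p.de_memE

theorem i_mem : p.i ∈ grpAlg (Ω := Ω) Ω K := mem_grpAlg_self p.i_memF

theorem i_mem_relCent : p.i ∈ relCent Ω K L := by
  refine mem_relCent.2 ⟨p.i_mem, fun y hy => commute_of_conj_eq (fun l hl => ?_) hy⟩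
  have hde : charIdem Ω φ * charIdem Ω θ ∈ grpAlg (Ω := Ω) E ⊤ := grpAlg_mono le_top p.de_memE
  refine conj_galTrace (γ := 1) hde ?_
  rw [(conj_eq_self_iff _ _).2, galAct_one hde]
  exact (mem_relCent.1 (mul_mem p.d_mem_relCent p.e_mem_relCent)).2 _ (single_mem_grpAlg hl)

theorem zeta_memF {c : Ω} (hc : c ∈ E) : p.zeta c ∈ grpAlg (Ω := Ω) F K :=
  galTrace_mem (p.smul_e_mem hc)

theorem zeta_mem {c : Ω} (hc : c ∈ E) : p.zeta c ∈ grpAlg (Ω := Ω) Ω K :=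
  mem_grpAlg_self (p.zeta_memF hc)

theorem zeta_comm {c : Ω} (hc : c ∈ E) {y : MonoidAlgebra Ω Γ} (hy : y ∈ grpAlg (Ω := Ω) Ω K) :
    p.zeta c * y = y * p.zeta c := by
  refine commute_of_conj_eq (fun k hk => ?_) hy
  refine conj_galTrace (γ := 1) (grpAlg_mono le_top (p.smul_e_mem hc)) ?_
  rw [(conj_eq_self_iff _ _).2, galAct_one (grpAlg_mono le_top (p.smul_e_mem hc))]
  rw [smul_mul_assoc, mul_smul_comm, p.split.comm _ (single_mem_grpAlg hk)]

theorem zeta_mem_relCent {c : Ω} (hc : c ∈ E) : p.zeta c ∈ relCent Ω K L :=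
  mem_relCent.2 ⟨p.zeta_mem hc, fun _ hy => p.zeta_comm hc (grpAlg_mono p.le hy)⟩

theorem i_mul_e : p.i * charIdem Ω θ = charIdem Ω φ * charIdem Ω θ :=
  p.split.galTrace_mul p.field (grpAlg_mono le_top p.de_memE) (by rw [mul_assoc, p.split.e_mul_e])

theorem zeta_mul_e {c : Ω} (hc : c ∈ E) : p.zeta c * charIdem Ω θ = c • charIdem Ω θ :=
  p.split.galTrace_mul p.field (grpAlg_mono le_top (p.smul_e_mem hc))
    (by rw [smul_mul_assoc, p.split.e_mul_e])

theorem i_mul_i : p.i * p.i = p.i := by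
  have hde : charIdem Ω φ * charIdem Ω θ ∈ grpAlg (Ω := Ω) E ⊤ := grpAlg_mono le_top p.de_memE
  refine (mul_galTrace (grpAlg_mono le_top p.i_memF) hde).trans (congrArg (galTrace E) ?_)
  rw [p.de_comm, ← mul_assoc, p.i_mul_e, mul_assoc, ← p.de_comm, ← mul_assoc, p.split'.e_mul_e,
    p.de_comm]

theorem P_i : p.P p.i = 1 := by
  rw [← p.P_mul_e p.i_mem, p.i_mul_e, p.P_mul_e p.d_mem', p.P_d]

theorem P_zeta {c : Ω} (hc : c ∈ E) : p.P (p.zeta c) = c • 1 := by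
  rw [← p.P_mul_e (p.zeta_mem hc), p.zeta_mul_e hc, map_smul, ← one_mul (charIdem Ω θ),
    p.P_mul_e (one_mem _), p.P_one]

theorem P_zeta_mul {c : Ω} (hc : c ∈ E) {x : MonoidAlgebra Ω Γ} (hx : x ∈ grpAlg (Ω := Ω) Ω K) :
    p.P (p.zeta c * x) = c • p.P x := by
  rw [p.P_mul (p.zeta_mem_relCent hc) hx, p.P_zeta hc, smul_mul_assoc, one_mul]

theorem P_mul_i {x : MonoidAlgebra Ω Γ} (hx : x ∈ grpAlg (Ω := Ω) Ω K) : p.P (x * p.i) = p.P x := by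
  rw [p.P_mul' hx p.i_mem_relCent, p.P_i, mul_one]

theorem P_i_mul {x : MonoidAlgebra Ω Γ} (hx : x ∈ grpAlg (Ω := Ω) Ω K) : p.P (p.i * x) = p.P x := by
  rw [p.P_mul p.i_mem_relCent hx, p.P_i, one_mul]

/-- The algebra `S = (i F K i)^L`, with unit element `i`. -/
def S : NonUnitalSubalgebra F (MonoidAlgebra Ω Γ) where
  carrier := {x | x ∈ grpAlg (Ω := Ω) F K ∧ x ∈ relCent Ω K L ∧ p.i * x = x ∧ x * p.i = x}
  zero_mem' := ⟨zero_mem _, zero_mem _, mul_zero _, zero_mul _⟩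
  add_mem' hx hy := ⟨add_mem hx.1 hy.1, add_mem hx.2.1 hy.2.1, by
    rw [mul_add, hx.2.2.1, hy.2.2.1], by rw [add_mul, hx.2.2.2, hy.2.2.2]⟩
  mul_mem' hx hy := ⟨mul_mem hx.1 hy.1, mul_mem hx.2.1 hy.2.1, by
    rw [← mul_assoc, hx.2.2.1], by rw [mul_assoc, hy.2.2.2]⟩
  smul_mem' c x hx := ⟨Subalgebra.smul_mem _ hx.1 c, by
    rw [← algebraMap_smul Ω c x]; exact Subalgebra.smul_mem _ hx.2.1 _, by
    rw [mul_smul_comm, hx.2.2.1], by rw [smul_mul_assoc, hx.2.2.2]⟩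

section

variable {p} {x y : MonoidAlgebra Ω Γ}

theorem mem_of_mem_S (hx : x ∈ p.S) : x ∈ grpAlg (Ω := Ω) Ω K := mem_grpAlg_self hx.1

theorem relCent_of_mem_S (hx : x ∈ p.S) : x ∈ relCent Ω K L := hx.2.1

theorem i_mul (hx : x ∈ p.S) : p.i * x = x := hx.2.2.1

theorem mul_i (hx : x ∈ p.S) : x * p.i = x := hx.2.2.2

end

theorem i_mem_S : p.i ∈ p.S := ⟨p.i_memF, p.i_mem_relCent, p.i_mul_i, p.i_mul_i⟩

theorem zeta_mul_mem_S {c : Ω} (hc : c ∈ E) {x : MonoidAlgebra Ω Γ} (hx : x ∈ p.S) :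
    p.zeta c * x ∈ p.S := by
  refine ⟨mul_mem (p.zeta_memF hc) hx.1, mul_mem (p.zeta_mem_relCent hc) hx.2.1, ?_, ?_⟩
  · rw [← mul_assoc, ← p.zeta_comm hc p.i_mem, mul_assoc, i_mul hx]
  · rw [mul_assoc, mul_i hx]

theorem P_mul_of_mem_S {x y : MonoidAlgebra Ω Γ} (hx : x ∈ p.S) (hy : y ∈ p.S) :
    p.P (x * y) = p.P x * p.P y := p.P_mul (relCent_of_mem_S hx) (mem_of_mem_S hy)

theorem eq_zero_of_P_eq_zero {x : MonoidAlgebra Ω Γ} (hx : x ∈ p.S) (h : p.P x = 0) : x = 0 := by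
  rw [← mul_i hx, i, mul_galTrace (grpAlg_mono le_top hx.1) (grpAlg_mono le_top p.de_memE),
    ← mul_assoc, p.mul_eq_zero_of_P_eq_zero hx.2.1 h, galTrace_zero]

theorem eq_of_P_eq {x y : MonoidAlgebra Ω Γ} (hx : x ∈ p.S) (hy : y ∈ p.S) (h : p.P x = p.P y) :
    x = y :=
  sub_eq_zero.1 (p.eq_zero_of_P_eq_zero (sub_mem hx hy) (by rw [map_sub, h, sub_self]))

/-- The `Ω`-span of `S` contains `(i Ω K i)^L`. -/
theorem mem_span_S {x : MonoidAlgebra Ω Γ} (hx : x ∈ relCent Ω K L) (h1 : p.i * x = x)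
    (h2 : x * p.i = x) : x ∈ Submodule.span Ω (p.S : Set (MonoidAlgebra Ω Γ)) := by
  refine Submodule.span_mono ?_ (mem_span_coeffMap F x)
  rintro _ ⟨f, rfl⟩
  have hx' := mem_relCent.1 hx
  have hm : coeffMap f x ∈ grpAlg (Ω := Ω) F K := coeffMap_mem f hx'.1
  refine ⟨hm, mem_relCent.2 ⟨mem_grpAlg_self hm, fun y hy => ?_⟩, ?_, ?_⟩
  · refine commute_of_mem_grpAlg (fun l hl => ?_) hy
    have hl' : MonoidAlgebra.single l (1 : Ω) ∈ grpAlg (Ω := Ω) F L := single_mem_grpAlg hl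
    rw [← coeffMap_mul_right f hl', ← coeffMap_mul_left f hl', hx'.2 _ (single_mem_grpAlg hl)]
  · rw [← coeffMap_mul_left f p.i_memF, h1]
  · rw [← coeffMap_mul_right f p.i_memF, h2]

theorem span_P_S : Submodule.span Ω (p.P '' p.S) = ⊤ := by
  rw [eq_top_iff]
  intro M _
  obtain ⟨x, hx, rfl⟩ := p.exists_P_eq M
  have hi := p.i_mem_relCent
  have hxi : x * p.i ∈ relCent Ω K L := mul_mem hx hi
  rw [← p.P_mul_i (mem_relCent.1 hx).1, ← p.P_i_mul (mem_relCent.1 hxi).1,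
    ← Submodule.map_span]
  refine Submodule.mem_map_of_mem (p.mem_span_S (mul_mem hi hxi) ?_ ?_)
  · rw [← mul_assoc, p.i_mul_i]
  · rw [mul_assoc, mul_assoc, p.i_mul_i]

/-- The trace of the compression. On a scalar form it is the reduced trace. -/
def t (x : MonoidAlgebra Ω Γ) : Ω := (p.P x).trace

theorem charEval_mul' {x y : MonoidAlgebra Ω Γ} (hx : x ∈ relCent Ω K L)
    (hy : y ∈ grpAlg (Ω := Ω) Ω L) :
    charEval θ (x * charIdem Ω φ * y) = p.t x * charEval φ y := p.charEval_mul hx hy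

/-- The trace can be read off from `θ(x e_φ l) = t(x) φ(l)`. -/
theorem t_mem {x : MonoidAlgebra Ω Γ} (hx : x ∈ p.S) : p.t x ∈ E := by
  obtain ⟨l, hl⟩ := p.split'.exists_apply_ne_zero
  have h1 := p.charEval_mul' hx.2.1 (single_mem_grpAlg l.2)
  rw [charEval_single] at h1
  rw [← mul_div_cancel_right₀ (p.t x) hl, ← h1]
  refine div_mem (charEval_mem p.θ_mem ?_) (p.φ_mem l)
  exact mul_mem (mul_mem (mem_grpAlg_of_tower hx.1) (grpAlg_mono p.le p.d_memE))
    (grpAlg_mono p.le (single_mem_grpAlg l.2))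

section SemiInv

variable {h : Γ} {γ : E ≃ₐ[F] E}

theorem conj_mem_relCent (hθ : SemiInv θ h γ) (hφ : SemiInv φ h γ) {x : MonoidAlgebra Ω Γ}
    (hx : x ∈ relCent Ω K L) : conj x h ∈ relCent Ω K L := by
  rw [mem_relCent] at hx ⊢
  refine ⟨conj_mem_grpAlg hθ.inv_conj_mem hx.1, fun y hy => ?_⟩
  have hy' : conj y h⁻¹ ∈ grpAlg (Ω := Ω) Ω L := by
    refine conj_mem_grpAlg (fun l hl => ?_) hy
    rw [inv_inv]
    exact (hφ.1 l).1 hl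
  have h1 := congrArg (fun z => conj z h) (hx.2 _ hy')
  simpa only [conj_mul, conj_inv_conj] using h1

theorem conj_mem_S (hθ : SemiInv θ h γ) (hφ : SemiInv φ h γ) {x : MonoidAlgebra Ω Γ}
    (hx : x ∈ p.S) : conj x h ∈ p.S := by
  refine ⟨conj_mem_grpAlg hθ.inv_conj_mem hx.1, conj_mem_relCent hθ hφ hx.2.1, ?_, ?_⟩
  · conv_lhs => rw [← p.conj_i hθ hφ, ← conj_mul, i_mul hx]
  · conv_lhs => rw [← p.conj_i hθ hφ, ← conj_mul, mul_i hx]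

/-- The trace is semi-invariant, as it is determined by `θ(x e_φ l) = t(x) φ(l)`. -/
theorem t_conj (hθ : SemiInv θ h γ) (hφ : SemiInv φ h γ) {x : MonoidAlgebra Ω Γ}
    (hx : x ∈ p.S) : p.t (conj x h) = galApply γ (p.t x) := by
  obtain ⟨l, hl⟩ := p.split'.exists_apply_ne_zero
  have hlm : MonoidAlgebra.single (l : Γ) (1 : Ω) ∈ grpAlg (Ω := Ω) F L := single_mem_grpAlg l.2
  have hxE : x ∈ grpAlg (Ω := Ω) E ⊤ := mem_grpAlg_of_tower (grpAlg_mono le_top hx.1)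
  have hdE : charIdem Ω φ ∈ grpAlg (Ω := Ω) E ⊤ := grpAlg_mono le_top p.d_memE
  have hlE : MonoidAlgebra.single (l : Γ) (1 : Ω) ∈ grpAlg (Ω := Ω) E ⊤ :=
    mem_grpAlg_of_tower (grpAlg_mono le_top hlm)
  have h1 := p.charEval_mul' hx.2.1 (mem_grpAlg_self hlm)
  rw [charEval_single] at h1
  have h2 := hθ.galApply_charEval p.θ_mem (x := x * charIdem Ω φ * MonoidAlgebra.single (l : Γ) 1)
    (mul_mem (mul_mem (mem_grpAlg_of_tower hx.1) (grpAlg_mono p.le p.d_memE))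
      (grpAlg_mono p.le (mem_grpAlg_of_tower hlm)))
  have hd : conj (galAct γ (charIdem Ω φ)) h = charIdem Ω φ := by
    rw [← galAct_conj γ hdE, p.split'.galAct_conj_eq p.field' hφ.1 hφ.2]
  rw [h1, galAct_mul γ (mul_mem hxE hdE) hlE, galAct_mul γ hxE hdE, galAct_eq_self γ hx.1,
    galAct_eq_self γ hlm, conj_mul, conj_mul, hd, conj_single,
    p.charEval_mul' (conj_mem_relCent hθ hφ hx.2.1) (single_mem_grpAlg (hφ.inv_conj_mem l l.2)),
    charEval_single φ ⟨_, hφ.inv_conj_mem l l.2⟩, ← hφ.apply l,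
    galApply_mul γ (p.t_mem hx) (p.φ_mem l)] at h2
  have h3 : galApply γ (φ l) ≠ 0 := by
    intro h0
    have h4 := galApply_galApply γ⁻¹ γ (p.φ_mem l)
    rw [h0, galApply_zero, inv_mul_cancel, galApply_one (p.φ_mem l)] at h4
    exact hl h4.symm
  exact (mul_right_cancel₀ h3 h2).symm

end SemiInv

theorem t_mul_comm {x y : MonoidAlgebra Ω Γ} (hx : x ∈ p.S) (hy : y ∈ p.S) :
    p.t (x * y) = p.t (y * x) := by
  rw [t, t, p.P_mul_of_mem_S hx hy, p.P_mul_of_mem_S hy hx, Matrix.trace_mul_comm]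

theorem exists_t_ne_zero : ∃ x ∈ p.S, p.t x ≠ 0 := by
  by_contra! hcon
  obtain ⟨a⟩ := p.pos
  have h1 : Matrix.single a a (1 : Ω) ∈ Submodule.span Ω (p.P '' p.S) :=
    p.span_P_S ▸ Submodule.mem_top
  have h2 : ∀ X ∈ Submodule.span Ω (p.P '' p.S), X.trace = 0 := by
    intro X hX
    induction hX using Submodule.span_induction with
    | mem x hx => obtain ⟨y, hy, rfl⟩ := hx; exact hcon y hy
    | zero => exact Matrix.trace_zero _ _
    | add x y _ _ hx hy => rw [Matrix.trace_add, hx, hy, add_zero]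
    | smul c x _ hx => rw [Matrix.trace_smul, hx, smul_zero]
  have h3 := h2 _ h1
  rw [Matrix.trace_single_eq_same] at h3
  exact one_ne_zero h3

/-- The center of `S` is `{ζ(c) i : c ∈ E}`. -/
theorem exists_eq_zeta {z : MonoidAlgebra Ω Γ} (hz : z ∈ p.S) (hc : ∀ y ∈ p.S, z * y = y * z) :
    ∃ c ∈ E, z = p.zeta c * p.i ∧ p.P z = c • 1 := by
  have h1 : ∀ Y, p.P z * Y = Y * p.P z := by
    intro Y
    have hY : Y ∈ Submodule.span Ω (p.P '' p.S) := p.span_P_S ▸ Submodule.mem_top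
    induction hY using Submodule.span_induction with
    | mem x hx =>
      obtain ⟨y, hy, rfl⟩ := hx
      rw [← p.P_mul_of_mem_S hz hy, hc y hy, p.P_mul_of_mem_S hy hz]
    | zero => rw [mul_zero, zero_mul]
    | add x y _ _ hx hy => rw [mul_add, hx, hy, add_mul]
    | smul c x _ hx => rw [mul_smul_comm, hx, smul_mul_assoc]
  obtain ⟨c, hcz⟩ := exists_scalar_of_commute h1
  have hcz' : p.P z = c • 1 := by rw [hcz]; ext a b; simp [Matrix.one_apply, Matrix.diagonal_apply]
  obtain ⟨y, hy, hty⟩ := p.exists_t_ne_zero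
  have h2 : p.t (z * y) = c * p.t y := by
    rw [t, p.P_mul_of_mem_S hz hy, hcz', smul_mul_assoc, one_mul, Matrix.trace_smul, smul_eq_mul, t]
  have hcE : c ∈ E := by
    have := div_mem (p.t_mem (mul_mem hz hy)) (p.t_mem hy)
    rwa [h2, mul_div_cancel_right₀ _ hty] at this
  refine ⟨c, hcE, p.eq_of_P_eq hz (p.zeta_mul_mem_S hcE p.i_mem_S) ?_, hcz'⟩
  rw [hcz', p.P_zeta_mul hcE p.i_mem, p.P_i]

end Pair

/-! ### Nonunital algebras with a spanning matrix representation -/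

section MatrixForm

variable {F A Ω : Type*} [Field F] [Ring A] [Algebra F A] [Field Ω] [Algebra F Ω] {k : ℕ}

/-- `T` is a finite-dimensional algebra with unit element `i`, on which `P` is a faithful
representation whose image spans the full matrix algebra. -/
structure IsMatrixForm (T : NonUnitalSubalgebra F A) (i : A)
    (P : A →+ Matrix (Fin k) (Fin k) Ω) : Prop where
  mem : i ∈ T
  one_mul : ∀ x ∈ T, i * x = x
  mul_one : ∀ x ∈ T, x * i = x
  map_mul : ∀ x ∈ T, ∀ y ∈ T, P (x * y) = P x * P y
  map_one : P i = 1
  injective : ∀ x ∈ T, P x = 0 → x = 0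
  span : Submodule.span Ω (P '' T) = ⊤
  finite : Module.Finite F T
  pos : Nonempty (Fin k)

namespace IsMatrixForm

variable {T : NonUnitalSubalgebra F A} {i : A} {P : A →+ Matrix (Fin k) (Fin k) Ω}

/-- The ring structure with unit element `i`. -/
abbrev ring (h : IsMatrixForm T i P) : Ring T :=
  { (inferInstance : NonUnitalRing T) with
    one := ⟨i, h.mem⟩
    one_mul := fun x => Subtype.ext (h.one_mul x x.2)
    mul_one := fun x => Subtype.ext (h.mul_one x x.2) }

/-- The matrix representation as a homomorphism of unital rings. -/
def hom (h : IsMatrixForm T i P) : @RingHom T (Matrix (Fin k) (Fin k) Ω) h.ring.toNonAssocSemiring _ :=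
  letI := h.ring
  { toFun := fun x => P x
    map_one' := h.map_one
    map_mul' := fun x y => h.map_mul x x.2 y y.2
    map_zero' := P.map_zero
    map_add' := fun x y => P.map_add x y }

theorem span_hom (h : IsMatrixForm T i P) : Submodule.span Ω (Set.range fun x : T => P x) = ⊤ := by
  rw [← h.span, Set.image_eq_range]
  rfl

theorem isSimpleRing (h : IsMatrixForm T i P) :
    @IsSimpleRing T h.ring.toNonAssocRing.toNonUnitalNonAssocRing := by
  let := h.ring
  let : Algebra F T := Algebra.ofModule (fun c x y => Subtype.ext (smul_mul_assoc c (x : A) y))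
    (fun c x y => Subtype.ext (mul_smul_comm c (x : A) y))
  have := h.pos
  have hfin : Module.Finite F T := h.finite
  have : IsArtinianRing T := IsArtinianRing.of_finite F T
  refine isSimpleRing_of_injective_of_span_eq_top h.hom ?_ h.span_hom
  rw [injective_iff_map_eq_zero]
  exact fun x hx => Subtype.ext (h.injective x x.2 hx)

/-- Membership in a subgroup that is stable under the center can be tested after extension of
scalars. -/
theorem mem_of_mem_span (h : IsMatrixForm T i P) (W : AddSubgroup A)
    (hW : ∀ z ∈ T, (∀ y ∈ T, z * y = y * z) → ∀ w ∈ T, w ∈ W → z * w ∈ W) {x : A} (hx : x ∈ T)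
    (hP : P x ∈ Submodule.span Ω (P '' {w | w ∈ T ∧ w ∈ W})) : x ∈ W := by
  let := h.ring
  have := h.pos
  have := h.isSimpleRing
  refine mem_of_mem_span_map (x := (⟨x, hx⟩ : T)) h.hom h.span_hom
    (W.comap (AddSubgroupClass.subtype T)) (fun z hz w hw => ?_) (Submodule.span_mono ?_ hP)
  · exact hW z z.2 (fun y hy => congrArg Subtype.val (hz ⟨y, hy⟩)) w w.2 hw
  · rintro _ ⟨w, ⟨hw, hw'⟩, rfl⟩
    exact ⟨⟨w, hw⟩, hw', rfl⟩

variable {n : ℕ} (ρ : T →ₙₐ[F] Matrix (Fin n) (Fin n) Ω)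

theorem map_one_of_span (h : IsMatrixForm T i P) (hρ : Submodule.span Ω (Set.range ρ) = ⊤) :
    ρ ⟨i, h.mem⟩ = 1 := by
  have h1 : ∀ X, ρ ⟨i, h.mem⟩ * X = X := by
    intro X
    have hX : X ∈ Submodule.span Ω (Set.range ρ) := hρ ▸ Submodule.mem_top
    induction hX using Submodule.span_induction with
    | mem x hx =>
      obtain ⟨y, rfl⟩ := hx
      rw [← _root_.map_mul]
      exact congrArg ρ (Subtype.ext (h.one_mul y y.2))
    | zero => rw [mul_zero]
    | add x y _ _ hx hy => rw [mul_add, hx, hy]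
    | smul c x _ hx => rw [mul_smul_comm, hx]
  have h2 := h1 1
  rwa [_root_.mul_one] at h2

/-- A reduced trace `1` in any spanning representation is a trace `1` in the given one. -/
theorem trace_eq_one (h : IsMatrixForm T i P) (hn : 0 < n)
    (hρ : Submodule.span Ω (Set.range ρ) = ⊤) {s : T} (hs : (ρ s).trace = 1) :
    (P s).trace = 1 := by
  let := h.ring
  have := h.pos
  have := h.isSimpleRing
  have : Nonempty (Fin n) := ⟨⟨0, hn⟩⟩
  let Q : T →+* Matrix (Fin n) (Fin n) Ω :=
    { toFun := fun x => ρ x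
      map_one' := h.map_one_of_span ρ hρ
      map_mul' := fun x y => _root_.map_mul ρ x y
      map_zero' := _root_.map_zero ρ
      map_add' := fun x y => _root_.map_add ρ x y }
  exact trace_eq_one_of_trace_eq_one Q h.hom hρ h.span_hom hs

end IsMatrixForm

end MatrixForm

/-! ### Basic configurations and scalar forms -/

namespace Config

variable {Γ : Type*} [Group Γ] [Finite Γ] {F Ω : Type*} [Field F] [Field Ω] [Algebra F Ω]
  {c : Config Γ Ω} {E : IntermediateField F Ω}

theorem IsBasic.L_le (hc : c.IsBasic F) : c.L ≤ c.K := hc.L_eq ▸ inf_le_right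

theorem IsBasic.semiInv (hc : c.IsBasic F) (hE : valueField F c.θ = E) {h : Γ} (hh : h ∈ c.H) :
    ∃ γ : E ≃ₐ[F] E, SemiInv c.θ h γ ∧ SemiInv c.φ h γ := by
  subst hE
  obtain ⟨γ, h1, h2⟩ := hc.semiInvariant h hh
  have hK : ∀ k, k ∈ c.K ↔ h * k * h⁻¹ ∈ c.K := fun k => by
    refine ⟨hc.normal h (hc.H_le hh) k, fun hk => ?_⟩
    have := hc.normal h⁻¹ (inv_mem (hc.H_le hh)) _ hk
    simpa [mul_assoc] using this
  refine ⟨γ, ⟨hK, h1⟩, fun k => ?_, h2⟩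
  have hH : k ∈ c.H ↔ h * k * h⁻¹ ∈ c.H := by
    rw [Subgroup.mul_mem_cancel_right _ (inv_mem hh), Subgroup.mul_mem_cancel_left _ hh]
  rw [hc.L_eq, Subgroup.mem_inf, Subgroup.mem_inf, ← hK, ← hH]

section Split

variable [IsAlgClosed Ω]

/-- The characters of a basic configuration have split blocks, and their idempotents satisfy
`e_φ e_θ ≠ 0`, since `φ` occurs in the restriction of `θ`. -/
theorem IsBasic.exists_split (hc : c.IsBasic F) :
    IsGalois F (valueField F c.θ) ∧ FiniteDimensional F (valueField F c.θ) ∧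
    ∃ (n m : ℕ) (r : MonoidAlgebra Ω Γ →ₗ[Ω] Matrix (Fin n) (Fin n) Ω)
    (s : Matrix (Fin n) (Fin n) Ω →ₗ[Ω] MonoidAlgebra Ω Γ)
    (u : MonoidAlgebra Ω Γ →ₗ[Ω] Matrix (Fin m) (Fin m) Ω)
    (v : Matrix (Fin m) (Fin m) Ω →ₗ[Ω] MonoidAlgebra Ω Γ),
    IsSplit c.θ (charIdem Ω c.θ) r s ∧ IsSplit c.φ (charIdem Ω c.φ) u v ∧
    charIdem Ω c.φ * charIdem Ω c.θ ≠ 0 := by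
  obtain ⟨n, m, ρ, τ, f, h1, h2, h3, h4, h5, h6, hf, hfρ⟩ := hc.chars
  obtain ⟨e, r, s, hr, hr1⟩ := exists_isSplit (Γ := Γ) ρ
  obtain ⟨d, u, v, hu, hu1⟩ := exists_isSplit (Γ := Γ) τ
  have hgal : IsGalois F (valueField F c.θ) := h3 ▸ isGalois_valueField ρ
  have hfin : FiniteDimensional F (valueField F c.θ) := h3 ▸ finiteDimensional_valueField ρ
  rw [h3] at hr
  rw [h6] at hu
  refine ⟨hgal, hfin, n, m, r, s, u, v, by rwa [hr.charIdem_eq], by rwa [hu.charIdem_eq], ?_⟩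
  rw [hr.charIdem_eq, hu.charIdem_eq]
  intro h0
  have hle := hc.L_le
  have hrd : r d = 0 := by
    rw [← hr.r_mul_e (grpAlg_mono hle hu.e_mem), h0, map_zero]
  have hint : ∀ y ∈ grpAlg (Ω := Ω) Ω c.L, LinearMap.toMatrix' f * u y
      = r y * LinearMap.toMatrix' f := by
    intro y hy
    induction hy using grpAlg_induction with
    | zero => rw [map_zero, map_zero, Matrix.mul_zero, Matrix.zero_mul]
    | add x y _ _ hx hy => rw [map_add, map_add, Matrix.mul_add, Matrix.add_mul, hx, hy]
    | smul c x _ hx => rw [map_smul, map_smul, Matrix.mul_smul, Matrix.smul_mul, hx]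
    | single l hl =>
      have h7 := hu1 ⟨l, hl⟩
      have h8 := hr1 ⟨l, hle hl⟩
      simp only at h7 h8
      rw [h7, h8, repMatrix, repMatrix, ← LinearMap.toMatrix'_comp, ← LinearMap.toMatrix'_comp]
      congr 1
      exact LinearMap.ext fun w => hfρ ⟨l, hl⟩ ⟨l, hle hl⟩ rfl w
  have h7 := hint d hu.e_mem
  rw [hu.r_e, hrd, Matrix.mul_one, Matrix.zero_mul] at h7
  exact hf (LinearMap.toMatrix'.injective (h7.trans (map_zero _).symm))

theorem IsBasic.nonempty_pair (hc : c.IsBasic F) (hE : valueField F c.θ = E) :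
    Nonempty (Pair c.θ c.φ E) := by
  obtain ⟨-, -, n, m, r, s, u, v, h1, h2, h3⟩ := hc.exists_split
  obtain ⟨a₀⟩ := h2.pos
  obtain ⟨p, -⟩ := exists_pair h1 h2 hc.L_le hE (hc.values.trans hE) h3 a₀
  exact ⟨p⟩

end Split

variable [FiniteDimensional F E] [IsGalois F E] (p : Pair c.θ c.φ E)

theorem i_eq (p : Pair c.θ c.φ E) : c.i F = p.i := by
  obtain rfl := p.field
  rw [i, finsum_eq_sum_of_fintype, p.i_eq_sum]

theorem S_eq (p : Pair c.θ c.φ E) : c.S F = p.S := by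
  ext x
  rw [S, c.i_eq p]
  constructor
  · rintro ⟨⟨a, ha, rfl⟩, h⟩
    have hm : p.i * a * p.i ∈ grpAlg (Ω := Ω) F c.K := mul_mem (mul_mem p.i_memF ha) p.i_memF
    refine ⟨hm, mem_relCent.2 ⟨mem_grpAlg_self hm, fun y hy => commute_of_conj_eq h hy⟩, ?_, ?_⟩
    · rw [← mul_assoc, ← mul_assoc, p.i_mul_i]
    · rw [mul_assoc, p.i_mul_i]
  · intro hx
    refine ⟨⟨x, hx.1, ?_⟩, conj_eq_of_commute (mem_relCent.1 hx.2.1).2⟩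
    rw [Pair.i_mul hx, Pair.mul_i hx]

theorem mem_S_iff (p : Pair c.θ c.φ E) {x : MonoidAlgebra Ω Γ} : x ∈ c.S F ↔ x ∈ p.S := by
  rw [c.S_eq p]; rfl

theorem invS_eq (p : Pair c.θ c.φ E) {x y : MonoidAlgebra Ω Γ} (hy : y ∈ p.S)
    (h1 : y * x = p.i) (h2 : x * y = p.i) : c.invS F x = y := by
  have h3 : c.invS F x ∈ c.S F ∧ c.invS F x * x = c.i F ∧ x * c.invS F x = c.i F :=
    Classical.epsilon_spec (p := fun t => t ∈ c.S F ∧ t * x = c.i F ∧ x * t = c.i F)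
      ⟨y, (c.mem_S_iff p).2 hy, by rw [h1, c.i_eq p], by rw [h2, c.i_eq p]⟩
  rw [c.mem_S_iff p, c.i_eq p] at h3
  rw [← Pair.mul_i h3.1, ← h2, ← mul_assoc, h3.2.1, Pair.i_mul hy]

theorem zeta_mul_i_mem_Z (p : Pair c.θ c.φ E) {a : Ω} (ha : a ∈ E) : p.zeta a * p.i ∈ c.Z F := by
  refine ⟨(c.mem_S_iff p).2 (p.zeta_mul_mem_S ha p.i_mem_S), fun s hs => ?_⟩
  rw [c.mem_S_iff p] at hs
  rw [mul_assoc, Pair.i_mul hs, ← mul_assoc, ← p.zeta_comm ha (Pair.mem_of_mem_S hs), mul_assoc,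
    Pair.mul_i hs]

theorem exists_zeta_of_mem_Z (p : Pair c.θ c.φ E) {z : MonoidAlgebra Ω Γ} (hz : z ∈ c.Z F) :
    ∃ a ∈ E, z = p.zeta a * p.i ∧ p.P z = a • 1 := by
  refine p.exists_eq_zeta ((c.mem_S_iff p).1 hz.1) fun y hy => hz.2 y ((c.mem_S_iff p).2 hy)

variable {S₀ : NonUnitalSubalgebra F (MonoidAlgebra Ω Γ)}

theorem IsScalarForm.mem_S (hS : c.IsScalarForm S₀) (p : Pair c.θ c.φ E) {x : MonoidAlgebra Ω Γ}
    (hx : x ∈ S₀) : x ∈ p.S := (c.mem_S_iff p).1 (hS.subset hx)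

theorem IsScalarForm.mem_of_mem_Z₀ (hS : c.IsScalarForm S₀) {z : MonoidAlgebra Ω Γ}
    (hz : z ∈ c.Z₀ F) : z ∈ S₀ := by
  rw [← hS.center] at hz
  exact hz.1

/-- The algebra `S` is spanned by the products `s ζ(a)` with `s ∈ S₀`. -/
theorem IsScalarForm.induction (hS : c.IsScalarForm S₀) (p : Pair c.θ c.φ E)
    {q : MonoidAlgebra Ω Γ → Prop} (mul : ∀ s ∈ S₀, ∀ a ∈ E, q (p.zeta a * s)) (zero : q 0)
    (add : ∀ x y, q x → q y → q (x + y)) (smul : ∀ (a : F) x, q x → q (a • x))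
    {x : MonoidAlgebra Ω Γ} (hx : x ∈ p.S) : q x := by
  rw [← c.mem_S_iff p, ← hS.span] at hx
  refine Submodule.span_induction ?_ zero (fun x y _ _ => add x y) (fun a x _ => smul a x) hx
  rintro _ ⟨s, hs, z, hz, rfl⟩
  obtain ⟨a, ha, rfl, -⟩ := c.exists_zeta_of_mem_Z p hz
  have hs' := hS.mem_S p hs
  rw [p.zeta_comm ha p.i_mem, ← mul_assoc, Pair.mul_i hs', ← p.zeta_comm ha (Pair.mem_of_mem_S hs')]
  exact mul s hs a ha

theorem IsScalarForm.span_P (hS : c.IsScalarForm S₀) (p : Pair c.θ c.φ E) :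
    Submodule.span Ω (p.P '' S₀) = ⊤ := by
  rw [eq_top_iff, ← p.span_P_S, Submodule.span_le]
  rintro _ ⟨x, hx, rfl⟩
  refine hS.induction p (q := fun x => p.P x ∈ Submodule.span Ω (p.P '' S₀)) ?_ ?_ ?_ ?_ hx
  · intro s hs a ha
    rw [p.P_zeta_mul ha (Pair.mem_of_mem_S (hS.mem_S p hs))]
    exact Submodule.smul_mem _ _ (Submodule.subset_span ⟨s, hs, rfl⟩)
  · rw [map_zero]; exact zero_mem _
  · intro x y hx hy
    rw [map_add]; exact add_mem hx hy
  · intro a x hx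
    rw [← algebraMap_smul Ω a x, map_smul]
    exact Submodule.smul_mem _ _ hx

variable (hsemi : ∀ h ∈ c.H, ∃ γ : E ≃ₐ[F] E, SemiInv c.θ h γ ∧ SemiInv c.φ h γ)

include hsemi in
theorem IsScalarForm.i_mem (hS : c.IsScalarForm S₀) : p.i ∈ S₀ := by
  refine hS.mem_of_mem_Z₀ ⟨⟨(c.mem_S_iff p).2 p.i_mem_S, fun s hs => ?_⟩, fun h hh => ?_⟩
  · rw [c.mem_S_iff p] at hs
    rw [Pair.i_mul hs, Pair.mul_i hs]
  · obtain ⟨γ, h1, h2⟩ := hsemi h hh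
    exact p.conj_i h1 h2

include hsemi in
/-- A scalar form is an `F`-form of a full matrix algebra over `Ω`, through the compression. -/
theorem IsScalarForm.isMatrixForm (hS : c.IsScalarForm S₀) :
    IsMatrixForm S₀ p.i p.P.toAddMonoidHom where
  mem := hS.i_mem p hsemi
  one_mul _ hx := Pair.i_mul (hS.mem_S p hx)
  mul_one _ hx := Pair.mul_i (hS.mem_S p hx)
  map_mul _ hx _ hy := p.P_mul_of_mem_S (hS.mem_S p hx) (hS.mem_S p hy)
  map_one := p.P_i
  injective _ hx h0 := p.eq_zero_of_P_eq_zero (hS.mem_S p hx) h0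
  span := hS.span_P p
  finite := by
    have h1 : S₀.toSubmodule ≤ Subalgebra.toSubmodule (grpAlg (Ω := Ω) F c.K) :=
      fun x hx => (hS.mem_S p hx).1
    have : Module.Finite F (Subalgebra.toSubmodule (grpAlg (Ω := Ω) F c.K)) :=
      inferInstanceAs (Module.Finite F (grpAlg (Ω := Ω) F c.K))
    exact Submodule.finiteDimensional_of_le h1
  pos := p.pos

include hsemi in
theorem IsScalarForm.zeta_mul_mem (hS : c.IsScalarForm S₀) {a : Ω} (ha : a ∈ E)
    (hfix : ∀ h ∈ c.H, conj (p.zeta a) h = p.zeta a) {s : MonoidAlgebra Ω Γ} (hs : s ∈ S₀) :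
    p.zeta a * s ∈ S₀ := by
  have h1 : p.zeta a * p.i ∈ S₀ := by
    refine hS.mem_of_mem_Z₀ ⟨c.zeta_mul_i_mem_Z p ha, fun h hh => ?_⟩
    obtain ⟨γ, h1, h2⟩ := hsemi h hh
    rw [conj_mul, hfix h hh, p.conj_i h1 h2]
  rw [← Pair.i_mul (hS.mem_S p hs), ← mul_assoc]
  exact mul_mem h1 hs

/-- A central element of `S₀` has the form `ζ(a) i` and is fixed by `H`. -/
theorem IsScalarForm.exists_zeta (hS : c.IsScalarForm S₀) {z : MonoidAlgebra Ω Γ} (hz : z ∈ S₀)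
    (hc : ∀ y ∈ S₀, z * y = y * z) :
    ∃ a ∈ E, z = p.zeta a * p.i ∧ p.P z = a • 1 ∧ ∀ h ∈ c.H, conj z h = z := by
  have h1 : z ∈ c.Z₀ F := by
    rw [← hS.center]
    exact ⟨hz, hc⟩
  obtain ⟨a, ha, h2, h3⟩ := c.exists_zeta_of_mem_Z p h1.1
  exact ⟨a, ha, h2, h3, h1.2⟩

theorem IsScalarForm.exists_t_ne_zero (hS : c.IsScalarForm S₀) : ∃ s ∈ S₀, p.t s ≠ 0 := by
  obtain ⟨x, hx, hxt⟩ := p.exists_t_ne_zero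
  by_contra! hcon
  apply hxt
  refine hS.induction p (q := fun x => p.t x = 0) ?_ ?_ ?_ ?_ hx
  · intro s hs a ha
    rw [Pair.t, p.P_zeta_mul ha (Pair.mem_of_mem_S (hS.mem_S p hs)), Matrix.trace_smul, ← Pair.t,
      hcon s hs, smul_zero]
  · rw [Pair.t, map_zero, Matrix.trace_zero]
  · intro x y hx hy
    rw [Pair.t, map_add, Matrix.trace_add, ← Pair.t, ← Pair.t, hx, hy, add_zero]
  · intro a x hx
    rw [Pair.t, ← algebraMap_smul Ω a x, map_smul, Matrix.trace_smul, ← Pair.t, hx, smul_zero]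

section Trace

include hsemi

/-- The elements of `S₀` of reduced trace `1` are those for which the compression has trace `1`. They
exist if the elements of `H` act on `S₀` by inner automorphisms of `S`. -/
theorem IsScalarForm.traceOne_spec (hS : c.IsScalarForm S₀)
    (hinner : ∀ h ∈ c.H, ∃ x ∈ p.S, ∃ y ∈ p.S, x * y = p.i ∧ y * x = p.i ∧
      ∀ s ∈ S₀, x * conj s h = s * x) :
    c.traceOne S₀ ∈ S₀ ∧ p.t (c.traceOne S₀) = 1 := by
  have hform := hS.isMatrixForm p hsemi
  have hex : ∃ s₀ : MonoidAlgebra Ω Γ, ∃ s z : S₀, (s : MonoidAlgebra Ω Γ) = s₀ ∧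
      (z : MonoidAlgebra Ω Γ) = c.i F ∧ HasReducedTrace S₀ s z := by
    obtain ⟨s, hs, hst⟩ := hS.exists_t_ne_zero p
    have hs' := hS.mem_S p hs
    -- the scalar `t(s)` is fixed by `H`, so `ζ(t(s)⁻¹) s` lies in `S₀`; its trace is `1`
    have hinv : (p.t s)⁻¹ ∈ E := inv_mem (p.t_mem hs')
    have hfix : ∀ h ∈ c.H, conj (p.zeta (p.t s)⁻¹) h = p.zeta (p.t s)⁻¹ := by
      intro h hh
      obtain ⟨γ, h1, h2⟩ := hsemi h hh
      obtain ⟨x, hx, y, hy, hxy, hyx, hx1⟩ := hinner h hh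
      rw [p.conj_zeta h1 hinv]
      congr 1
      have h3 : p.t s = galApply γ (p.t s) := by
        rw [← p.t_conj h1 h2 hs']
        have h4 := p.conj_mem_S h1 h2 hs'
        calc p.t s = p.t (s * x * y) := by rw [mul_assoc, hxy, Pair.mul_i hs']
          _ = p.t (x * (conj s h * y)) := by rw [← hx1 s hs, mul_assoc]
          _ = p.t (conj s h) := by
            rw [p.t_mul_comm hx (mul_mem h4 hy), mul_assoc, hyx, Pair.mul_i h4]
      have h5 : galApply γ (p.t s)⁻¹ * galApply γ (p.t s) = 1 := by
        rw [← galApply_mul γ hinv (p.t_mem hs'), inv_mul_cancel₀ hst,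
          ← map_one (algebraMap F Ω), galApply_algebraMap]
      rw [← h3] at h5
      exact eq_inv_of_mul_eq_one_left h5
    have hmem := hS.zeta_mul_mem p hsemi hinv hfix hs
    refine ⟨_, ⟨_, hmem⟩, ⟨p.i, hform.mem⟩, rfl, (c.i_eq p).symm, fun t => Subtype.ext ?_, p.k,
      { toFun := fun x => p.P x
        map_smul' := fun a x => ?_
        map_zero' := map_zero p.P
        map_add' := fun x y => map_add p.P _ _
        map_mul' := fun x y => hform.map_mul x x.2 y y.2 }, Fin.pos_iff_nonempty.2 p.pos,
      hform.span_hom, ?_⟩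
    · exact (hform.one_mul t t.2).trans (hform.mul_one t t.2).symm
    · change p.P (a • (x : MonoidAlgebra Ω Γ)) = a • p.P x
      rw [← algebraMap_smul Ω a (x : MonoidAlgebra Ω Γ), map_smul, algebraMap_smul]
    · change p.P p.i = Matrix.scalar _ (p.P (p.zeta (p.t s)⁻¹ * s)).trace
      rw [p.P_i, p.P_zeta_mul hinv (Pair.mem_of_mem_S hs'), Matrix.trace_smul, ← Pair.t, smul_eq_mul,
        inv_mul_cancel₀ hst, map_one]
  obtain ⟨s, z, h1, h2, -, n, ρ, hn, hρ, h3⟩ : ∃ s z : S₀, (s : MonoidAlgebra Ω Γ) = c.traceOne S₀ ∧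
      (z : MonoidAlgebra Ω Γ) = c.i F ∧ HasReducedTrace S₀ s z := Classical.epsilon_spec hex
  rw [← h1]
  refine ⟨s.2, hform.trace_eq_one ρ hn hρ ?_⟩
  have hz : z = ⟨p.i, hform.mem⟩ := Subtype.ext (h2.trans (c.i_eq p))
  rw [hz, hform.map_one_of_span ρ hρ] at h3
  have h4 := congrFun (congrFun h3 ⟨0, hn⟩) ⟨0, hn⟩
  simpa using h4.symm

end Trace

include hsemi in
/-- On the scalar form, a magic crossed representation induces the action of `H`. -/
theorem IsMagicCrossed.spec {σ : c.H ⧸ c.L.subgroupOf c.H → MonoidAlgebra Ω Γ}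
    (hσ : c.IsMagicCrossed S₀ σ) (h : c.H) :
    σ h ∈ p.S ∧ (∃ y ∈ p.S, σ h * y = p.i ∧ y * σ h = p.i) ∧
      ∀ s ∈ S₀, σ h * conj s h = s * σ h := by
  obtain ⟨hS, hinv, ε, h1, -, h3⟩ := hσ
  obtain ⟨h4, y, h5, h6, h7⟩ := hinv h
  rw [c.mem_S_iff p] at h4 h5
  rw [c.i_eq p] at h6 h7
  refine ⟨h4, ⟨y, h5, h7, h6⟩, fun s hs => ?_⟩
  have hs' := hS.mem_S p hs
  rw [h3 h s (hS.subset hs)]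
  congr 1
  have hi : p.i ∈ c.Z F := ⟨(c.mem_S_iff p).2 p.i_mem_S, fun s hs => by
    rw [c.mem_S_iff p] at hs
    rw [Pair.i_mul hs, Pair.mul_i hs]⟩
  have h8 := h1 h s hs p.i hi
  rw [Pair.mul_i hs'] at h8
  obtain ⟨γ, h9, h10⟩ := hsemi h h.2
  rw [h8, p.conj_i h9 h10, Pair.mul_i hs']

/-- The cocycle identity of a magic crossed representation, with `ε` eliminated. -/
theorem IsMagicCrossed.mul_conj {σ : c.H ⧸ c.L.subgroupOf c.H → MonoidAlgebra Ω Γ}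
    (hσ : c.IsMagicCrossed S₀ σ) (x y : c.H) :
    σ y * conj (σ x) (y : Γ) = σ ((x * y : c.H)) := by
  obtain ⟨-, hinv, ε, -, h2, h3⟩ := hσ
  rw [h3 y _ (hinv x).1, h2]

end Config

section

/-! ### Extending intertwiners from a corner -/

section Corner

variable {F A : Type*} [Field F] [Ring A] [Algebra F A] {T : NonUnitalSubalgebra F A}
  {i j τ : A} {n : ℕ} {a b : Fin n → A}

/-- An element intertwining two homomorphisms on the corner `j T j` extends to one intertwining them
on `T`, provided that `T j T` contains the unit element of `T`. -/
theorem extend_intertwiner (f g : A →+* A) (ha : ∀ k, a k ∈ T) (hb : ∀ k, b k ∈ T)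
    (hi : ∑ k, a k * j * b k = i) (hiT : ∀ x ∈ T, i * x = x) (hTi : ∀ x ∈ T, x * i = x)
    (hj : j ∈ T) (hf : f j = j) (hg : g j = j) (hjτ : j * τ = τ) (hτj : τ * j = τ)
    (hτ : ∀ x ∈ T, f (j * x * j) * τ = τ * g (j * x * j)) :
    (∀ s ∈ T, f s * (∑ k, f (a k) * τ * g (b k)) = (∑ k, f (a k) * τ * g (b k)) * g s) ∧
      (∑ k, f (a k) * τ * g (b k)) * j = τ := by
  constructor
  · intro s hs
    have key : ∀ k l, f (a l * j * b l * (s * a k)) * τ * g (b k)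
        = f (a l) * τ * g (b l) * g (s * (a k * j * b k)) := by
      intro k l
      have h1 := hτ (b l * s * a k) (mul_mem (mul_mem (hb l) hs) (ha k))
      calc f (a l * j * b l * (s * a k)) * τ * g (b k)
          = f (a l) * (f (j * (b l * s * a k) * j) * τ) * g (b k) := by
            conv_lhs => rw [← hjτ]
            simp only [map_mul, mul_assoc, hf]
        _ = f (a l) * (τ * j) * g (b l) * g (s * (a k * j * b k)) := by
            rw [h1]
            simp only [map_mul, mul_assoc, hg]
        _ = _ := by rw [hτj]
    calc f s * (∑ k, f (a k) * τ * g (b k))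
        = ∑ k, f (i * (s * a k)) * τ * g (b k) := by
          rw [Finset.mul_sum]
          refine Finset.sum_congr rfl fun k _ => ?_
          rw [hiT _ (mul_mem hs (ha k)), map_mul]
          simp only [mul_assoc]
      _ = ∑ k, ∑ l, f (a l) * τ * g (b l) * g (s * (a k * j * b k)) := by
          refine Finset.sum_congr rfl fun k _ => ?_
          rw [← hi, Finset.sum_mul, map_sum, Finset.sum_mul, Finset.sum_mul]
          exact Finset.sum_congr rfl fun l _ => key k l
      _ = (∑ l, f (a l) * τ * g (b l)) * g (s * i) := by
          rw [Finset.sum_comm, ← hi, Finset.mul_sum, map_sum, Finset.sum_mul_sum]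
      _ = _ := by rw [hTi s hs]
  · calc (∑ k, f (a k) * τ * g (b k)) * j = ∑ k, f (a k) * (τ * g (j * b k * j)) := by
          rw [Finset.sum_mul]
          refine Finset.sum_congr rfl fun k _ => ?_
          rw [map_mul, map_mul, hg]
          conv_lhs => rw [← hτj]
          simp only [mul_assoc]
      _ = f (∑ k, a k * j * b k * j) * τ := by
          rw [map_sum, Finset.sum_mul]
          refine Finset.sum_congr rfl fun k _ => ?_
          rw [← hτ _ (hb k)]
          simp only [map_mul, mul_assoc]
      _ = τ := by rw [← Finset.sum_mul, hi, hiT j hj, hf, hjτ]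

/-- An intertwiner is determined by its product with `j`. -/
theorem intertwiner_eq_zero (f g : A →+* A) (ha : ∀ k, a k ∈ T) (hi : ∑ k, a k * j * b k = i)
    (hg : g j = j) {D : A} (hD : ∀ s ∈ T, f s * D = D * g s) (hDi : D * g i = D)
    (hDj : D * j = 0) : D = 0 := by
  rw [← hDi, ← hi, map_sum, Finset.mul_sum]
  refine Finset.sum_eq_zero fun k _ => ?_
  rw [map_mul, map_mul, hg, ← mul_assoc, ← mul_assoc, ← hD _ (ha k), mul_assoc (f _), hDj, mul_zero,
    zero_mul]

end Corner

/-! ### Spanning sets of matrix algebras -/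

section MatrixSpan

variable {Ω : Type*} [Field Ω] {k : ℕ} {T : Set (Matrix (Fin k) (Fin k) Ω)}

open Pointwise in
/-- The full matrix algebra is simple. -/
theorem span_mul_mul_eq_top (hT : Submodule.span Ω T = ⊤) {X : Matrix (Fin k) (Fin k) Ω}
    (hX : X ≠ 0) : Submodule.span Ω (T * {X} * T) = ⊤ := by
  rw [← Submodule.span_mul_span, ← Submodule.span_mul_span, hT, eq_top_iff]
  obtain ⟨a, b, hab⟩ : ∃ a b, X a b ≠ 0 := by
    by_contra! hcon
    exact hX (Matrix.ext hcon)
  intro Y _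
  rw [Matrix.matrix_eq_sum_single Y]
  refine sum_mem fun x _ => sum_mem fun y _ => ?_
  have h1 : Matrix.single x y (Y x y)
      = Matrix.single x a (Y x y * (X a b)⁻¹) * X * Matrix.single b y 1 := by
    rw [Matrix.single_mul_mul_single, mul_one, mul_assoc, inv_mul_cancel₀ hab, mul_one]
  rw [h1]
  exact Submodule.mul_mem_mul (Submodule.mul_mem_mul Submodule.mem_top
    (Submodule.mem_span_singleton_self X)) Submodule.mem_top

/-- A matrix of trace zero is a linear combination of commutators. -/
theorem mem_span_commutator (hT : Submodule.span Ω T = ⊤) {X : Matrix (Fin k) (Fin k) Ω}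
    (hX : X.trace = 0) :
    X ∈ Submodule.span Ω {Z | ∃ M ∈ T, ∃ N ∈ T, Z = M * N - N * M} := by
  set W := Submodule.span Ω {Z | ∃ M ∈ T, ∃ N ∈ T, Z = M * N - N * M}
  have h1 : ∀ M ∈ T, ∀ N : Matrix (Fin k) (Fin k) Ω, M * N - N * M ∈ W := by
    intro M hM N
    have hN : N ∈ Submodule.span Ω T := hT ▸ Submodule.mem_top
    induction hN using Submodule.span_induction with
    | mem N hN => exact Submodule.subset_span ⟨M, hM, N, hN, rfl⟩
    | zero => simp
    | add x y _ _ hx hy =>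
      have : M * (x + y) - (x + y) * M = (M * x - x * M) + (M * y - y * M) := by noncomm_ring
      rw [this]; exact add_mem hx hy
    | smul c x _ hx =>
      rw [mul_smul_comm, smul_mul_assoc, ← smul_sub]; exact Submodule.smul_mem _ _ hx
  have h2 : ∀ M N : Matrix (Fin k) (Fin k) Ω, M * N - N * M ∈ W := by
    intro M N
    have hM : M ∈ Submodule.span Ω T := hT ▸ Submodule.mem_top
    induction hM using Submodule.span_induction with
    | mem M hM => exact h1 M hM N
    | zero => simp
    | add x y _ _ hx hy =>
      have : (x + y) * N - N * (x + y) = (x * N - N * x) + (y * N - N * y) := by noncomm_ring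
      rw [this]; exact add_mem hx hy
    | smul c x _ hx =>
      rw [mul_smul_comm, smul_mul_assoc, ← smul_sub]; exact Submodule.smul_mem _ _ hx
  rcases isEmpty_or_nonempty (Fin k) with hk | ⟨⟨o⟩⟩
  · rw [Subsingleton.elim X 0]; exact zero_mem _
  have h3 : X = ∑ a, ∑ b, X a b • (Matrix.single a o 1 * Matrix.single o b 1
      - Matrix.single o b 1 * Matrix.single a o (1 : Ω)) := by
    simp only [smul_sub, Finset.sum_sub_distrib]
    have h4 : ∑ a, ∑ b, X a b • (Matrix.single o b 1 * Matrix.single a o (1 : Ω)) = 0 := by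
      have : ∀ a, ∑ b, X a b • (Matrix.single o b 1 * Matrix.single a o (1 : Ω))
          = X a a • Matrix.single o o 1 := by
        intro a
        rw [Finset.sum_eq_single a]
        · rw [Matrix.single_mul_single_same, mul_one]
        · intro b _ hb
          rw [Matrix.single_mul_single_of_ne _ _ _ _ hb, smul_zero]
        · simp
      simp only [this]
      rw [← Finset.sum_smul]
      have h5 : ∑ a, X a a = 0 := hX
      rw [h5, zero_smul]
    rw [h4, sub_zero]
    conv_lhs => rw [Matrix.matrix_eq_sum_single X]
    refine Finset.sum_congr rfl fun a _ => Finset.sum_congr rfl fun b _ => ?_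
    rw [Matrix.single_mul_single_same, mul_one, Matrix.smul_single, smul_eq_mul, mul_one]
  rw [h3]
  exact sum_mem fun a _ => sum_mem fun b _ => Submodule.smul_mem _ _ (h2 _ _)

end MatrixSpan

/-! ### Towers of two configurations -/

variable {Γ : Type*} [Group Γ] [Finite Γ] {F Ω : Type*} [Field F] [Field Ω] [Algebra F Ω]
  {U H K N L : Subgroup Γ} {θ : K → Ω} {η : N → Ω} {φ : L → Ω} {E : IntermediateField F Ω}
  [FiniteDimensional F E] [IsGalois F E]

/-- Scalar forms for the three configurations of a tower. The primitive idempotents of `Ω L e_φ`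
used to compress `Ω N` and `Ω K` are the same. -/
structure Tower (U H : Subgroup Γ) (p₁ : Pair θ η E) (p₂ : Pair η φ E) (p : Pair θ φ E)
    (S₁₀ S₂₀ S₀ : NonUnitalSubalgebra F (MonoidAlgebra Ω Γ)) : Prop where
  form₁ : Config.IsScalarForm (⟨⊤, U, K, N, θ, η⟩ : Config Γ Ω) S₁₀
  form₂ : Config.IsScalarForm (⟨U, H, N, L, η, φ⟩ : Config Γ Ω) S₂₀
  form : Config.IsScalarForm (⟨⊤, H, K, L, θ, φ⟩ : Config Γ Ω) S₀
  semi₁ : ∀ u ∈ U, ∃ γ : E ≃ₐ[F] E, SemiInv θ u γ ∧ SemiInv η u γ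
  semi : ∀ h ∈ H, ∃ γ : E ≃ₐ[F] E, SemiInv θ h γ ∧ SemiInv η h γ ∧ SemiInv φ h γ
  factor : ∀ u ∈ U, ∃ h ∈ H, ∃ n ∈ N, u = h * n
  H_le : H ≤ U
  prod : ∀ s₁ ∈ S₁₀, ∀ s₂ ∈ S₂₀, s₁ * s₂ ∈ S₀
  mu_eq : p.mu p.a₀ p.a₀ = p₂.mu p₂.a₀ p₂.a₀

namespace Tower

variable {p₁ : Pair θ η E} {p₂ : Pair η φ E} {p : Pair θ φ E}
  {S₁₀ S₂₀ S₀ : NonUnitalSubalgebra F (MonoidAlgebra Ω Γ)}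
  (T : Tower U H p₁ p₂ p S₁₀ S₂₀ S₀)

include T

theorem semi_c : ∀ h ∈ H, ∃ γ : E ≃ₐ[F] E, SemiInv θ h γ ∧ SemiInv φ h γ := fun h hh =>
  let ⟨γ, h1, _, h3⟩ := T.semi h hh
  ⟨γ, h1, h3⟩

theorem semi₂ : ∀ h ∈ H, ∃ γ : E ≃ₐ[F] E, SemiInv η h γ ∧ SemiInv φ h γ := fun h hh =>
  let ⟨γ, _, h2, h3⟩ := T.semi h hh
  ⟨γ, h2, h3⟩

variable {x y : MonoidAlgebra Ω Γ}

theorem mem_S₁ (hx : x ∈ S₁₀) : x ∈ p₁.S := T.form₁.mem_S p₁ hx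

theorem mem_S₂ (hx : x ∈ S₂₀) : x ∈ p₂.S := T.form₂.mem_S p₂ hx

theorem mem_S (hx : x ∈ S₀) : x ∈ p.S := T.form.mem_S p hx

omit T in
theorem comm (hx : x ∈ p₁.S) (hy : y ∈ grpAlg (Ω := Ω) Ω N) : x * y = y * x :=
  (mem_relCent.1 (Pair.relCent_of_mem_S hx)).2 y hy

omit T in
theorem comm' (hx : x ∈ p₁.S) (hy : y ∈ p₂.S) : x * y = y * x := comm hx (Pair.mem_of_mem_S hy)

theorem i₁_mem : p₁.i ∈ S₁₀ := by
  exact Config.IsScalarForm.i_mem (c := ⟨⊤, U, K, N, θ, η⟩) p₁ T.semi₁ T.form₁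

theorem i₂_mem : p₂.i ∈ S₂₀ := by
  exact Config.IsScalarForm.i_mem (c := ⟨U, H, N, L, η, φ⟩) p₂ T.semi₂ T.form₂

theorem i_mem : p.i ∈ S₀ := by
  exact Config.IsScalarForm.i_mem (c := ⟨⊤, H, K, L, θ, φ⟩) p T.semi_c T.form

theorem isMatrixForm : IsMatrixForm S₀ p.i p.P.toAddMonoidHom := by
  exact Config.IsScalarForm.isMatrixForm (c := ⟨⊤, H, K, L, θ, φ⟩) p T.semi_c T.form

theorem j_mem : p₁.i * p₂.i ∈ S₀ := T.prod _ T.i₁_mem _ T.i₂_mem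

omit T in
theorem i_comm (p₁ : Pair θ η E) (p₂ : Pair η φ E) : p₁.i * p₂.i = p₂.i * p₁.i :=
  comm' p₁.i_mem_S p₂.i_mem_S

omit T in
theorem j_mul_j (p₁ : Pair θ η E) (p₂ : Pair η φ E) :
    p₁.i * p₂.i * (p₁.i * p₂.i) = p₁.i * p₂.i := by
  rw [mul_assoc, ← mul_assoc p₂.i, ← i_comm, mul_assoc, p₂.i_mul_i, ← mul_assoc, p₁.i_mul_i]

theorem conj_j {h : Γ} (hh : h ∈ H) : conj (p₁.i * p₂.i) h = p₁.i * p₂.i := by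
  obtain ⟨γ, h1, h2, h3⟩ := T.semi h hh
  rw [conj_mul, p₁.conj_i h1 h2, p₂.conj_i h2 h3]

omit T in
theorem jIdem_eq (p₁ : Pair θ η E) (p₂ : Pair η φ E) : jIdem F θ η φ = p₁.i * p₂.i := by
  obtain rfl := p₁.field
  rw [jIdem, finsum_eq_sum_of_fintype]
  have hη : charIdem Ω η ∈ grpAlg (Ω := Ω) (valueField F θ) ⊤ := grpAlg_mono le_top p₁.d_memE
  have hde := grpAlg_mono (le_top (a := K)) p₁.de_memE
  have h1 : p₁.i * charIdem Ω η = charIdem Ω η * charIdem Ω θ := by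
    refine p₁.split'.galTrace_mul p₁.field' hde ?_
    rw [p₁.de_comm, mul_assoc, p₁.split'.e_mul_e]
  have h2 : p₁.i * p₂.i
      = galTrace (valueField F θ) (p₁.i * (charIdem Ω φ * charIdem Ω η)) :=
    mul_galTrace (grpAlg_mono le_top p₁.i_memF) (grpAlg_mono le_top p₂.de_memE)
  rw [h2, p₂.de_comm, ← mul_assoc, h1, p₁.de_comm]
  rfl

/-- Under `e_θ`, the factor `i₁` of an element amounts to `e_η`. -/
theorem mul_mul_e (hx : x * p₁.i = x) (hy : y ∈ grpAlg (Ω := Ω) Ω K) :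
    x * y * charIdem Ω θ = x * charIdem Ω η * y * charIdem Ω θ := by
  have h1 : x * charIdem Ω θ = x * charIdem Ω η * charIdem Ω θ := by
    conv_lhs => rw [← hx, mul_assoc, p₁.i_mul_e, ← mul_assoc]
  rw [mul_assoc, p₁.split.comm y hy, ← mul_assoc, h1, mul_assoc, ← p₁.split.comm y hy, ← mul_assoc]

omit T in
theorem relCent_mul (hx : x ∈ relCent Ω K N) (hy : y ∈ relCent Ω N L) (hKN : N ≤ K) (hNL : L ≤ N) :
    x * y ∈ relCent Ω K L := by
  rw [mem_relCent] at hx hy ⊢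
  refine ⟨mul_mem hx.1 (grpAlg_mono hKN hy.1), fun z hz => ?_⟩
  rw [mul_assoc, hy.2 z hz, ← mul_assoc, hx.2 z (grpAlg_mono hNL hz), mul_assoc]

/-- The compression traces are multiplicative in towers. -/
theorem t_mul (hx : x ∈ p₁.S) (hy : y ∈ relCent Ω N L) : p.t (x * y) = p₁.t x * p₂.t y := by
  obtain ⟨l, hl⟩ := p.split'.exists_apply_ne_zero
  have hlm : MonoidAlgebra.single (l : Γ) (1 : Ω) ∈ grpAlg (Ω := Ω) Ω L := single_mem_grpAlg l.2
  have hy' := mem_relCent.1 hy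
  have hz : y * charIdem Ω φ * MonoidAlgebra.single (l : Γ) 1 ∈ grpAlg (Ω := Ω) Ω N :=
    mul_mem (mul_mem hy'.1 p₂.d_mem') (grpAlg_mono p₂.le hlm)
  have h1 := p.charEval_mul' (relCent_mul hx.2.1 hy p₁.le p₂.le) hlm
  have h2 := p₁.charEval_mul' hx.2.1 hz
  rw [p₂.charEval_mul' hy hlm] at h2
  have hxK := Pair.mem_of_mem_S hx
  have hzK := grpAlg_mono p₁.le hz
  have h3 : charEval θ (x * charIdem Ω η * (y * charIdem Ω φ * MonoidAlgebra.single (l : Γ) 1))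
      = charEval θ (x * y * charIdem Ω φ * MonoidAlgebra.single (l : Γ) 1) := by
    rw [← p.split.charEval_mul_e (mul_mem (mul_mem hxK p₁.d_mem') hzK),
      ← T.mul_mul_e (Pair.mul_i hx) hzK, p.split.charEval_mul_e (mul_mem hxK hzK)]
    simp only [mul_assoc]
  rw [h2, h1, charEval_single, ← mul_assoc] at h3
  exact (mul_right_cancel₀ hl h3).symm

/-- The idempotent `j` is nonzero, because the trace is multiplicative in towers. -/
theorem P_j_ne_zero : p.P (p₁.i * p₂.i) ≠ 0 := by
  intro h0
  have h1 := p.eq_zero_of_P_eq_zero (T.mem_S T.j_mem) h0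
  obtain ⟨x, hx, hxt⟩ := p₁.exists_t_ne_zero
  obtain ⟨y, hy, hyt⟩ := p₂.exists_t_ne_zero
  apply mul_ne_zero hxt hyt
  rw [← T.t_mul hx hy.2.1, ← Pair.mul_i hx, ← Pair.i_mul hy, mul_assoc, ← mul_assoc p₁.i, h1,
    zero_mul, mul_zero, Pair.t, map_zero, Matrix.trace_zero]

open Pointwise in
/-- The idempotent `j` is full in the simple algebra `S₀`. -/
theorem exists_sum_eq_i : ∃ (n : ℕ) (a b : Fin n → MonoidAlgebra Ω Γ), (∀ k, a k ∈ S₀) ∧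
    (∀ k, b k ∈ S₀) ∧ ∑ k, a k * (p₁.i * p₂.i) * b k = p.i := by
  set j := p₁.i * p₂.i
  let W : Submodule F (MonoidAlgebra Ω Γ) :=
    Submodule.span F {x | ∃ a ∈ S₀, ∃ b ∈ S₀, x = a * j * b}
  have h1 : p.i ∈ W := by
    refine T.isMatrixForm.mem_of_mem_span W.toAddSubgroup ?_ T.i_mem ?_
    · intro z hz _ w _ hw
      rw [Submodule.mem_toAddSubgroup] at hw ⊢
      refine Submodule.span_induction (fun x hx => ?_) ?_ (fun x y _ _ hx hy => ?_)
        (fun c x _ hx => ?_) hw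
      · obtain ⟨a, ha, b, hb, rfl⟩ := hx
        exact Submodule.subset_span ⟨z * a, mul_mem hz ha, b, hb, by simp only [mul_assoc]⟩
      · rw [mul_zero]; exact zero_mem _
      · rw [mul_add]; exact add_mem hx hy
      · rw [mul_smul_comm]; exact Submodule.smul_mem _ _ hx
    · have h2 := span_mul_mul_eq_top T.isMatrixForm.span T.P_j_ne_zero
      have h3 : p.P.toAddMonoidHom p.i ∈ Submodule.span Ω
          ((p.P.toAddMonoidHom '' S₀) * {p.P j} * (p.P.toAddMonoidHom '' S₀)) :=
        h2 ▸ Submodule.mem_top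
      refine Submodule.span_mono ?_ h3
      rintro _ ⟨_, ⟨_, ⟨a, ha, rfl⟩, _, rfl, rfl⟩, _, ⟨b, hb, rfl⟩, rfl⟩
      have haj := mul_mem ha T.j_mem
      refine ⟨a * j * b, ⟨mul_mem haj hb, Submodule.subset_span ⟨a, ha, b, hb, rfl⟩⟩, ?_⟩
      rw [T.isMatrixForm.map_mul _ haj _ hb, T.isMatrixForm.map_mul _ ha _ T.j_mem]
      rfl
  obtain ⟨n, f, g, hfg⟩ := Submodule.mem_span_set'.1 h1
  choose a ha b hb hab using fun k => (g k).2
  refine ⟨n, fun k => f k • a k, b, fun k => SMulMemClass.smul_mem _ (ha k), hb, ?_⟩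
  rw [← hfg]
  refine Finset.sum_congr rfl fun k _ => ?_
  rw [hab, smul_mul_assoc, smul_mul_assoc]

/-- Elements of `Ω N` with the same compression for the lower pair have the same compression for the
composite pair after multiplication by an element centralizing `Ω N`. -/
theorem P_mul_eq (hx : x ∈ relCent Ω K N) (hxi : x * p₁.i = x) {w : MonoidAlgebra Ω Γ}
    (hy : y ∈ grpAlg (Ω := Ω) Ω N) (hw : w ∈ grpAlg (Ω := Ω) Ω N) (h : p₂.P y = p₂.P w) :
    p.P (x * y) = p.P (x * w) := by
  have hx' := mem_relCent.1 hx
  set f := p.mu p.a₀ p.a₀ with hf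
  have hfN : f ∈ grpAlg (Ω := Ω) Ω N := grpAlg_mono p₂.le (p.mu_mem _ _)
  have hfK : f ∈ grpAlg (Ω := Ω) Ω K := p.mu_mem' _ _
  have h1 : ∀ z ∈ grpAlg (Ω := Ω) Ω N,
      p.P (x * z) = p.P (x * (f * z * f * charIdem Ω η)) := by
    intro z hz
    have hzK := grpAlg_mono p₁.le hz
    have hfz : f * z * f ∈ grpAlg (Ω := Ω) Ω N := mul_mem (mul_mem hfN hz) hfN
    have hfzK := grpAlg_mono p₁.le hfz
    rw [← p.P_mu_mul (mul_mem hx'.1 hzK), ← p.P_mul_mu (mul_mem hfK (mul_mem hx'.1 hzK)), ← hf]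
    have h2 : f * (x * z) * f = x * (f * z * f) := by
      rw [← mul_assoc, ← hx'.2 f hfN]
      simp only [mul_assoc]
    rw [h2, ← p.P_mul_e (mul_mem hx'.1 hfzK), T.mul_mul_e hxi hfzK,
      p.P_mul_e (mul_mem (mul_mem hx'.1 p₁.d_mem') hfzK), mul_assoc, p₁.split'.comm _ hfz]
  have h3 : f * y * f * charIdem Ω η = f * w * f * charIdem Ω η := by
    refine p₂.split.mul_e_eq_of_r_eq (mul_mem (mul_mem hfN hy) hfN) (mul_mem (mul_mem hfN hw) hfN) ?_
    rw [hf, T.mu_eq, ← p₂.α_mul_P hy, ← p₂.α_mul_P hw, h]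
  rw [h1 y hy, h1 w hw, h3]

end Tower

end

section

/-! ### Class functions and scalar forms -/

section ClassFunction

variable {Γ : Type*} [Group Γ] [Finite Γ] {F Ω : Type*} [Field F] [Field Ω] [Algebra F Ω]

theorem apply_mul_comm_of_mem_charSpan {V : Subgroup Γ} {e : MonoidAlgebra Ω Γ} {χ : V → Ω}
    (hχ : χ ∈ charSpan V e) (v w : V) : χ (v * w) = χ (w * v) := by
  induction hχ using Submodule.span_induction with
  | mem χ h =>
    obtain ⟨⟨n, ρ, -, rfl⟩, -⟩ := h
    exact ρ.char_mul_comm w v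
  | zero => rfl
  | add χ ψ _ _ h1 h2 => rw [Pi.add_apply, Pi.add_apply, h1, h2]
  | smul c χ _ h => rw [Pi.smul_apply, Pi.smul_apply, h]

variable {c : Config Γ Ω} {E : IntermediateField F Ω} [FiniteDimensional F E] [IsGalois F E]
  {S₀ : NonUnitalSubalgebra F (MonoidAlgebra Ω Γ)}

/-- If `X` induces the action of `h` on the scalar form `S₀`, then the value `χ(s X⁻¹ h)` of a class
function depends only on the reduced trace of `s ∈ S₀`. -/
theorem Config.IsScalarForm.charEval_eq_of_t_eq (hS : c.IsScalarForm S₀) (p : Pair c.θ c.φ E)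
    (hsemi : ∀ h ∈ c.H, ∃ γ : E ≃ₐ[F] E, SemiInv c.θ h γ ∧ SemiInv c.φ h γ) {h : Γ} (hh : h ∈ c.H)
    {X Y : MonoidAlgebra Ω Γ} (hX : X ∈ p.S) (hY : Y ∈ p.S) (hXY : X * Y = p.i) (hYX : Y * X = p.i)
    (hint : ∀ s ∈ S₀, X * conj s h = s * X) {V : Subgroup Γ} (hV : c.K ≤ V) (hhV : h ∈ V)
    {χ : V → Ω} (hχ : ∀ v w, χ (v * w) = χ (w * v)) {s s' : MonoidAlgebra Ω Γ} (hs : s ∈ S₀)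
    (hs' : s' ∈ S₀) (hst : p.t s = p.t s') :
    charEval χ (s * Y * MonoidAlgebra.single h 1)
      = charEval χ (s' * Y * MonoidAlgebra.single h 1) := by
  have hSV : ∀ {a}, a ∈ p.S → a ∈ grpAlg (Ω := Ω) Ω V := fun ha =>
    grpAlg_mono hV (Pair.mem_of_mem_S ha)
  have hhm : MonoidAlgebra.single h (1 : Ω) ∈ grpAlg (Ω := Ω) Ω V := single_mem_grpAlg hhV
  have hmove : ∀ a : MonoidAlgebra Ω Γ,
      MonoidAlgebra.single h 1 * a = conj a h⁻¹ * MonoidAlgebra.single h 1 := fun a => by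
    rw [← single_mul_conj (conj a h⁻¹) h, conj_inv_conj]
  obtain ⟨γ, hγθ, hγφ⟩ := hsemi h⁻¹ (inv_mem hh)
  obtain ⟨δ, hδθ, hδφ⟩ := hsemi h hh
  let f : MonoidAlgebra Ω Γ →+ Ω :=
    ((evalLin χ).toAddMonoidHom.comp (AddMonoidHom.mulRight (MonoidAlgebra.single h (1 : Ω)))).comp
      (AddMonoidHom.mulRight Y)
  change f s = f s'
  have hf : ∀ a, f a = charEval χ (a * Y * MonoidAlgebra.single h 1) := fun a => rfl
  by_cases hfix : ∃ a ∈ E, galApply γ a ≠ a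
  · -- the center of `S` is moved by `h`, and the class function vanishes
    obtain ⟨a, ha, hne⟩ := hfix
    have hmu0 : a - galApply γ a ≠ 0 := sub_ne_zero.2 hne.symm
    have hmu : (a - galApply γ a)⁻¹ ∈ E := inv_mem (sub_mem ha (galApply_mem γ ha))
    have key : ∀ b ∈ p.S, f (p.zeta a * b) = f (p.zeta (galApply γ a) * b) := by
      intro b hb
      have hbY : b * Y ∈ p.S := mul_mem hb hY
      rw [hf, hf, mul_assoc (p.zeta a), mul_assoc (p.zeta a),
        charEval_mul_comm hχ (grpAlg_mono hV (p.zeta_mem ha)) (mul_mem (hSV hbY) hhm), mul_assoc,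
        hmove, p.conj_zeta hγθ ha, ← mul_assoc,
        ← p.zeta_comm (galApply_mem γ ha) (Pair.mem_of_mem_S hbY), ← mul_assoc]
    have hzero : ∀ b ∈ p.S, f b = 0 := by
      intro b hb
      set b' := p.zeta (a - galApply γ a)⁻¹ * b with hb'
      have hbS : b' ∈ p.S := p.zeta_mul_mem_S hmu hb
      have h1 : b = p.zeta a * b' - p.zeta (galApply γ a) * b' := by
        refine p.eq_of_P_eq hb (sub_mem (p.zeta_mul_mem_S ha hbS)
          (p.zeta_mul_mem_S (galApply_mem γ ha) hbS)) ?_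
        rw [map_sub, p.P_zeta_mul ha (Pair.mem_of_mem_S hbS),
          p.P_zeta_mul (galApply_mem γ ha) (Pair.mem_of_mem_S hbS), ← sub_smul, hb',
          p.P_zeta_mul hmu (Pair.mem_of_mem_S hb), smul_smul, mul_inv_cancel₀ hmu0, one_smul]
      rw [h1, map_sub, key _ hbS, sub_self]
    rw [hzero _ (hS.mem_S p hs), hzero _ (hS.mem_S p hs')]
  · -- `h` centralizes the center of `S`, and `f` vanishes on commutators
    push Not at hfix
    have hintS : ∀ b ∈ p.S, X * conj b h = b * X := by
      intro b hb
      refine hS.induction p (q := fun b => X * conj b h = b * X) ?_ ?_ ?_ ?_ hb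
      · intro b hb a ha
        have h1 : conj (p.zeta a) h = p.zeta a := by
          have h2 := p.conj_zeta hγθ ha
          rw [hfix a ha] at h2
          conv_lhs => rw [← h2, conj_inv_conj]
        rw [conj_mul, h1, ← mul_assoc, ← p.zeta_comm ha (Pair.mem_of_mem_S hX), mul_assoc, hint b hb,
          mul_assoc]
      · rw [conj_zero, mul_zero, zero_mul]
      · intro x y hx hy
        rw [conj_add, mul_add, hx, hy, add_mul]
      · intro a x hx
        rw [conj_smul, mul_smul_comm, hx, smul_mul_assoc]
    have hYint : ∀ b ∈ p.S, Y * conj b h⁻¹ = b * Y := by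
      intro b hb
      have hb' : conj b h⁻¹ ∈ p.S := p.conj_mem_S hγθ hγφ hb
      have h1 := hintS _ hb'
      rw [conj_inv_conj] at h1
      calc Y * conj b h⁻¹ = Y * (conj b h⁻¹ * X) * Y := by
            rw [mul_assoc, mul_assoc, hXY, Pair.mul_i hb']
        _ = b * Y := by rw [← h1, ← mul_assoc, hYX, Pair.i_mul hb]
    have hcomm : ∀ a ∈ p.S, ∀ b ∈ p.S, f (a * b) = f (b * a) := by
      intro a ha b hb
      rw [hf, hf, mul_assoc a, mul_assoc a,
        charEval_mul_comm hχ (hSV ha) (mul_mem (hSV (mul_mem hb hY)) hhm), mul_assoc, hmove,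
        ← mul_assoc, mul_assoc b, hYint a ha, ← mul_assoc]
    have hform := hS.isMatrixForm p hsemi
    let W : AddSubgroup (MonoidAlgebra Ω Γ) :=
      AddSubgroup.closure {x | ∃ a ∈ S₀, ∃ b ∈ S₀, x = a * b - b * a}
    have hW : s - s' ∈ W := by
      refine hform.mem_of_mem_span W ?_ (sub_mem hs hs') ?_
      · intro z hz hzc w _ hw
        refine AddSubgroup.closure_induction (fun x hx => ?_) ?_ (fun x y _ _ hx hy => ?_)
          (fun x _ hx => ?_) hw
        · obtain ⟨a, ha, b, hb, rfl⟩ := hx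
          refine AddSubgroup.subset_closure ⟨z * a, mul_mem hz ha, b, hb, ?_⟩
          rw [mul_sub, ← mul_assoc, ← mul_assoc, ← mul_assoc, hzc b hb]
        · rw [mul_zero]; exact zero_mem _
        · rw [mul_add]; exact add_mem hx hy
        · rw [mul_neg]; exact neg_mem hx
      · have htr : (p.P.toAddMonoidHom (s - s')).trace = 0 := by
          change (p.P (s - s')).trace = 0
          rw [map_sub, Matrix.trace_sub, sub_eq_zero]
          exact hst
        refine Submodule.span_mono ?_ (mem_span_commutator hform.span htr)
        rintro _ ⟨_, ⟨a, ha, rfl⟩, _, ⟨b, hb, rfl⟩, rfl⟩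
        refine ⟨a * b - b * a, ⟨sub_mem (mul_mem ha hb) (mul_mem hb ha),
          AddSubgroup.subset_closure ⟨a, ha, b, hb, rfl⟩⟩, ?_⟩
        rw [map_sub, hform.map_mul a ha b hb, hform.map_mul b hb a ha]
    have hWf : ∀ w ∈ W, f w = 0 := by
      intro w hw
      refine AddSubgroup.closure_induction (fun x hx => ?_) (map_zero f)
        (fun x y _ _ hx hy => by rw [map_add, hx, hy, add_zero])
        (fun x _ hx => by rw [map_neg, hx, neg_zero]) hw
      obtain ⟨a, ha, b, hb, rfl⟩ := hx
      rw [map_sub, hcomm a (hS.mem_S p ha) b (hS.mem_S p hb), sub_self]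
    have h1 := hWf _ hW
    rwa [map_sub, sub_eq_zero] at h1

end ClassFunction

/-! ### The composite magic crossed representation -/

variable {Γ : Type*} [Group Γ] [Finite Γ] {F Ω : Type*} [Field F] [Field Ω] [Algebra F Ω]
  {U H K N L : Subgroup Γ} {θ : K → Ω} {η : N → Ω} {φ : L → Ω} {E : IntermediateField F Ω}
  [FiniteDimensional F E] [IsGalois F E]

namespace Tower

variable {p₁ : Pair θ η E} {p₂ : Pair η φ E} {p : Pair θ φ E}
  {S₁₀ S₂₀ S₀ : NonUnitalSubalgebra F (MonoidAlgebra Ω Γ)}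
  (T : Tower U H p₁ p₂ p S₁₀ S₂₀ S₀) {x y : MonoidAlgebra Ω Γ}

include T

open Pointwise in
/-- A double centralizer argument over `Ω`: since `Ω N e_η` is a matrix algebra, the elements of
`j Ω K j` are sums of products of elements centralizing `Ω N` and elements of `i₂ Ω N i₂`. After
compression, the former come from `S₁₀` and the latter from `S₂₀`. -/
theorem P_corner_mem (hx : x ∈ grpAlg (Ω := Ω) Ω K) :
    p.P (p₁.i * p₂.i * x * (p₁.i * p₂.i)) ∈ Submodule.span Ω
      (p.P '' ((S₁₀ : Set (MonoidAlgebra Ω Γ)) * (S₂₀ : Set (MonoidAlgebra Ω Γ)))) := by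
  have h₂K : p₂.i ∈ grpAlg (Ω := Ω) Ω K := grpAlg_mono p₁.le p₂.i_mem
  have hi₁ := mem_relCent.1 p₁.i_mem_relCent
  -- `c a b` are the coefficients of `i₁ x i₁` with respect to the matrix units of `Ω N e_η`
  let c : Fin p₁.m → Fin p₁.m → MonoidAlgebra Ω Γ := fun a b => p₁.i * p₁.spread a b x * p₁.i
  have hc : ∀ a b, c a b ∈ relCent Ω K N := fun a b =>
    mul_mem (mul_mem p₁.i_mem_relCent (p₁.spread_mem a b hx)) p₁.i_mem_relCent
  have hci : ∀ a b, c a b * p₁.i = c a b := fun a b => by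
    simp only [c]; rw [mul_assoc, p₁.i_mul_i]
  have h1 : p₁.i * p₂.i * x * (p₁.i * p₂.i) * charIdem Ω θ
      = (∑ a, ∑ b, c a b * (p₂.i * p₁.mu a b * p₂.i)) * charIdem Ω θ := by
    calc p₁.i * p₂.i * x * (p₁.i * p₂.i) * charIdem Ω θ
        = p₂.i * p₁.i * x * p₁.i * p₂.i * charIdem Ω θ := by
          rw [i_comm p₁ p₂, ← i_comm p₁ p₂, ← mul_assoc, i_comm p₁ p₂]
      _ = p₂.i * p₁.i * (x * p₁.i * charIdem Ω η * p₂.i) * charIdem Ω θ := by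
          rw [T.mul_mul_e (by rw [mul_assoc, p₁.i_mul_i]) h₂K]
          simp only [mul_assoc]
      _ = p₂.i * p₁.i * charIdem Ω η * (x * p₁.i * charIdem Ω η * p₂.i) * charIdem Ω θ := by
          rw [T.mul_mul_e (by rw [mul_assoc, p₁.i_mul_i])
            (mul_mem (mul_mem (mul_mem hx p₁.i_mem) p₁.d_mem') h₂K)]
      _ = p₂.i * p₁.i * (charIdem Ω η * x * charIdem Ω η) * p₁.i * p₂.i * charIdem Ω θ := by
          have h2 : p₁.i * charIdem Ω η = charIdem Ω η * p₁.i := hi₁.2 _ p₁.d_mem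
          rw [mul_assoc x, h2]
          simp only [mul_assoc]
      _ = _ := by
          congr 1
          rw [p₁.d_mul_mul_d, Finset.mul_sum, Finset.sum_mul, Finset.sum_mul]
          refine Finset.sum_congr rfl fun a _ => ?_
          rw [Finset.mul_sum, Finset.sum_mul, Finset.sum_mul]
          refine Finset.sum_congr rfl fun b _ => ?_
          have h3 := (mem_relCent.1 (hc a b)).2 _ p₂.i_mem
          have h4 := hi₁.2 _ (p₁.mu_mem a b)
          calc p₂.i * p₁.i * (p₁.spread a b x * p₁.mu a b) * p₁.i * p₂.i
              = p₂.i * p₁.i * p₁.spread a b x * (p₁.mu a b * p₁.i) * p₂.i := by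
                simp only [mul_assoc]
            _ = p₂.i * c a b * p₁.mu a b * p₂.i := by
                rw [← h4]; simp only [c, mul_assoc]
            _ = _ := by rw [← h3]; simp only [mul_assoc]
  have hmuK : ∀ a b, p₂.i * p₁.mu a b * p₂.i ∈ grpAlg (Ω := Ω) Ω N := fun a b =>
    mul_mem (mul_mem p₂.i_mem (p₁.mu_mem a b)) p₂.i_mem
  have hjm : p₁.i * p₂.i * x * (p₁.i * p₂.i) ∈ grpAlg (Ω := Ω) Ω K :=
    mul_mem (mul_mem (mul_mem p₁.i_mem h₂K) hx) (mul_mem p₁.i_mem h₂K)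
  have hsm : ∑ a, ∑ b, c a b * (p₂.i * p₁.mu a b * p₂.i) ∈ grpAlg (Ω := Ω) Ω K :=
    sum_mem fun a _ => sum_mem fun b _ =>
      mul_mem (mem_relCent.1 (hc a b)).1 (grpAlg_mono p₁.le (hmuK a b))
  rw [← p.P_mul_e hjm, h1, p.P_mul_e hsm, map_sum]
  refine sum_mem fun a _ => ?_
  rw [map_sum]
  refine sum_mem fun b _ => ?_
  obtain ⟨c', hc', hPc⟩ : ∃ c' ∈ Submodule.span Ω (S₁₀ : Set (MonoidAlgebra Ω Γ)),
      p₁.P c' = p₁.P (c a b) := by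
    have h2 : p₁.P (c a b) ∈ Submodule.span Ω (p₁.P '' S₁₀) :=
      T.form₁.span_P p₁ ▸ Submodule.mem_top
    rwa [← Submodule.map_span] at h2
  obtain ⟨w, hw, hPw⟩ : ∃ w ∈ Submodule.span Ω (S₂₀ : Set (MonoidAlgebra Ω Γ)),
      p₂.P w = p₂.P (p₂.i * p₁.mu a b * p₂.i) := by
    have h2 : p₂.P (p₂.i * p₁.mu a b * p₂.i) ∈ Submodule.span Ω (p₂.P '' S₂₀) :=
      T.form₂.span_P p₂ ▸ Submodule.mem_top
    rwa [← Submodule.map_span] at h2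
  have hc'1 : c' ∈ relCent Ω K N := by
    refine Submodule.span_le (p := Subalgebra.toSubmodule (relCent Ω K N)).2 (fun z hz => ?_) hc'
    exact Pair.relCent_of_mem_S (T.mem_S₁ hz)
  have hc'i : c' * p₁.i = c' := by
    refine Submodule.span_induction (fun z hz => Pair.mul_i (T.mem_S₁ hz)) (zero_mul _)
      (fun x y _ _ hx hy => by rw [add_mul, hx, hy])
      (fun a x _ hx => by rw [smul_mul_assoc, hx]) hc'
  have hw1 : w ∈ grpAlg (Ω := Ω) Ω N := by
    refine Submodule.span_le (p := Subalgebra.toSubmodule (grpAlg (Ω := Ω) Ω N)).2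
      (fun z hz => ?_) hw
    exact Pair.mem_of_mem_S (T.mem_S₂ hz)
  have hyK := grpAlg_mono p₁.le (hmuK a b)
  have h2 : p.P (c a b * (p₂.i * p₁.mu a b * p₂.i)) = p.P (c' * (p₂.i * p₁.mu a b * p₂.i)) := by
    have h3 : (c a b - c') * charIdem Ω η * charIdem Ω θ = 0 :=
      p₁.mul_eq_zero_of_P_eq_zero (sub_mem (hc a b) hc'1) (by rw [map_sub, hPc, sub_self])
    have h4 : (c a b - c') * 1 * charIdem Ω θ = 0 := by
      rw [T.mul_mul_e (by rw [sub_mul, hci, hc'i]) (one_mem _), mul_one, h3]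
    have h5 : c a b * charIdem Ω θ = c' * charIdem Ω θ := by
      rwa [mul_one, sub_mul, sub_eq_zero] at h4
    rw [← p.P_mul_e (mul_mem (mem_relCent.1 (hc a b)).1 hyK),
      ← p.P_mul_e (mul_mem (mem_relCent.1 hc'1).1 hyK), mul_assoc, mul_assoc c',
      p.split.comm _ hyK, ← mul_assoc (c a b), ← mul_assoc c', h5]
  rw [h2, T.P_mul_eq hc'1 hc'i (hmuK a b) hw1 hPw.symm, ← Submodule.map_span,
    ← Submodule.span_mul_span]
  exact Submodule.mem_map_of_mem (Submodule.mul_mem_mul hc' hw)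

/-- The corner `j S₀ j` is spanned by the products of elements of `S₁₀` and `S₂₀`. -/
theorem corner_mem (hx : x ∈ S₀) : p₁.i * p₂.i * x * (p₁.i * p₂.i) ∈
    Submodule.span F {y | ∃ s₁ ∈ S₁₀, ∃ s₂ ∈ S₂₀, y = s₁ * s₂} := by
  set W := Submodule.span F {y | ∃ s₁ ∈ S₁₀, ∃ s₂ ∈ S₂₀, y = s₁ * s₂}
  refine T.isMatrixForm.mem_of_mem_span W.toAddSubgroup ?_
    (mul_mem (mul_mem T.j_mem hx) T.j_mem) ?_
  · intro z hz hzc w _ hw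
    obtain ⟨a, ha, rfl, hPz, hfix⟩ := T.form.exists_zeta p hz hzc
    have hfixU : ∀ u ∈ U, conj (p₁.zeta a) u = p₁.zeta a := by
      intro u hu
      obtain ⟨h, hh, n, hn, rfl⟩ := T.factor u hu
      obtain ⟨γ, h1, h2, h3⟩ := T.semi h hh
      have h4 : conj (p.zeta a) h = p.zeta a := by
        have h5 := hfix h hh
        rw [conj_mul, p.conj_zeta h1 ha, p.conj_i h1 h3] at h5
        have h6 := congrArg p.P h5
        rw [hPz, p.P_zeta_mul (galApply_mem γ ha) p.i_mem, p.P_i] at h6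
        obtain ⟨o⟩ := p.pos
        have h7 := congrFun (congrFun h6 o) o
        rw [Matrix.smul_apply, Matrix.smul_apply, Matrix.one_apply_eq, smul_eq_mul, smul_eq_mul,
          mul_one, mul_one] at h7
        rw [p.conj_zeta h1 ha, h7]
      have h5 : p₁.zeta a = p.zeta a := rfl
      rw [h5, ← conj_conj, h4]
      exact conj_eq_of_commute (F := Ω) (fun y hy => p.zeta_comm ha hy) n (p₁.le hn)
    rw [Submodule.mem_toAddSubgroup] at hw ⊢
    refine Submodule.span_induction (fun x hx => ?_) ?_ (fun x y _ _ hx hy => ?_)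
      (fun c x _ hx => ?_) hw
    · obtain ⟨s₁, hs₁, s₂, hs₂, rfl⟩ := hx
      refine Submodule.subset_span ⟨p₁.zeta a * s₁,
        Config.IsScalarForm.zeta_mul_mem (c := ⟨⊤, U, K, N, θ, η⟩) p₁ T.semi₁ T.form₁ ha hfixU hs₁,
        s₂, hs₂, ?_⟩
      rw [mul_assoc, T.isMatrixForm.one_mul _ (T.prod _ hs₁ _ hs₂), ← mul_assoc]
      rfl
    · rw [mul_zero]; exact zero_mem _
    · rw [mul_add]; exact add_mem hx hy
    · rw [mul_smul_comm]; exact Submodule.smul_mem _ _ hx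
  · refine Submodule.span_mono ?_ (T.P_corner_mem (Pair.mem_of_mem_S (T.mem_S hx)))
    rintro _ ⟨_, ⟨s₁, hs₁, s₂, hs₂, rfl⟩, rfl⟩
    exact ⟨_, ⟨T.prod _ hs₁ _ hs₂, Submodule.subset_span ⟨s₁, hs₁, s₂, hs₂, rfl⟩⟩, rfl⟩

omit T in
theorem j_mul (hx : x ∈ p₁.S) (hy : y ∈ p₂.S) : p₁.i * p₂.i * (x * y) = x * y := by
  rw [mul_assoc, ← mul_assoc p₂.i, ← comm' hx p₂.i_mem_S, mul_assoc, Pair.i_mul hy, ← mul_assoc,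
    Pair.i_mul hx]

omit T in
theorem mul_j (hx : x ∈ p₁.S) (hy : y ∈ p₂.S) : x * y * (p₁.i * p₂.i) = x * y := by
  rw [mul_assoc, ← mul_assoc y, ← comm' p₁.i_mem_S hy, mul_assoc, Pair.mul_i hy, ← mul_assoc,
    Pair.mul_i hx]

theorem i_mul_j : p.i * (p₁.i * p₂.i) = p₁.i * p₂.i := T.isMatrixForm.one_mul _ T.j_mem

theorem j_mul_i : p₁.i * p₂.i * p.i = p₁.i * p₂.i := T.isMatrixForm.mul_one _ T.j_mem

/-- The algebras `S₁` and `S₂` are not contained in `S`, but their products are. -/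
theorem mul_mem_S (hx : x ∈ p₁.S) (hy : y ∈ p₂.S) : x * y ∈ p.S := by
  refine ⟨mul_mem hx.1 (grpAlg_mono p₁.le hy.1), relCent_mul hx.2.1 hy.2.1 p₁.le p₂.le, ?_, ?_⟩
  · rw [← j_mul hx hy, ← mul_assoc, T.i_mul_j]
  · rw [← mul_j hx hy, mul_assoc, T.j_mul_i]

/-- Elements of `S` inducing the action of `h` on `S₀` are determined by their product with `j`. -/
theorem lift_unique {h : Γ} (hh : h ∈ H) {X X' : MonoidAlgebra Ω Γ} (hX : X ∈ p.S) (hX' : X' ∈ p.S)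
    (h1 : ∀ s ∈ S₀, X * conj s h = s * X) (h2 : ∀ s ∈ S₀, X' * conj s h = s * X')
    (hj : X * (p₁.i * p₂.i) = X' * (p₁.i * p₂.i)) : X = X' := by
  obtain ⟨n, a, b, ha, hb, hi⟩ := T.exists_sum_eq_i
  obtain ⟨γ, h3, h4⟩ := T.semi_c h hh
  rw [← sub_eq_zero]
  refine intertwiner_eq_zero (RingHom.id _) (conjHom h : MonoidAlgebra Ω Γ →ₐ[Ω] _).toRingHom ha hi
    (T.conj_j hh) (fun s hs => ?_) ?_ ?_
  · change s * (X - X') = (X - X') * conj s h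
    rw [sub_mul, h1 s hs, h2 s hs, mul_sub]
  · change (X - X') * conj p.i h = X - X'
    rw [p.conj_i h3 h4, Pair.mul_i (sub_mem hX hX')]
  · rw [sub_mul, hj, sub_self]

/-- Elements of `S₁` and `S₂` inducing the action of `h` on the scalar forms give rise to an element
of `S` inducing the action of `h` on `S₀`. -/
theorem exists_lift {h : Γ} (hh : h ∈ H) {t₁ y₁ t₂ y₂ : MonoidAlgebra Ω Γ} (ht₁ : t₁ ∈ p₁.S)
    (hy₁ : y₁ ∈ p₁.S) (ht₂ : t₂ ∈ p₂.S) (hy₂ : y₂ ∈ p₂.S) (h₁ : t₁ * y₁ = p₁.i)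
    (h₁' : y₁ * t₁ = p₁.i) (h₂ : t₂ * y₂ = p₂.i) (h₂' : y₂ * t₂ = p₂.i)
    (hc₁ : ∀ s ∈ S₁₀, t₁ * conj s h = s * t₁) (hc₂ : ∀ s ∈ S₂₀, t₂ * conj s h = s * t₂) :
    ∃ X ∈ p.S, ∃ Y ∈ p.S, X * Y = p.i ∧ Y * X = p.i ∧ (∀ s ∈ S₀, X * conj s h = s * X) ∧
      X * (p₁.i * p₂.i) = t₁ * t₂ := by
  obtain ⟨n, a, b, ha, hb, hi⟩ := T.exists_sum_eq_i
  obtain ⟨γ, hθ, hη, hφ⟩ := T.semi h hh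
  have hconj : ∀ {s}, s ∈ S₀ → conj s h ∈ p.S := fun hs => p.conj_mem_S hθ hφ (T.mem_S hs)
  set j := p₁.i * p₂.i
  have hjh : conj j h = j := T.conj_j hh
  have hjj : j * j = j := j_mul_j p₁ p₂
  have hττ : t₁ * t₂ * (y₁ * y₂) = j := by
    rw [comm' hy₁ hy₂, mul_assoc, ← mul_assoc t₂, h₂, ← comm' hy₁ p₂.i_mem_S, ← mul_assoc, h₁]
  have hττ' : y₁ * y₂ * (t₁ * t₂) = j := by
    rw [comm' ht₁ ht₂, mul_assoc, ← mul_assoc y₂, h₂', ← comm' ht₁ p₂.i_mem_S, ← mul_assoc, h₁']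
  have hw : ∀ w ∈ Submodule.span F {y | ∃ s₁ ∈ S₁₀, ∃ s₂ ∈ S₂₀, y = s₁ * s₂},
      w * (t₁ * t₂) = t₁ * t₂ * conj w h := by
    intro w hw
    refine Submodule.span_induction (fun x hx => ?_) ?_ (fun x y _ _ hx hy => ?_)
      (fun c x _ hx => ?_) hw
    · obtain ⟨s₁, hs₁, s₂, hs₂, rfl⟩ := hx
      have h3 : conj s₁ h ∈ p₁.S := p₁.conj_mem_S hθ hη (T.mem_S₁ hs₁)
      calc s₁ * s₂ * (t₁ * t₂) = s₁ * (s₂ * t₁) * t₂ := by simp only [mul_assoc]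
        _ = s₁ * t₁ * (s₂ * t₂) := by
          rw [← comm' ht₁ (T.mem_S₂ hs₂)]; simp only [mul_assoc]
        _ = t₁ * (conj s₁ h * t₂) * conj s₂ h := by
          rw [← hc₁ s₁ hs₁, ← hc₂ s₂ hs₂]; simp only [mul_assoc]
        _ = t₁ * t₂ * conj (s₁ * s₂) h := by
          rw [comm' h3 ht₂, conj_mul]; simp only [mul_assoc]
    · rw [zero_mul, conj_zero, mul_zero]
    · rw [add_mul, hx, hy, conj_add, mul_add]
    · rw [smul_mul_assoc, hx, conj_smul, mul_smul_comm]
  have hτ : ∀ x ∈ S₀, j * x * j * (t₁ * t₂) = t₁ * t₂ * conj (j * x * j) h := fun x hx =>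
    hw _ (T.corner_mem hx)
  have hτ' : ∀ x ∈ S₀, conj (j * x * j) h * (y₁ * y₂) = y₁ * y₂ * (j * x * j) := by
    intro x hx
    have h3 : j * conj (j * x * j) h = conj (j * x * j) h := by
      calc j * conj (j * x * j) h = conj (j * (j * x * j)) h := by rw [conj_mul j, hjh]
        _ = conj (j * x * j) h := by rw [← mul_assoc j, ← mul_assoc j j x, hjj]
    calc conj (j * x * j) h * (y₁ * y₂)
        = y₁ * y₂ * (t₁ * t₂ * conj (j * x * j) h) * (y₁ * y₂) := by
          rw [← mul_assoc (y₁ * y₂), hττ', h3]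
      _ = y₁ * y₂ * (j * x * j) * (t₁ * t₂ * (y₁ * y₂)) := by
          rw [← hτ x hx]; simp only [mul_assoc]
      _ = y₁ * y₂ * (j * x * j) := by
          rw [hττ]; simp only [mul_assoc]; rw [hjj]
  let f := RingHom.id (MonoidAlgebra Ω Γ)
  let g := (conjHom h : MonoidAlgebra Ω Γ →ₐ[Ω] MonoidAlgebra Ω Γ).toRingHom
  have hiT : ∀ x ∈ S₀, p.i * x = x := T.isMatrixForm.one_mul
  have hTi : ∀ x ∈ S₀, x * p.i = x := T.isMatrixForm.mul_one
  obtain ⟨hX, hXj⟩ := extend_intertwiner f g ha hb hi hiT hTi T.j_mem rfl hjh (j_mul ht₁ ht₂)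
    (mul_j ht₁ ht₂) hτ
  obtain ⟨hY, hYj⟩ := extend_intertwiner g f ha hb hi hiT hTi T.j_mem hjh rfl (j_mul hy₁ hy₂)
    (mul_j hy₁ hy₂) hτ'
  have hXS : ∑ k, f (a k) * (t₁ * t₂) * g (b k) ∈ p.S := sum_mem fun k _ =>
    mul_mem (mul_mem (T.mem_S (ha k)) (T.mul_mem_S ht₁ ht₂)) (hconj (hb k))
  have hYS : ∑ k, g (a k) * (y₁ * y₂) * f (b k) ∈ p.S := sum_mem fun k _ =>
    mul_mem (mul_mem (hconj (ha k)) (T.mul_mem_S hy₁ hy₂)) (T.mem_S (hb k))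
  set X := ∑ k, f (a k) * (t₁ * t₂) * g (b k)
  set Y := ∑ k, g (a k) * (y₁ * y₂) * f (b k)
  have hXY : X * Y = p.i := by
    rw [← sub_eq_zero]
    refine intertwiner_eq_zero f f ha hi rfl (fun s hs => ?_) ?_ ?_
    · rw [sub_mul, mul_sub, ← mul_assoc, hX s hs, mul_assoc, hY s hs, ← mul_assoc]
      congr 1
      exact (hTi s hs).trans (hiT s hs).symm
    · exact Pair.mul_i (sub_mem (mul_mem hXS hYS) p.i_mem_S)
    · rw [sub_mul, T.i_mul_j, mul_assoc, hYj, ← j_mul hy₁ hy₂, ← mul_assoc, hXj, hττ, sub_self]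
  refine ⟨X, hXS, Y, hYS, hXY, ?_, fun s hs => (hX s hs).symm, hXj⟩
  -- in matrix algebras one-sided inverses are two-sided
  refine p.eq_of_P_eq (mul_mem hYS hXS) p.i_mem_S ?_
  rw [p.P_mul_of_mem_S hYS hXS, p.P_i]
  refine mul_eq_one_comm.1 ?_
  rw [← p.P_mul_of_mem_S hXS hYS, hXY, p.P_i]

end Tower

end

section

/-! ### Transitivity of magic crossed representations and of their correspondences -/

namespace Tower

variable {Γ : Type*} [Group Γ] [Finite Γ] {F Ω : Type*} [Field F] [Field Ω] [Algebra F Ω]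
  {U H K N L : Subgroup Γ} {θ : K → Ω} {η : N → Ω} {φ : L → Ω} {E : IntermediateField F Ω}
  [FiniteDimensional F E] [IsGalois F E]
  {p₁ : Pair θ η E} {p₂ : Pair η φ E} {p : Pair θ φ E}
  {S₁₀ S₂₀ S₀ : NonUnitalSubalgebra F (MonoidAlgebra Ω Γ)}
  (T : Tower U H p₁ p₂ p S₁₀ S₂₀ S₀)
  {σ₁ : U ⧸ N.subgroupOf U → MonoidAlgebra Ω Γ} {σ₂ : H ⧸ L.subgroupOf H → MonoidAlgebra Ω Γ}

include T

theorem spec₁ (hσ₁ : Config.IsMagicCrossed (⟨⊤, U, K, N, θ, η⟩ : Config Γ Ω) S₁₀ σ₁) (u : U) :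
    σ₁ u ∈ p₁.S ∧ (∃ y ∈ p₁.S, σ₁ u * y = p₁.i ∧ y * σ₁ u = p₁.i) ∧
      ∀ s ∈ S₁₀, σ₁ u * conj s u = s * σ₁ u :=
  Config.IsMagicCrossed.spec (c := ⟨⊤, U, K, N, θ, η⟩) p₁ T.semi₁ hσ₁ u

theorem spec₂ (hσ₂ : Config.IsMagicCrossed (⟨U, H, N, L, η, φ⟩ : Config Γ Ω) S₂₀ σ₂) (h : H) :
    σ₂ h ∈ p₂.S ∧ (∃ y ∈ p₂.S, σ₂ h * y = p₂.i ∧ y * σ₂ h = p₂.i) ∧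
      ∀ s ∈ S₂₀, σ₂ h * conj s h = s * σ₂ h :=
  Config.IsMagicCrossed.spec (c := ⟨U, H, N, L, η, φ⟩) p₂ T.semi₂ hσ₂ h

/-- The map `σ` with `σ(h) j = σ₁(h) σ₂(h)`, inducing the action of `H` on `S₀`, together with its
pointwise inverse. -/
theorem exists_crossed (hσ₁ : Config.IsMagicCrossed (⟨⊤, U, K, N, θ, η⟩ : Config Γ Ω) S₁₀ σ₁)
    (hσ₂ : Config.IsMagicCrossed (⟨U, H, N, L, η, φ⟩ : Config Γ Ω) S₂₀ σ₂) :
    ∃ σ ρ : H ⧸ L.subgroupOf H → MonoidAlgebra Ω Γ, ∀ h : H, σ h ∈ p.S ∧ ρ h ∈ p.S ∧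
      σ h * ρ h = p.i ∧ ρ h * σ h = p.i ∧ (∀ s ∈ S₀, σ h * conj s h = s * σ h) ∧
      σ h * (p₁.i * p₂.i) = σ₁ (⟨h, T.H_le h.2⟩ : U) * σ₂ h := by
  have key : ∀ q : H ⧸ L.subgroupOf H, ∃ X Y : MonoidAlgebra Ω Γ, ∀ h : H, (h : H ⧸ _) = q →
      X ∈ p.S ∧ Y ∈ p.S ∧ X * Y = p.i ∧ Y * X = p.i ∧ (∀ s ∈ S₀, X * conj s h = s * X) ∧
      X * (p₁.i * p₂.i) = σ₁ (⟨h, T.H_le h.2⟩ : U) * σ₂ q := by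
    intro q
    obtain ⟨g, rfl⟩ := QuotientGroup.mk_surjective q
    obtain ⟨ht₁, ⟨y₁, hy₁, h₁, h₁'⟩, hc₁⟩ := T.spec₁ hσ₁ ⟨g, T.H_le g.2⟩
    obtain ⟨ht₂, ⟨y₂, hy₂, h₂, h₂'⟩, hc₂⟩ := T.spec₂ hσ₂ g
    obtain ⟨X, hX, Y, hY, hXY, hYX, hint, hj⟩ :=
      T.exists_lift g.2 ht₁ hy₁ ht₂ hy₂ h₁ h₁' h₂ h₂' hc₁ hc₂
    refine ⟨X, Y, fun h hh => ⟨hX, hY, hXY, hYX, fun s hs => ?_, ?_⟩⟩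
    · have hl : (g⁻¹ * h : H) ∈ L.subgroupOf H := QuotientGroup.eq.1 hh.symm
      obtain ⟨γ, h3, h4⟩ := T.semi_c g g.2
      have h5 : conj (conj s (g : Γ)) ((g⁻¹ * h : H) : Γ) = conj s (g : Γ) :=
        conj_eq_of_commute (mem_relCent.1 (p.conj_mem_S h3 h4 (T.mem_S hs)).2.1).2 _ hl
      rw [← hint s hs, ← h5, conj_conj, ← Subgroup.coe_mul, mul_inv_cancel_left]
    · rw [hj]
      congr 2
      refine QuotientGroup.eq.2 ?_
      have hl : (g⁻¹ * h : H) ∈ L.subgroupOf H := QuotientGroup.eq.1 hh.symm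
      exact p₂.le hl
  choose σ ρ h using key
  exact ⟨σ, ρ, fun g => h g g rfl⟩

/-- The lift of `σ₁ σ₂` is a magic crossed representation: the cocycle identity holds since it holds
after multiplication by `j`. -/
theorem isMagicCrossed (hσ₁ : Config.IsMagicCrossed (⟨⊤, U, K, N, θ, η⟩ : Config Γ Ω) S₁₀ σ₁)
    (hσ₂ : Config.IsMagicCrossed (⟨U, H, N, L, η, φ⟩ : Config Γ Ω) S₂₀ σ₂)
    {σ ρ : H ⧸ L.subgroupOf H → MonoidAlgebra Ω Γ} (hσ : ∀ h : H, σ h ∈ p.S ∧ ρ h ∈ p.S ∧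
      σ h * ρ h = p.i ∧ ρ h * σ h = p.i ∧ (∀ s ∈ S₀, σ h * conj s h = s * σ h) ∧
      σ h * (p₁.i * p₂.i) = σ₁ (⟨h, T.H_le h.2⟩ : U) * σ₂ h) :
    Config.IsMagicCrossed (⟨⊤, H, K, L, θ, φ⟩ : Config Γ Ω) S₀ σ := by
  have hSiff : ∀ {x}, x ∈ Config.S F (⟨⊤, H, K, L, θ, φ⟩ : Config Γ Ω) ↔ x ∈ p.S :=
    Config.mem_S_iff (c := ⟨⊤, H, K, L, θ, φ⟩) p
  have hi : Config.i F (⟨⊤, H, K, L, θ, φ⟩ : Config Γ Ω) = p.i :=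
    Config.i_eq (c := ⟨⊤, H, K, L, θ, φ⟩) p
  refine ⟨T.form, fun q => ?_, fun h =>
    { toFun := fun x => σ h * conj x h * ρ h
      map_add' := fun x y => by rw [conj_add, mul_add, add_mul]
      map_smul' := fun a x => by
        rw [conj_smul, mul_smul_comm, smul_mul_assoc, RingHom.id_apply] }, ?_, ?_, ?_⟩
  · obtain ⟨g, rfl⟩ := QuotientGroup.mk_surjective q
    obtain ⟨h1, h2, h3, h4, -⟩ := hσ g
    exact ⟨hSiff.2 h1, ρ g, hSiff.2 h2, by rw [hi, h4], by rw [hi, h3]⟩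
  · intro h s hs z hz
    obtain ⟨h1, h2, h3, -, h5, -⟩ := hσ h
    obtain ⟨a, ha, rfl, -⟩ := Config.exists_zeta_of_mem_Z (c := ⟨⊤, H, K, L, θ, φ⟩) p hz
    obtain ⟨γ, h6, h7⟩ := T.semi_c h h.2
    have ha' := galApply_mem γ ha
    change σ h * conj (s * (p.zeta a * p.i)) h * ρ h = s * conj (p.zeta a * p.i) h
    rw [conj_mul, conj_mul, p.conj_zeta h6 ha, p.conj_i h6 h7, ← mul_assoc, h5 s hs, mul_assoc,
      mul_assoc, mul_assoc _ p.i, Pair.i_mul h2, ← mul_assoc (σ h),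
      ← p.zeta_comm ha' (Pair.mem_of_mem_S h1), mul_assoc (p.zeta _), h3]
  · intro x y
    obtain ⟨h1, h2, h3, h4, h5, h6⟩ := hσ y
    obtain ⟨k1, k2, k3, k4, k5, k6⟩ := hσ x
    obtain ⟨γ, h7, h8, h9⟩ := T.semi y y.2
    have hc : conj (σ x) (y : Γ) ∈ p.S := p.conj_mem_S h7 h9 k1
    change σ y * conj (σ x) y * ρ y * σ y = σ ((x * y : H))
    rw [mul_assoc, h4, Pair.mul_i (mul_mem h1 hc)]
    obtain ⟨l1, -, -, -, l5, l6⟩ := hσ (x * y)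
    refine T.lift_unique (x * y).2 (mul_mem h1 hc) l1 (fun s hs => ?_) l5 ?_
    · rw [Subgroup.coe_mul, ← conj_conj, mul_assoc, ← conj_mul, k5 s hs, conj_mul, ← mul_assoc,
        h5 s hs, mul_assoc]
    · have hx₁ := (T.spec₁ hσ₁ ⟨x, T.H_le x.2⟩).1
      have hx₂ := (T.spec₂ hσ₂ x).1
      have hy₁ := (T.spec₁ hσ₁ ⟨y, T.H_le y.2⟩).1
      have hy₂ := (T.spec₂ hσ₂ y).1
      have hc₁ : conj (σ₁ (⟨x, T.H_le x.2⟩ : U)) (y : Γ) ∈ p₁.S := p₁.conj_mem_S h7 h8 hx₁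
      have hc₂ : conj (σ₂ x) (y : Γ) ∈ p₂.S := p₂.conj_mem_S h8 h9 hx₂
      have hm₁ := hσ₁.mul_conj ⟨x, T.H_le x.2⟩ ⟨y, T.H_le y.2⟩
      have hm₂ := hσ₂.mul_conj x y
      simp only at hm₁ hm₂
      calc σ y * conj (σ x) (y : Γ) * (p₁.i * p₂.i)
          = σ y * conj (σ x * (p₁.i * p₂.i)) y := by
            rw [conj_mul, T.conj_j y.2, mul_assoc]
        _ = σ y * (p₁.i * p₂.i *
              (conj (σ₁ (⟨x, T.H_le x.2⟩ : U)) y * conj (σ₂ x) y)) := by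
            rw [k6, conj_mul, j_mul hc₁ hc₂]
        _ = σ₁ (⟨y, T.H_le y.2⟩ : U) * (σ₂ y * conj (σ₁ (⟨x, T.H_le x.2⟩ : U)) y) *
              conj (σ₂ x) y := by
            rw [← mul_assoc, h6]; simp only [mul_assoc]
        _ = σ₁ (⟨y, T.H_le y.2⟩ : U) * conj (σ₁ (⟨x, T.H_le x.2⟩ : U)) y *
              (σ₂ y * conj (σ₂ x) y) := by
            rw [← comm' hc₁ hy₂]; simp only [mul_assoc]
        _ = σ ((x * y : H)) * (p₁.i * p₂.i) := by
            rw [l6]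
            exact congrArg₂ (· * ·) hm₁ hm₂
  · intro h s hs
    rw [hSiff] at hs
    obtain ⟨h1, h2, h3, h4, h5, h6⟩ := hσ h
    obtain ⟨γ, h7, h8⟩ := T.semi_c h h.2
    change σ h * conj s h = σ h * conj s h * ρ h * σ h
    rw [mul_assoc _ (ρ h), h4, Pair.mul_i (mul_mem h1 (p.conj_mem_S h7 h8 hs))]

/-- Transitivity of the character correspondences. -/
theorem iota_eq (hσ₁ : Config.IsMagicCrossed (⟨⊤, U, K, N, θ, η⟩ : Config Γ Ω) S₁₀ σ₁)
    (hσ₂ : Config.IsMagicCrossed (⟨U, H, N, L, η, φ⟩ : Config Γ Ω) S₂₀ σ₂)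
    {σ ρ : H ⧸ L.subgroupOf H → MonoidAlgebra Ω Γ} (hσ : ∀ h : H, σ h ∈ p.S ∧ ρ h ∈ p.S ∧
      σ h * ρ h = p.i ∧ ρ h * σ h = p.i ∧ (∀ s ∈ S₀, σ h * conj s h = s * σ h) ∧
      σ h * (p₁.i * p₂.i) = σ₁ (⟨h, T.H_le h.2⟩ : U) * σ₂ h)
    (hNU : N ≤ U) {V : Subgroup Γ} (hKV : K ≤ V) {χ : V → Ω} (hχ : ∀ v w, χ (v * w) = χ (w * v))
    {h : Γ} (hV : h ∈ V) (hH : h ∈ H) :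
    Config.iota ⟨⊤, H, K, L, θ, φ⟩ S₀ σ V χ ⟨h, hV, hH⟩ =
      Config.iota ⟨U, H, N, L, η, φ⟩ S₂₀ σ₂ (V ⊓ U)
        (Config.iota ⟨⊤, U, K, N, θ, η⟩ S₁₀ σ₁ V χ) ⟨h, ⟨hV, T.H_le hH⟩, hH⟩ := by
  obtain ⟨h1, h2, h3, h4, h5, h6⟩ := hσ ⟨h, hH⟩
  obtain ⟨ht₁, ⟨y₁, hy₁, h₁, h₁'⟩, -⟩ := T.spec₁ hσ₁ ⟨h, T.H_le hH⟩
  obtain ⟨ht₂, ⟨y₂, hy₂, h₂, h₂'⟩, -⟩ := T.spec₂ hσ₂ ⟨h, hH⟩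
  simp only at h6
  obtain ⟨hs, hst⟩ := Config.IsScalarForm.traceOne_spec (c := ⟨⊤, H, K, L, θ, φ⟩) p T.semi_c T.form
    fun g hg => by
      obtain ⟨g1, g2, g3, g4, g5, -⟩ := hσ ⟨g, hg⟩
      exact ⟨_, g1, _, g2, g3, g4, g5⟩
  obtain ⟨hs₁, hst₁⟩ := Config.IsScalarForm.traceOne_spec (c := ⟨⊤, U, K, N, θ, η⟩) p₁ T.semi₁
    T.form₁ fun g hg => by
      obtain ⟨g1, ⟨y, hy, g2, g3⟩, g4⟩ := T.spec₁ hσ₁ ⟨g, hg⟩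
      exact ⟨_, g1, _, hy, g2, g3, g4⟩
  obtain ⟨hs₂, hst₂⟩ := Config.IsScalarForm.traceOne_spec (c := ⟨U, H, N, L, η, φ⟩) p₂ T.semi₂
    T.form₂ fun g hg => by
      obtain ⟨g1, ⟨y, hy, g2, g3⟩, g4⟩ := T.spec₂ hσ₂ ⟨g, hg⟩
      exact ⟨_, g1, _, hy, g2, g3, g4⟩
  set s := Config.traceOne ⟨⊤, H, K, L, θ, φ⟩ S₀
  set s₁ := Config.traceOne ⟨⊤, U, K, N, θ, η⟩ S₁₀
  set s₂ := Config.traceOne ⟨U, H, N, L, η, φ⟩ S₂₀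
  have hs₁' := T.mem_S₁ hs₁
  have hs₂' := T.mem_S₂ hs₂
  set ψ := Config.iota ⟨⊤, U, K, N, θ, η⟩ S₁₀ σ₁ V χ
  -- on the coset `N h` the element `σ₁` is constant, so `ψ(y h) = χ(s₁ σ₁(h)⁻¹ y h)` for `y` in `Ω N`
  have hψn : ∀ n (hn : n ∈ N), charEval ψ (MonoidAlgebra.single (n * h) 1)
      = charEval χ (s₁ * y₁ * (MonoidAlgebra.single n 1 * MonoidAlgebra.single h 1)) := by
    intro n hn
    have hmem : n * h ∈ V ⊓ U :=
      ⟨mul_mem (hKV (p₁.le hn)) hV, mul_mem (hNU hn) (T.H_le hH)⟩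
    rw [charEval_single ψ ⟨n * h, hmem⟩, MonoidAlgebra.single_mul_single, mul_one]
    have hcoset : ((⟨n * h, hmem.2⟩ : U) : U ⧸ N.subgroupOf U) = (⟨h, T.H_le hH⟩ : U) := by
      rw [QuotientGroup.eq]
      change (n * h)⁻¹ * h ∈ N
      obtain ⟨γ, -, h7⟩ := T.semi₁ h (T.H_le hH)
      have := h7.inv_conj_mem n⁻¹ (inv_mem hn)
      rwa [mul_inv_rev]
    change charEval χ (s₁ * Config.invS F ⟨⊤, U, K, N, θ, η⟩ (σ₁ ((⟨n * h, hmem.2⟩ : U) : U ⧸ _)) *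
      MonoidAlgebra.single (n * h) 1) = _
    rw [hcoset, Config.invS_eq (c := ⟨⊤, U, K, N, θ, η⟩) p₁ hy₁ h₁' h₁]
  have hψy : ∀ y ∈ grpAlg (Ω := Ω) Ω N, charEval ψ (y * MonoidAlgebra.single h 1)
      = charEval χ (s₁ * y₁ * (y * MonoidAlgebra.single h 1)) := by
    intro y hy
    simp only [← evalLin_apply] at hψn ⊢
    induction hy using grpAlg_induction with
    | single n hn => rw [← hψn n hn, MonoidAlgebra.single_mul_single, mul_one]
    | zero => rw [zero_mul, mul_zero, map_zero, map_zero]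
    | add x y _ _ hx hy => rw [add_mul, mul_add, map_add, map_add, hx, hy]
    | smul c x _ hx => rw [smul_mul_assoc, mul_smul_comm, map_smul, map_smul, hx]
  have hτY : y₁ * y₂ = p₁.i * p₂.i * ρ (⟨h, hH⟩ : H) := by
    have hττ' : y₁ * y₂ * (σ₁ (⟨h, T.H_le hH⟩ : U) * σ₂ (⟨h, hH⟩ : H)) = p₁.i * p₂.i := by
      rw [comm' ht₁ ht₂, mul_assoc, ← mul_assoc y₂, h₂', ← comm' ht₁ p₂.i_mem_S, ← mul_assoc, h₁']
    have hjτ : σ (⟨h, hH⟩ : H) * (p₁.i * p₂.i) = p₁.i * p₂.i * σ (⟨h, hH⟩ : H) := by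
      rw [← h5 _ T.j_mem, T.conj_j hH]
    calc y₁ * y₂ = y₁ * y₂ * (p₁.i * p₂.i * (σ (⟨h, hH⟩ : H) * ρ (⟨h, hH⟩ : H))) := by
          rw [h3, T.j_mul_i, mul_j hy₁ hy₂]
      _ = y₁ * y₂ * (p₁.i * p₂.i * σ (⟨h, hH⟩ : H)) * ρ (⟨h, hH⟩ : H) := by
          simp only [mul_assoc]
      _ = p₁.i * p₂.i * ρ (⟨h, hH⟩ : H) := by rw [← hjτ, h6, hττ']
  have hL : Config.iota ⟨⊤, H, K, L, θ, φ⟩ S₀ σ V χ ⟨h, hV, hH⟩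
      = charEval χ (s * ρ (⟨h, hH⟩ : H) * MonoidAlgebra.single h 1) := by
    change charEval χ (s * Config.invS F ⟨⊤, H, K, L, θ, φ⟩ (σ (⟨h, hH⟩ : H)) *
      MonoidAlgebra.single h 1) = _
    rw [Config.invS_eq (c := ⟨⊤, H, K, L, θ, φ⟩) p h2 h4 h3]
  have hR : Config.iota ⟨U, H, N, L, η, φ⟩ S₂₀ σ₂ (V ⊓ U) ψ ⟨h, ⟨hV, T.H_le hH⟩, hH⟩
      = charEval χ (s₁ * s₂ * ρ (⟨h, hH⟩ : H) * MonoidAlgebra.single h 1) := by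
    change charEval ψ (s₂ * Config.invS F ⟨U, H, N, L, η, φ⟩ (σ₂ (⟨h, hH⟩ : H)) *
      MonoidAlgebra.single h 1) = _
    rw [Config.invS_eq (c := ⟨U, H, N, L, η, φ⟩) p₂ hy₂ h₂' h₂,
      hψy _ (mul_mem (Pair.mem_of_mem_S hs₂') (Pair.mem_of_mem_S hy₂)), ← mul_j hs₁' hs₂',
      mul_assoc (s₁ * s₂), ← hτY]
    congr 1
    calc s₁ * y₁ * (s₂ * y₂ * MonoidAlgebra.single h 1)
        = s₁ * (y₁ * s₂) * y₂ * MonoidAlgebra.single h 1 := by simp only [mul_assoc]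
      _ = s₁ * s₂ * (y₁ * y₂) * MonoidAlgebra.single h 1 := by
        rw [comm' hy₁ hs₂']; simp only [mul_assoc]
  rw [hL, hR]
  refine Config.IsScalarForm.charEval_eq_of_t_eq (c := ⟨⊤, H, K, L, θ, φ⟩) T.form p T.semi_c hH h1 h2
    h3 h4 h5 hKV hV hχ hs (T.prod _ hs₁ _ hs₂) ?_
  rw [hst, T.t_mul hs₁' (Pair.relCent_of_mem_S hs₂'), hst₁, hst₂, mul_one]

end Tower

/-- If `e_φ e_η` and `e_η e_θ` do not vanish, neither does `e_φ e_θ`, since the block `Ω N e_η` is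
simple. -/
theorem charIdem_mul_ne_zero {Γ : Type*} [Group Γ] [Finite Γ] {Ω : Type*} [Field Ω]
    {K N L : Subgroup Γ} {θ : K → Ω} {η : N → Ω} {φ : L → Ω} (hNK : N ≤ K) (hLN : L ≤ N)
    {n m l : ℕ} {r : MonoidAlgebra Ω Γ →ₗ[Ω] Matrix (Fin n) (Fin n) Ω}
    {s : Matrix (Fin n) (Fin n) Ω →ₗ[Ω] MonoidAlgebra Ω Γ}
    {u : MonoidAlgebra Ω Γ →ₗ[Ω] Matrix (Fin m) (Fin m) Ω}
    {v : Matrix (Fin m) (Fin m) Ω →ₗ[Ω] MonoidAlgebra Ω Γ}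
    {y : MonoidAlgebra Ω Γ →ₗ[Ω] Matrix (Fin l) (Fin l) Ω}
    {z : Matrix (Fin l) (Fin l) Ω →ₗ[Ω] MonoidAlgebra Ω Γ}
    (hθ : IsSplit θ (charIdem Ω θ) r s) (hη : IsSplit η (charIdem Ω η) u v)
    (hφ : IsSplit φ (charIdem Ω φ) y z) (h1 : charIdem Ω η * charIdem Ω θ ≠ 0)
    (h2 : charIdem Ω φ * charIdem Ω η ≠ 0) : charIdem Ω φ * charIdem Ω θ ≠ 0 := by
  intro h0
  have hdN : charIdem Ω φ ∈ grpAlg (Ω := Ω) Ω N := grpAlg_mono hLN hφ.e_mem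
  have hdK := grpAlg_mono hNK hdN
  have hvK : ∀ X, v X ∈ grpAlg (Ω := Ω) Ω K := fun X => grpAlg_mono hNK (hη.s_mem X)
  have hrd : r (charIdem Ω φ) = 0 := by rw [← hθ.r_mul_e hdK, h0, map_zero]
  have hud : u (charIdem Ω φ) ≠ 0 := fun h => h2 (hη.mul_e_eq_zero_of_r_eq_zero hdN h)
  have hzero : ∀ X Y, r (v (X * u (charIdem Ω φ) * Y)) = 0 := by
    intro X Y
    rw [← hη.s_mul, ← hη.s_mul, hη.s_r _ hdN, hη.comm _ hdN, ← mul_assoc, hη.s_mul_e,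
      hθ.map_mul _ (mul_mem (hvK _) hdK) _ (hvK _), hθ.map_mul _ (hvK _) _ hdK, hrd, mul_zero,
      zero_mul]
  have htop := span_mul_mul_eq_top (T := Set.univ) Submodule.span_univ hud
  have hall : ∀ X, r (v X) = 0 := by
    intro X
    have hX : X ∈ Submodule.span Ω _ := htop ▸ Submodule.mem_top (x := X)
    refine Submodule.span_induction (fun W hW => ?_) (by rw [map_zero, map_zero])
      (fun X Y _ _ hX hY => by rw [map_add, map_add, hX, hY, add_zero])
      (fun c X _ hX => by rw [map_smul, map_smul, hX, smul_zero]) hX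
    obtain ⟨_, ⟨X, -, _, rfl, rfl⟩, Y, -, rfl⟩ := hW
    exact hzero X Y
  apply h1
  refine hθ.mul_e_eq_zero_of_r_eq_zero (grpAlg_mono hNK hη.e_mem) ?_
  rw [hη.e_eq, hall]

end

end MagicRep

end

theorem propositionp {G : Type*} [Group G] [Finite G]
    {F Ω : Type*} [Field F] [Field Ω] [IsAlgClosed Ω] [Algebra F Ω]
    (U H K N L : Subgroup G) (hHU : H ≤ U)
    (θ : K → Ω) (η : N → Ω) (φ : L → Ω)
    (hc₁ : MagicRep.Config.IsBasic F (⟨⊤, U, K, N, θ, η⟩ : MagicRep.Config G Ω))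
    (hc₂ : MagicRep.Config.IsBasic F (⟨U, H, N, L, η, φ⟩ : MagicRep.Config G Ω))
    (S₁₀ S₂₀ S₀ : NonUnitalSubalgebra F (MonoidAlgebra Ω G))
    (hS₀ : MagicRep.Config.IsScalarForm ⟨⊤, H, K, L, θ, φ⟩ S₀)
    (hprod : ∀ s₁ ∈ S₁₀, ∀ s₂ ∈ S₂₀, s₁ * s₂ ∈ S₀)
    (σ₁ : U ⧸ N.subgroupOf U → MonoidAlgebra Ω G)
    (σ₂ : H ⧸ L.subgroupOf H → MonoidAlgebra Ω G)
    (hσ₁ : MagicRep.Config.IsMagicCrossed ⟨⊤, U, K, N, θ, η⟩ S₁₀ σ₁)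
    (hσ₂ : MagicRep.Config.IsMagicCrossed ⟨U, H, N, L, η, φ⟩ S₂₀ σ₂) :
    ∃ σ : H ⧸ L.subgroupOf H → MonoidAlgebra Ω G,
      MagicRep.Config.IsMagicCrossed ⟨⊤, H, K, L, θ, φ⟩ S₀ σ ∧
      (∀ h : H, σ h * MagicRep.jIdem F θ η φ = σ₁ (⟨h, hHU h.2⟩ : U) * σ₂ h) ∧
      ∀ V : Subgroup G, K ≤ V →
        ∀ χ ∈ MagicRep.charSpan V (MagicRep.charIdem F θ),
        ∀ (h : G) (hV : h ∈ V) (hH : h ∈ H),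
          MagicRep.Config.iota ⟨⊤, H, K, L, θ, φ⟩ S₀ σ V χ ⟨h, hV, hH⟩ =
            MagicRep.Config.iota ⟨U, H, N, L, η, φ⟩ S₂₀ σ₂ (V ⊓ U)
              (MagicRep.Config.iota ⟨⊤, U, K, N, θ, η⟩ S₁₀ σ₁ V χ)
              ⟨h, ⟨hV, hHU hH⟩, hH⟩ := by
  have hηE : MagicRep.valueField F η = MagicRep.valueField F θ := hc₁.values
  have hφE : MagicRep.valueField F φ = MagicRep.valueField F θ := hc₂.values.trans hηE
  obtain ⟨hgal, hfin, n, m, r, s, u, v, hsθ, hsη, hne₁⟩ := hc₁.exists_split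
  obtain ⟨-, -, m', l, u', v', y, z, hsη', hsφ, hne₂⟩ := hc₂.exists_split
  dsimp only at hgal hfin hsθ hsη hne₁ hsη' hsφ hne₂
  obtain ⟨p₁⟩ := hc₁.nonempty_pair (E := MagicRep.valueField F θ) rfl
  obtain ⟨p₂⟩ := hc₂.nonempty_pair (E := MagicRep.valueField F θ) hηE
  dsimp only at p₁ p₂
  obtain ⟨p, hp⟩ := MagicRep.exists_pair hsθ p₂.split' (p₂.le.trans p₁.le) rfl hφE
    (MagicRep.charIdem_mul_ne_zero p₁.le p₂.le hsθ hsη hsφ hne₁ hne₂) p₂.a₀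
  have hsemi₁ : ∀ w ∈ U, ∃ γ : MagicRep.valueField F θ ≃ₐ[F] MagicRep.valueField F θ,
      MagicRep.SemiInv θ w γ ∧ MagicRep.SemiInv η w γ := fun w hw => hc₁.semiInv rfl hw
  have T : MagicRep.Tower U H p₁ p₂ p S₁₀ S₂₀ S₀ :=
    { form₁ := hσ₁.1
      form₂ := hσ₂.1
      form := hS₀
      semi₁ := hsemi₁
      semi := fun h hh => by
        obtain ⟨γ, h1, h2⟩ := hsemi₁ h (hHU hh)
        obtain ⟨δ, h3, h4⟩ := hc₂.semiInv (E := MagicRep.valueField F θ) hηE hh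
        dsimp only at h3 h4
        -- the action of a field automorphism is determined by the values of `η`
        have hγδ : γ = δ := MagicRep.gal_ext hηE fun k => by rw [h2.apply, h3.apply]
        exact ⟨γ, h1, h2, hγδ ▸ h4⟩
      factor := hc₂.factor
      H_le := hHU
      prod := hprod
      mu_eq := hp }
  obtain ⟨σ, ρ, hσ⟩ := T.exists_crossed hσ₁ hσ₂
  have hNU : N ≤ U := by
    have h1 : N = U ⊓ K := hc₁.L_eq
    rw [h1]
    exact inf_le_left
  refine ⟨σ, T.isMagicCrossed hσ₁ hσ₂ hσ, fun h => ?_, fun V hKV χ hχ h hV hH => ?_⟩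
  · rw [MagicRep.Tower.jIdem_eq p₁ p₂, (hσ h).2.2.2.2.2]
  · exact T.iota_eq hσ₁ hσ₂ hσ hNU hKV (MagicRep.apply_mul_comm_of_mem_charSpan hχ) hV hH
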